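/- **Setting.** Consider on $\mathbb R$ the Cauchy problem $$i(u_t+u_x)=G_1(u,v),\qquad i(v_t-v_x)=G_2(u,v),\qquad (u,v)|_{t=0}=(u_0,v_0),\tag{1}$$ for $\mathbb C$-valued $u,v$, where $G_1=\partial_{\bar u}W+F_1$, $G_2=\partial_{\bar v}W+F_2$ (Wirtinger derivatives) and - (A1) $W:\mathbb C^2\to\mathbb R$ is a real polynomial in $|u|^2$ and $|v|^2$; - (A2) $F_1,F_2$ are polynomials of degree at most three in $u,v,\bar u,\bar v$, and there is a constant $c>0$ with $|\bar uF_1(u,v)|+|\bar vF_2(u,v)|\le c|u|^2|v|^2$ for all $(u,v)\in\mathbb C^2$. (The inequality forces $F_1,F_2$ to be homogeneous of degree three.) A *classical solution* on $[0,T]\times\mathbb R$ is a pair of $C^1$ functions there that satisfies the two equations at every point. A pair $(u,v)\in C([0,\infty);L^2(\mathbb R))\cap L^\infty(\mathbb R\times[0,\infty))$ is a *global strong solution* of (1) if it satisfies the two equations in the sense of distributions on $(0,\infty)\times\mathbb R$ and if for every $T>0$ there are classical solutions $(u^n,v^n)$ on $[0,T]\times\mathbb R$, continuous in $t$ with values in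 $L^2(\mathbb R)$, such that $(u^n,v^n)\to(u,v)$ in $C([0,T];L^2(\mathbb R))$ and $(u^n,v^n)|_{t=0}\to(u_0,v_0)$ in $L^2(\mathbb R)$. **Theorem.** (i) For every $\alpha\in\mathbb R$ the following models satisfy (A1) and (A2): the massless Thirring model $W=\alpha|u|^2|v|^2$, $F_1=F_2=0$; the Federbusch model $W=\alpha(|u|^2+|v|^2)|u|^2|v|^2$, $F_1=F_2=0$; the massless Gross–Neveu model $W=0$, $(F_1,F_2)=(\partial_{\bar u},\partial_{\bar v})\,\alpha(\bar uv+u\bar v)^2$. (ii) For every $c>0$ there is $\delta>0$ such that for all $W,F_1,F_2$ satisfying (A1) and (A2) with this $c$, and all $u_0,v_0\in L^2(\mathbb R)\cap L^\infty(\mathbb R)$ with $\|u_0\|_{L^2}+\|v_0\|_{L^2}<\delta$, problem (1) has a unique global strong solution $(u,v)\in C([0,\infty);L^2(\mathbb R))\cap L^\infty(\mathbb R\times[0,\infty))$. Moreover, for all $a<b$, $$\int_a^b\big(|u(x,t)|^2+|v(x,t)|^2\big)\,dx\to0\qquad(t\to+\infty).$$ -/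

import Mathlib

open MeasureTheory Filter Topology Set
open scoped ENNReal ComplexConjugate ContDiff

noncomputable section

namespace NonlinearDirac

/-- The Wirtinger derivative `∂f/∂z̄ = (∂f/∂x + i ∂f/∂y) / 2` at the point `z = x + iy`. -/
def dbar (f : ℂ → ℂ) (z : ℂ) : ℂ :=
  (fderiv ℝ f z 1 + Complex.I * fderiv ℝ f z Complex.I) / 2

/-- `G₁ = ∂W/∂ū + F₁`. -/
def G₁ (W : ℂ → ℂ → ℝ) (F₁ : ℂ → ℂ → ℂ) (u v : ℂ) : ℂ :=
  dbar (fun z => (W z v : ℂ)) u + F₁ u v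

/-- `G₂ = ∂W/∂v̄ + F₂`. -/
def G₂ (W : ℂ → ℂ → ℝ) (F₂ : ℂ → ℂ → ℂ) (u v : ℂ) : ℂ :=
  dbar (fun z => (W u z : ℂ)) v + F₂ u v

/-- (A1): `W` is a real polynomial in `|u|²` and `|v|²`. -/
def A1 (W : ℂ → ℂ → ℝ) : Prop :=
  ∃ P : MvPolynomial (Fin 2) ℝ, ∀ u v : ℂ, W u v = MvPolynomial.eval ![‖u‖ ^ 2, ‖v‖ ^ 2] P

/-- `F` is a polynomial of degree at most three in `u, v, ū, v̄`. (The inequality in (A2) then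
forces it to be homogeneous of degree three.) -/
def IsCubic (F : ℂ → ℂ → ℂ) : Prop :=
  ∃ P : MvPolynomial (Fin 4) ℂ, P.totalDegree ≤ 3 ∧
    ∀ u v : ℂ, F u v = MvPolynomial.eval ![u, v, conj u, conj v] P

/-- (A2) with the constant `c`. -/
def A2 (c : ℝ) (F₁ F₂ : ℂ → ℂ → ℂ) : Prop :=
  IsCubic F₁ ∧ IsCubic F₂ ∧
    ∀ u v : ℂ, ‖conj u * F₁ u v‖ + ‖conj v * F₂ u v‖ ≤ c * (‖u‖ ^ 2 * ‖v‖ ^ 2)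

/-- The massless Thirring model. -/
def thirringW (α : ℝ) (u v : ℂ) : ℝ := α * (‖u‖ ^ 2 * ‖v‖ ^ 2)

/-- The Federbusch model. -/
def federbuschW (α : ℝ) (u v : ℂ) : ℝ := α * ((‖u‖ ^ 2 + ‖v‖ ^ 2) * (‖u‖ ^ 2 * ‖v‖ ^ 2))

/-- The massless Gross-Neveu potential `α (ūv + uv̄)²`. -/
def grossNeveu (α : ℝ) (u v : ℂ) : ℂ := α * (conj u * v + u * conj v) ^ 2

/-- Gross-Neveu nonlinearity in the equation for `u`. -/
def grossNeveuF₁ (α : ℝ) (u v : ℂ) : ℂ := dbar (fun z => grossNeveu α z v) u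

/-- Gross-Neveu nonlinearity in the equation for `v`. -/
def grossNeveuF₂ (α : ℝ) (u v : ℂ) : ℂ := dbar (fun z => grossNeveu α u z) v

/-- The complex Hilbert space `L²(ℝ)`. -/
abbrev L2 : Type := Lp ℂ 2 (volume : Measure ℝ)

/-- `u ∈ C([0,∞); L²(ℝ)) ∩ L^∞(ℝ × [0,∞))`. Only the values at times `t ≥ 0` matter. For an
`L²`-continuous curve, an essential bound on space-time is the same as an essential bound, with the
same constant, on each time slice. -/
def InSolutionSpace (u : ℝ → L2) : Prop :=
  ContinuousOn u (Ici 0) ∧ ∃ M : ℝ, ∀ t, 0 ≤ t → ∀ᵐ x : ℝ, ‖u t x‖ ≤ M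

/-- `(a, b)` (functions of `(t, x)`) is a classical solution of
`i (u_t + u_x) = G₁(u,v)`, `i (v_t - v_x) = G₂(u,v)` on `[0,T] × ℝ`: it is continuously
differentiable there and the equations hold at every point, with one-sided time derivatives at
`t = 0` and `t = T`. -/
structure IsClassicalSolution (W : ℂ → ℂ → ℝ) (F₁ F₂ : ℂ → ℂ → ℂ) (T : ℝ)
    (a b : ℝ → ℝ → ℂ) : Prop where
  contDiffOn_fst : ContDiffOn ℝ 1 (fun p : ℝ × ℝ => a p.1 p.2) (Icc 0 T ×ˢ univ)
  contDiffOn_snd : ContDiffOn ℝ 1 (fun p : ℝ × ℝ => b p.1 p.2) (Icc 0 T ×ˢ univ)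
  eq_fst : ∀ t ∈ Icc 0 T, ∀ x : ℝ,
    Complex.I * (derivWithin (fun s => a s x) (Icc 0 T) t + deriv (fun y => a t y) x)
      = G₁ W F₁ (a t x) (b t x)
  eq_snd : ∀ t ∈ Icc 0 T, ∀ x : ℝ,
    Complex.I * (derivWithin (fun s => b s x) (Icc 0 T) t - deriv (fun y => b t y) x)
      = G₂ W F₂ (a t x) (b t x)

/-- `φ ∈ C_c^∞((0,T) × ℝ)`. -/
structure IsTestFunction (T : ℝ) (φ : ℝ × ℝ → ℂ) : Prop where
  contDiff : ContDiff ℝ ∞ φ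
  hasCompactSupport : HasCompactSupport φ
  tsupport_subset : tsupport φ ⊆ Ioo 0 T ×ˢ univ

/-- The system holds in the sense of distributions on `(0,T) × ℝ`. This is used only for `u, v`
satisfying `InSolutionSpace`: then the inner integrands are integrable and the inner integrals are
continuous in `t`, so that the iterated integrals are the integrals over `(0,T) × ℝ`. -/
def SolvesInDistributions (W : ℂ → ℂ → ℝ) (F₁ F₂ : ℂ → ℂ → ℂ) (T : ℝ) (u v : ℝ → L2) : Prop :=
  ∀ φ : ℝ × ℝ → ℂ, IsTestFunction T φ →
    (-Complex.I * (∫ t in 0..T, ∫ x : ℝ, u t x * (fderiv ℝ φ (t, x) (1, 0) + fderiv ℝ φ (t, x) (0, 1)))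
      = ∫ t in 0..T, ∫ x : ℝ, G₁ W F₁ (u t x) (v t x) * φ (t, x)) ∧
    (-Complex.I * (∫ t in 0..T, ∫ x : ℝ, v t x * (fderiv ℝ φ (t, x) (1, 0) - fderiv ℝ φ (t, x) (0, 1)))
      = ∫ t in 0..T, ∫ x : ℝ, G₂ W F₂ (u t x) (v t x) * φ (t, x))

/-- `(u, v)` is, on `[0,T]`, the limit in `C([0,T]; L²)` of classical solutions whose initial values
converge to `(u₀, v₀)` in `L²`. -/
def IsLimitOfClassical (W : ℂ → ℂ → ℝ) (F₁ F₂ : ℂ → ℂ → ℂ) (u₀ v₀ : L2) (T : ℝ)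
    (u v : ℝ → L2) : Prop :=
  ∃ un vn : ℕ → ℝ → L2,
    (∀ n, ContinuousOn (un n) (Icc 0 T) ∧ ContinuousOn (vn n) (Icc 0 T) ∧
      ∃ a b : ℝ → ℝ → ℂ, IsClassicalSolution W F₁ F₂ T a b ∧
        ∀ t ∈ Icc 0 T, (un n t : ℝ → ℂ) =ᵐ[volume] a t ∧ (vn n t : ℝ → ℂ) =ᵐ[volume] b t) ∧
    TendstoUniformlyOn un u atTop (Icc 0 T) ∧
    TendstoUniformlyOn vn v atTop (Icc 0 T) ∧
    Tendsto (fun n => un n 0) atTop (𝓝 u₀) ∧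
    Tendsto (fun n => vn n 0) atTop (𝓝 v₀)

/-- `(u, v) ∈ C([0,∞); L²) ∩ L^∞` is a global strong solution with initial data `(u₀, v₀)`: it lies
in this space and, on every `[0,T]`, it is a limit of classical solutions and satisfies the
equations (in the sense of distributions). -/
structure IsGlobalStrongSolution (W : ℂ → ℂ → ℝ) (F₁ F₂ : ℂ → ℂ → ℂ) (u₀ v₀ : L2)
    (u v : ℝ → L2) : Prop where
  space_fst : InSolutionSpace u
  space_snd : InSolutionSpace v
  limit : ∀ T, 0 < T → IsLimitOfClassical W F₁ F₂ u₀ v₀ T u v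
  solves : ∀ T, 0 < T → SolvesInDistributions W F₁ F₂ T u v

end NonlinearDirac

end

/-! Write the system as `u_t + u_x = g₁`, `v_t - v_x = g₂` with `gⱼ = -i Gⱼ`. Along its own
characteristic `|u|²` has derivative `2 Re(ū g₁)`. The potential `W` contributes a real multiple of
`u` to `G₁`, hence nothing to this real part, and (A2) bounds the rest by `2c|u|²|v|²`; the same
holds for `v`. So `|u|²` and `|v|²` are densities travelling in opposite directions, each growing at
a rate at most `2c` times the other.

A characteristic of `u` crosses those of `v` transversally. If `|v|²` has grown by a factor at most
`e`, its integral along a characteristic of `u` is at most `e m / 2`, where `m` bounds the initial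
masses. When `2c e m ≤ 1` the exponent governing the growth of `|u|²` is then at most `1/2`,
although only the bound `1` was assumed. This gain closes a continuation argument
(`density_le_exp_one_mul`) and yields `|u(t,x)|² ≤ e |u₀(x-t)|²` and `|v(t,x)|² ≤ e |v₀(x+t)|²`.

Everything follows from these bounds. They depend on `c` only, so `δ` does not depend on `W`. They
bound the solution in the sup norm, so the nonlinearity may be cut off outside a ball, whatever its
degree. For the cut-off nonlinearity Picard iteration gives global `C¹` solutions
(`exists_classical_solution`), and the energy estimate for distributional transport equations
(`IsTransportSolution.norm_le`) with Grönwall's inequality gives Lipschitz dependence on the data in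
`L²`. That dependence makes smooth approximations converge and also proves uniqueness. The bounds
survive the limit, and the local charge decays because the mass of the translated data leaves every
bounded interval. -/

noncomputable section

namespace NonlinearDirac

/-! ### Duhamel's integral for one transport equation, with exponential weights in time. -/

section Duhamel

variable {F : Type*} [NormedAddCommGroup F] [NormedSpace ℝ F]

/-- The point at time `r t` on the characteristic of speed `s` through `(t, x)`, as a linear map
in `(t, x)`. -/
def backChar (s r : ℝ) : ℝ × ℝ →L[ℝ] ℝ × ℝ :=
  r • (ContinuousLinearMap.inl ℝ ℝ ℝ).comp (ContinuousLinearMap.fst ℝ ℝ ℝ) +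
    (ContinuousLinearMap.inr ℝ ℝ ℝ).comp (ContinuousLinearMap.snd ℝ ℝ ℝ) -
    (s * (1 - r)) • (ContinuousLinearMap.inr ℝ ℝ ℝ).comp (ContinuousLinearMap.fst ℝ ℝ ℝ)

@[simp]
theorem backChar_apply (s r : ℝ) (z : ℝ × ℝ) :
    backChar s r z = (r * z.1, z.2 - s * (1 - r) * z.1) := by
  simp [backChar]

theorem continuous_backChar (s : ℝ) : Continuous (backChar s) := by
  unfold backChar
  fun_prop

theorem norm_backChar_le {s r : ℝ} (hs : |s| ≤ 1) (hr : r ∈ Icc (0 : ℝ) 1) :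
    ‖backChar s r‖ ≤ 2 := by
  refine ContinuousLinearMap.opNorm_le_bound _ (by norm_num) fun z => ?_
  rw [backChar_apply, Prod.norm_mk, Real.norm_eq_abs, Real.norm_eq_abs]
  have h1 : |z.1| ≤ ‖z‖ := norm_fst_le z
  have h2 : |z.2| ≤ ‖z‖ := norm_snd_le z
  have h3 : |r| ≤ 1 := abs_le.2 ⟨by linarith [hr.1], hr.2⟩
  have h4 : |1 - r| ≤ 1 := abs_le.2 ⟨by linarith [hr.2], by linarith [hr.1]⟩
  have h0 := norm_nonneg z
  refine max_le ?_ ?_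
  · rw [abs_mul]
    nlinarith [abs_nonneg r, abs_nonneg z.1]
  · have h5 : |s * (1 - r)| ≤ 1 := by
      rw [abs_mul]
      exact mul_le_one₀ hs (abs_nonneg _) h4
    have h6 : |s * (1 - r) * z.1| ≤ ‖z‖ := by
      rw [abs_mul]
      nlinarith [abs_nonneg (s * (1 - r)), abs_nonneg z.1]
    linarith [abs_sub z.2 (s * (1 - r) * z.1)]

/-- The solution of `w_t + s w_x = η` with zero initial value. -/
def duhamel (s : ℝ) (η : ℝ × ℝ → F) (z : ℝ × ℝ) : F :=
  -- The substitution `τ = r t` makes the endpoints independent of `t`, so that derivatives in `(t,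
  -- x)` pass under the integral without boundary terms.
  ∫ r in (0 : ℝ)..1, z.1 • η (backChar s r z)

theorem continuous_comp_backChar {X : Type*} [TopologicalSpace X] {η : ℝ × ℝ → X}
    (hη : Continuous η) (s : ℝ) :
    Continuous fun p : (ℝ × ℝ) × ℝ => η (backChar s p.2 p.1) := by
  simp only [backChar_apply]
  fun_prop

theorem duhamel_sub {η₁ η₂ : ℝ × ℝ → F} (h₁ : Continuous η₁) (h₂ : Continuous η₂) (s : ℝ)
    (z : ℝ × ℝ) : duhamel s η₁ z - duhamel s η₂ z = duhamel s (fun y => η₁ y - η₂ y) z := by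
  unfold duhamel
  rw [← intervalIntegral.integral_sub]
  · simp only [smul_sub]
  · exact (((continuous_comp_backChar h₁ s).comp (Continuous.prodMk_right z)).const_smul
      z.1).intervalIntegrable _ _
  · exact (((continuous_comp_backChar h₂ s).comp (Continuous.prodMk_right z)).const_smul
      z.1).intervalIntegrable _ _

/-- The factor `1 / μ` gained here makes Duhamel's integral contracting for the weight `exp(μ|t|)`
on all of time at once, so no short time steps need to be glued. -/
theorem integral_abs_mul_exp_le {μ : ℝ} (hμ : 0 < μ) (t : ℝ) :
    ∫ r in (0 : ℝ)..1, |t| * Real.exp (μ * (r * |t|)) ≤ Real.exp (μ * |t|) / μ := by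
  have h : ∀ r ∈ uIcc (0 : ℝ) 1, HasDerivAt (fun r => Real.exp (μ * (r * |t|)) / μ)
      (|t| * Real.exp (μ * (r * |t|))) r := by
    intro r _
    have h1 : HasDerivAt (fun r : ℝ => μ * (r * |t|)) (μ * (1 * |t|)) r :=
      ((hasDerivAt_id r).mul_const _).const_mul _
    convert! h1.exp.div_const μ using 1
    field_simp
  rw [intervalIntegral.integral_eq_sub_of_hasDerivAt h
    (Continuous.intervalIntegrable (by fun_prop) _ _)]
  simp
  positivity

theorem norm_duhamel_le {η : ℝ × ℝ → F} {C μ : ℝ} (hμ : 0 < μ)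
    (h : ∀ z, ‖η z‖ ≤ C * Real.exp (μ * |z.1|)) (s : ℝ) (z : ℝ × ℝ) :
    ‖duhamel s η z‖ ≤ C / μ * Real.exp (μ * |z.1|) := by
  have hC : 0 ≤ C := by simpa using (norm_nonneg _).trans (h 0)
  calc ‖duhamel s η z‖ ≤ ∫ r in (0 : ℝ)..1, C * (|z.1| * Real.exp (μ * (r * |z.1|))) := by
        refine intervalIntegral.norm_integral_le_of_norm_le zero_le_one (ae_of_all _ fun r hr => ?_)
          (Continuous.intervalIntegrable (by fun_prop) _ _)
        rw [norm_smul, Real.norm_eq_abs]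
        have := h (backChar s r z)
        rw [backChar_apply] at this ⊢
        rw [abs_mul, abs_of_pos hr.1] at this
        nlinarith [abs_nonneg z.1]
    _ = C * ∫ r in (0 : ℝ)..1, |z.1| * Real.exp (μ * (r * |z.1|)) :=
        intervalIntegral.integral_const_mul _ _
    _ ≤ C * (Real.exp (μ * |z.1|) / μ) := by gcongr; exact integral_abs_mul_exp_le hμ _
    _ = _ := by ring

theorem hasFDerivAt_duhamel {η : ℝ × ℝ → F} (hη : ContDiff ℝ 1 η) (s : ℝ) (z : ℝ × ℝ) :
    HasFDerivAt (duhamel s η) (∫ r in (0 : ℝ)..1,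
      (z.1 • (fderiv ℝ η (backChar s r z)).comp (backChar s r) +
        (ContinuousLinearMap.fst ℝ ℝ ℝ).smulRight (η (backChar s r z)))) z := by
  have hc : Continuous fun p : (ℝ × ℝ) × ℝ =>
      p.1.1 • (fderiv ℝ η (backChar s p.2 p.1)).comp (backChar s p.2) +
        (ContinuousLinearMap.fst ℝ ℝ ℝ).smulRight (η (backChar s p.2 p.1)) := by
    refine Continuous.add ?_ ?_
    · refine (by fun_prop : Continuous fun p : (ℝ × ℝ) × ℝ => p.1.1).smul ?_
      exact (continuous_comp_backChar (hη.continuous_fderiv one_ne_zero) s).clm_comp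
        ((continuous_backChar s).comp continuous_snd)
    · exact (ContinuousLinearMap.smulRightL ℝ (ℝ × ℝ) F
        (ContinuousLinearMap.fst ℝ ℝ ℝ)).continuous.comp
        (continuous_comp_backChar hη.continuous s)
  -- The dominating function is a constant: the derivative of the integrand is jointly continuous,
  -- hence bounded on a compact set.
  obtain ⟨B, hB⟩ := ((isCompact_closedBall z 1).prod
      (isCompact_Icc (a := (0 : ℝ)) (b := 1))).bddAbove_image
    hc.norm.continuousOn
  refine intervalIntegral.hasFDerivAt_integral_of_dominated_of_fderiv_le (bound := fun _ => B)
    (F' := fun z r => z.1 • (fderiv ℝ η (backChar s r z)).comp (backChar s r) +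
        (ContinuousLinearMap.fst ℝ ℝ ℝ).smulRight (η (backChar s r z)))
    (Metric.closedBall_mem_nhds z one_pos) ?_ ?_ ?_ ?_ ?_ ?_
  · exact Eventually.of_forall fun y => Continuous.aestronglyMeasurable
      (((continuous_comp_backChar hη.continuous s).comp (Continuous.prodMk_right y)).const_smul y.1)
  · exact Continuous.intervalIntegrable
      (((continuous_comp_backChar hη.continuous s).comp (Continuous.prodMk_right z)).const_smul
        z.1) _ _
  · exact Continuous.aestronglyMeasurable (hc.comp (Continuous.prodMk_right z))
  · refine ae_of_all _ fun r hr y hy => hB ⟨(y, r), ⟨hy, ?_⟩, rfl⟩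
    rw [uIoc_of_le zero_le_one] at hr
    exact ⟨hr.1.le, hr.2⟩
  · simp
  · refine ae_of_all _ fun r _ y _ => ?_
    have h1 : HasFDerivAt η (fderiv ℝ η (backChar s r y)) (backChar s r y) :=
      (hη.differentiable one_ne_zero _).hasFDerivAt
    exact hasFDerivAt_fst.smul (h1.comp y (backChar s r).hasFDerivAt)

theorem contDiff_duhamel {η : ℝ × ℝ → F} (hη : ContDiff ℝ 1 η) (s : ℝ) :
    ContDiff ℝ 1 (duhamel s η) := by
  refine contDiff_one_iff_hasFDerivAt.2 ⟨_, ?_, hasFDerivAt_duhamel hη s⟩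
  refine intervalIntegral.continuous_parametric_intervalIntegral_of_continuous' ?_ _ _
  refine Continuous.add ?_ ?_
  · refine (by fun_prop : Continuous fun p : (ℝ × ℝ) × ℝ => p.1.1).smul ?_
    exact (continuous_comp_backChar (hη.continuous_fderiv one_ne_zero) s).clm_comp
      ((continuous_backChar s).comp continuous_snd)
  · exact (ContinuousLinearMap.smulRightL ℝ (ℝ × ℝ) F
      (ContinuousLinearMap.fst ℝ ℝ ℝ)).continuous.comp
      (continuous_comp_backChar hη.continuous s)

/-- Differentiating `η` along `backChar`, whose norm is at most `2`, gives the term with the gain `1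
/ μ`. Differentiating the prefactor `t` gives the term `C`, which has no gain but involves only `η`
itself. -/
theorem norm_fderiv_duhamel_le {η : ℝ × ℝ → F} (hη : ContDiff ℝ 1 η) {C C' μ s : ℝ} (hμ : 0 < μ)
    (hs : |s| ≤ 1) (h : ∀ z, ‖η z‖ ≤ C * Real.exp (μ * |z.1|))
    (h' : ∀ z, ‖fderiv ℝ η z‖ ≤ C' * Real.exp (μ * |z.1|)) (z : ℝ × ℝ) :
    ‖fderiv ℝ (duhamel s η) z‖ ≤ (C + 2 * C' / μ) * Real.exp (μ * |z.1|) := by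
  have hC : 0 ≤ C := by simpa using (norm_nonneg _).trans (h 0)
  have hC' : 0 ≤ C' := by simpa using (norm_nonneg _).trans (h' 0)
  rw [(hasFDerivAt_duhamel hη s z).fderiv]
  calc _ ≤ ∫ r in (0 : ℝ)..1, (2 * C' * (|z.1| * Real.exp (μ * (r * |z.1|)))
            + C * Real.exp (μ * |z.1|)) := by
        refine intervalIntegral.norm_integral_le_of_norm_le zero_le_one (ae_of_all _ fun r hr => ?_)
          (Continuous.intervalIntegrable (by fun_prop) _ _)
        have e1 := h (backChar s r z)
        have e2 := h' (backChar s r z)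
        have e0 : |(backChar s r z).1| = r * |z.1| := by
          rw [backChar_apply, abs_mul, abs_of_pos hr.1]
        rw [e0] at e1 e2
        refine (norm_add_le _ _).trans (add_le_add ?_ ?_)
        · rw [norm_smul, Real.norm_eq_abs]
          have := (ContinuousLinearMap.opNorm_comp_le (fderiv ℝ η (backChar s r z))
            (backChar s r)).trans (mul_le_mul e2 (norm_backChar_le hs ⟨hr.1.le, hr.2⟩)
              (norm_nonneg _) (by positivity))
          nlinarith [abs_nonneg z.1]
        · rw [ContinuousLinearMap.norm_smulRight_apply]
          have e3 : C * Real.exp (μ * (r * |z.1|)) ≤ C * Real.exp (μ * |z.1|) := by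
            gcongr
            nlinarith [abs_nonneg z.1, hr.2]
          have e4 := ContinuousLinearMap.norm_fst_le ℝ ℝ ℝ
          nlinarith [norm_nonneg (η (backChar s r z)), norm_nonneg (ContinuousLinearMap.fst ℝ ℝ ℝ)]
    _ = 2 * C' * (∫ r in (0 : ℝ)..1, |z.1| * Real.exp (μ * (r * |z.1|)))
          + C * Real.exp (μ * |z.1|) := by
        rw [intervalIntegral.integral_add (Continuous.intervalIntegrable (by fun_prop) _ _)
          (by simp), intervalIntegral.integral_const_mul]
        simp
    _ ≤ 2 * C' * (Real.exp (μ * |z.1|) / μ) + C * Real.exp (μ * |z.1|) := by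
        gcongr; exact integral_abs_mul_exp_le hμ _
    _ = _ := by ring

/-- Undoing the substitution `τ = r t` recovers the usual integral along the characteristic, which
the fundamental theorem of calculus can differentiate. -/
theorem duhamel_along [CompleteSpace F] (s : ℝ) (η : ℝ × ℝ → F) (t y : ℝ) :
    duhamel s η (t, y + s * t) = ∫ τ in (0 : ℝ)..t, η (τ, y + s * τ) := by
  unfold duhamel
  simp only [backChar_apply]
  rw [intervalIntegral.integral_smul]
  have := intervalIntegral.smul_integral_comp_mul_right (a := 0) (b := 1)
    (fun τ => η (τ, y + s * τ)) t
  simp only [zero_mul, one_mul] at this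
  rw [← this]
  congr 1
  refine intervalIntegral.integral_congr fun r _ => ?_
  congr 2
  ring

end Duhamel

/-! ### Picard iteration in `C¹` for semilinear transport systems. -/

section Picard

variable {ι : Type*}

/-- The Duhamel operator of a family of transport equations with speeds `σ i`. -/
def systemDuhamel (σ : ι → ℝ) (η : ℝ × ℝ → ι → ℂ) (z : ℝ × ℝ) (i : ι) : ℂ :=
  duhamel (σ i) (fun y => η y i) z

theorem contDiff_systemDuhamel [Fintype ι] {σ : ι → ℝ} {η : ℝ × ℝ → ι → ℂ} (hη : ContDiff ℝ 1 η) :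
    ContDiff ℝ 1 (systemDuhamel σ η) :=
  contDiff_pi.2 fun i => contDiff_duhamel (contDiff_pi.1 hη i) (σ i)

theorem systemDuhamel_sub {σ : ι → ℝ} {η₁ η₂ : ℝ × ℝ → ι → ℂ} (h₁ : Continuous η₁)
    (h₂ : Continuous η₂) (z : ℝ × ℝ) :
    systemDuhamel σ η₁ z - systemDuhamel σ η₂ z = systemDuhamel σ (fun y => η₁ y - η₂ y) z := by
  ext i
  exact duhamel_sub (continuous_pi_iff.1 h₁ i) (continuous_pi_iff.1 h₂ i) (σ i) z

variable [Fintype ι]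

theorem norm_systemDuhamel_le {σ : ι → ℝ} {η : ℝ × ℝ → ι → ℂ} {C μ : ℝ} (hμ : 0 < μ)
    (h : ∀ z, ‖η z‖ ≤ C * Real.exp (μ * |z.1|)) (z : ℝ × ℝ) :
    ‖systemDuhamel σ η z‖ ≤ C / μ * Real.exp (μ * |z.1|) := by
  have hC : 0 ≤ C := by simpa using (norm_nonneg _).trans (h 0)
  exact (pi_norm_le_iff_of_nonneg (by positivity)).2 fun i =>
    norm_duhamel_le hμ (fun y => (norm_le_pi_norm (η y) i).trans (h y)) (σ i) z

theorem fderiv_pi_apply' {η : ℝ × ℝ → ι → ℂ} (hη : ContDiff ℝ 1 η) (z v : ℝ × ℝ) (i : ι) :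
    fderiv ℝ η z v i = fderiv ℝ (fun y => η y i) z v := by
  rw [fderiv_pi fun i => (contDiff_pi.1 hη i).differentiable one_ne_zero z]
  rfl

theorem norm_fderiv_systemDuhamel_le {σ : ι → ℝ} (hσ : ∀ i, |σ i| ≤ 1) {η : ℝ × ℝ → ι → ℂ}
    (hη : ContDiff ℝ 1 η) {C C' μ : ℝ} (hμ : 0 < μ)
    (h : ∀ z, ‖η z‖ ≤ C * Real.exp (μ * |z.1|))
    (h' : ∀ z, ‖fderiv ℝ η z‖ ≤ C' * Real.exp (μ * |z.1|)) (z : ℝ × ℝ) :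
    ‖fderiv ℝ (systemDuhamel σ η) z‖ ≤ (C + 2 * C' / μ) * Real.exp (μ * |z.1|) := by
  have hC : 0 ≤ C := by simpa using (norm_nonneg _).trans (h 0)
  have hC' : 0 ≤ C' := by simpa using (norm_nonneg _).trans (h' 0)
  refine ContinuousLinearMap.opNorm_le_bound _ (by positivity) fun v =>
    (pi_norm_le_iff_of_nonneg (by positivity)).2 fun i => ?_
  rw [fderiv_pi_apply' (contDiff_systemDuhamel hη)]
  refine (ContinuousLinearMap.le_opNorm _ v).trans ?_
  gcongr
  refine norm_fderiv_duhamel_le (contDiff_pi.1 hη i) hμ (hσ i)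
    (fun y => (norm_le_pi_norm (η y) i).trans (h y)) (fun y => ?_) z
  refine le_trans ?_ (h' y)
  refine ContinuousLinearMap.opNorm_le_bound _ (norm_nonneg _) fun v => ?_
  rw [← fderiv_pi_apply' hη]
  exact (norm_le_pi_norm _ i).trans (ContinuousLinearMap.le_opNorm _ v)

/-- The Picard iterates for `w = Φ + systemDuhamel σ (h ∘ w)`. -/
def picardIterate (σ : ι → ℝ) (h : (ι → ℂ) → ι → ℂ) (Φ : ℝ × ℝ → ι → ℂ) :
    ℕ → ℝ × ℝ → ι → ℂ
  | 0 => fun _ => 0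
  | k + 1 => fun z => Φ z + systemDuhamel σ (fun y => h (picardIterate σ h Φ k y)) z

variable {σ : ι → ℝ} {h : (ι → ℂ) → ι → ℂ} {Φ : ℝ × ℝ → ι → ℂ} {L K B : ℝ}

theorem contDiff_picardIterate (hh : ContDiff ℝ 1 h) (hΦ : ContDiff ℝ 1 Φ) (k : ℕ) :
    ContDiff ℝ 1 (picardIterate σ h Φ k) := by
  induction k with
  | zero => exact contDiff_const
  | succ k ih => exact hΦ.add (contDiff_systemDuhamel (hh.comp ih))

theorem picardIterate_succ_sub_succ (hh : ContDiff ℝ 1 h) (hΦ : ContDiff ℝ 1 Φ) (k : ℕ) :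
    (fun z => picardIterate σ h Φ (k + 2) z - picardIterate σ h Φ (k + 1) z) =
      systemDuhamel σ
        (fun y => h (picardIterate σ h Φ (k + 1) y) - h (picardIterate σ h Φ k y)) := by
  ext1 z
  have hc : ∀ k, Continuous fun y => h (picardIterate σ h Φ k y) := fun k =>
    hh.continuous.comp (contDiff_picardIterate hh hΦ k).continuous
  rw [← systemDuhamel_sub (hc (k + 1)) (hc k)]
  simp [picardIterate]

theorem fderiv_comp_apply_eq {w : ℝ × ℝ → ι → ℂ} (hh : ContDiff ℝ 1 h) (hw : ContDiff ℝ 1 w)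
    (z : ℝ × ℝ) :
    fderiv ℝ (fun y => h (w y)) z = (fderiv ℝ h (w z)).comp (fderiv ℝ w z) :=
  fderiv_comp z (hh.differentiable one_ne_zero _) (hw.differentiable one_ne_zero _)

/-- The bound reproduces itself because of the rate `4L + 1`: the new derivative is at most `B + L +
4L(B + L)/(4L + 1) ≤ 2(B + L)` times the weight. -/
theorem norm_fderiv_picardIterate_le (hσ : ∀ i, |σ i| ≤ 1) (hh : ContDiff ℝ 1 h)
    (hΦ : ContDiff ℝ 1 Φ) (hL : ∀ y, ‖h y‖ ≤ L) (hL' : ∀ y, ‖fderiv ℝ h y‖ ≤ L)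
    (hB' : ∀ z, ‖fderiv ℝ Φ z‖ ≤ B) (k : ℕ) (z : ℝ × ℝ) :
    ‖fderiv ℝ (picardIterate σ h Φ k) z‖ ≤
      2 * (B + L) * Real.exp ((4 * L + 1) * |z.1|) := by
  have hL0 : 0 ≤ L := (norm_nonneg _).trans (hL 0)
  have hB0 : 0 ≤ B := (norm_nonneg _).trans (hB' 0)
  induction k generalizing z with
  | zero =>
    have : fderiv ℝ (picardIterate σ h Φ 0) z = 0 := fderiv_const_apply _
    rw [this, norm_zero]
    positivity
  | succ k ih =>
    have hk := contDiff_picardIterate (σ := σ) hh hΦ k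
    have hη : ContDiff ℝ 1 fun y => h (picardIterate σ h Φ k y) := hh.comp hk
    have e0 : ∀ z : ℝ × ℝ, 1 ≤ Real.exp ((4 * L + 1) * |z.1|) := fun z =>
      Real.one_le_exp (by positivity)
    have e : fderiv ℝ (picardIterate σ h Φ (k + 1)) z = fderiv ℝ Φ z +
        fderiv ℝ (systemDuhamel σ fun y => h (picardIterate σ h Φ k y)) z :=
      fderiv_add (hΦ.differentiable one_ne_zero _)
        ((contDiff_systemDuhamel hη).differentiable one_ne_zero _)
    have e2 := norm_fderiv_systemDuhamel_le hσ hη (C := L) (C' := L * (2 * (B + L)))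
      (μ := 4 * L + 1) (by positivity) (fun z => (hL _).trans (le_mul_of_one_le_right hL0 (e0 z)))
      (fun z => by
        rw [fderiv_comp_apply_eq hh hk]
        refine (ContinuousLinearMap.opNorm_comp_le _ _).trans ?_
        rw [mul_assoc]
        exact mul_le_mul (hL' _) (ih z) (norm_nonneg _) hL0) z
    rw [e]
    refine (norm_add_le _ _).trans ?_
    have e3 : 2 * (L * (2 * (B + L))) / (4 * L + 1) ≤ B + L := by
      rw [div_le_iff₀ (by positivity)]
      nlinarith
    have e4 := hB' z
    nlinarith [e0 z]

/-- Each step multiplies the weighted difference by at most `L/(4L + 1) ≤ 1/2`. -/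
theorem norm_picardIterate_succ_sub_le (hh : ContDiff ℝ 1 h)
    (hΦ : ContDiff ℝ 1 Φ) (hL : ∀ y, ‖h y‖ ≤ L) (hLL : ∀ x y, ‖h x - h y‖ ≤ L * ‖x - y‖)
    (hB : ∀ z, ‖Φ z‖ ≤ B) (k : ℕ) (z : ℝ × ℝ) :
    ‖picardIterate σ h Φ (k + 1) z - picardIterate σ h Φ k z‖ ≤
      (B + L) * (1 / 2) ^ k * Real.exp ((4 * L + 1) * |z.1|) := by
  have hL0 : 0 ≤ L := (norm_nonneg _).trans (hL 0)
  have hB0 : 0 ≤ B := (norm_nonneg _).trans (hB 0)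
  have e0 : ∀ z : ℝ × ℝ, 1 ≤ Real.exp ((4 * L + 1) * |z.1|) := fun z =>
    Real.one_le_exp (by positivity)
  induction k generalizing z with
  | zero =>
    have := norm_systemDuhamel_le (σ := σ) (η := fun _ => h 0) (C := L) (μ := 4 * L + 1)
      (by positivity) (fun z => (hL _).trans (le_mul_of_one_le_right hL0 (e0 z))) z
    have e3 : L / (4 * L + 1) ≤ L := div_le_self hL0 (by linarith)
    simp only [picardIterate, sub_zero, pow_zero, mul_one]
    refine (norm_add_le _ _).trans ?_
    nlinarith [hB z, e0 z]
  | succ k ih =>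
    rw [congrFun (picardIterate_succ_sub_succ hh hΦ k) z]
    refine (norm_systemDuhamel_le (C := L * ((B + L) * (1 / 2) ^ k)) (μ := 4 * L + 1)
      (by positivity) (fun z => ?_) z).trans ?_
    · rw [mul_assoc]
      exact (hLL _ _).trans (by gcongr; exact ih z)
    · gcongr
      rw [div_le_iff₀ (by positivity), pow_succ]
      have : 0 ≤ (B + L) * (1 / 2) ^ k := by positivity
      nlinarith

/-- Convergence of derivatives needs `Dh` to be Lipschitz. The resulting error is a product of a
difference of iterates and a derivative of an iterate, each carrying the weight once; hence the
doubled rate in the exponent. -/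
theorem norm_fderiv_picardIterate_succ_sub_le (hσ : ∀ i, |σ i| ≤ 1) (hh : ContDiff ℝ 1 h)
    (hΦ : ContDiff ℝ 1 Φ) (hL : ∀ y, ‖h y‖ ≤ L) (hL' : ∀ y, ‖fderiv ℝ h y‖ ≤ L)
    (hLL : ∀ x y, ‖h x - h y‖ ≤ L * ‖x - y‖) (hK : 0 ≤ K)
    (hKK : ∀ x y, ‖fderiv ℝ h x - fderiv ℝ h y‖ ≤ K * ‖x - y‖)
    (hB : ∀ z, ‖Φ z‖ ≤ B) (hB' : ∀ z, ‖fderiv ℝ Φ z‖ ≤ B) (k : ℕ) (z : ℝ × ℝ) :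
    ‖fderiv ℝ (fun z => picardIterate σ h Φ (k + 1) z - picardIterate σ h Φ k z) z‖ ≤
      (4 * (L * (B + L) + K * (B + L) * (2 * (B + L))) + 2 * (B + L)) * (1 / 2) ^ k *
        Real.exp (2 * (4 * L + 1) * |z.1|) := by
  have hL0 : 0 ≤ L := (norm_nonneg _).trans (hL 0)
  have hB0 : 0 ≤ B := (norm_nonneg _).trans (hB 0)
  set C := B + L with hC
  have hC0 : 0 ≤ C := by positivity
  -- The induction step needs `LC + 2KC² + C'/4 ≤ C'/2`, which the first summand provides; the
  -- second covers `k = 0`.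
  set C' := 4 * (L * C + K * C * (2 * C)) + 2 * C with hC'
  have hC'0 : 0 ≤ C' := by positivity
  have e1 : ∀ z : ℝ × ℝ, Real.exp ((4 * L + 1) * |z.1|) ≤ Real.exp (2 * (4 * L + 1) * |z.1|) := by
    intro z
    have : 0 ≤ (4 * L + 1) * |z.1| := by positivity
    exact Real.exp_le_exp.2 (by linarith)
  have e2 : ∀ z : ℝ × ℝ, Real.exp ((4 * L + 1) * |z.1|) * Real.exp ((4 * L + 1) * |z.1|) =
      Real.exp (2 * (4 * L + 1) * |z.1|) := by
    intro z
    rw [← Real.exp_add]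
    ring_nf
  have hw := contDiff_picardIterate (σ := σ) hh hΦ
  induction k generalizing z with
  | zero =>
    have := norm_fderiv_picardIterate_le hσ hh hΦ hL hL' hB' 1 z
    have e3 : 2 * C ≤ C' := by
      have : 0 ≤ 4 * (L * C + K * C * (2 * C)) := by positivity
      linarith
    simp only [picardIterate, sub_zero, pow_zero, mul_one] at this ⊢
    exact this.trans (mul_le_mul e3 (e1 z) (by positivity) hC'0)
  | succ k ih =>
    rw [picardIterate_succ_sub_succ hh hΦ k]
    have hη : ContDiff ℝ 1 fun y =>
        h (picardIterate σ h Φ (k + 1) y) - h (picardIterate σ h Φ k y) :=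
      (hh.comp (hw _)).sub (hh.comp (hw _))
    have p0 : (0 : ℝ) ≤ (1 / 2) ^ k := by positivity
    have hd := norm_picardIterate_succ_sub_le (σ := σ) hh hΦ hL hLL hB k
    refine (norm_fderiv_systemDuhamel_le hσ hη (C := L * (C * (1 / 2) ^ k))
      (C' := L * (C' * (1 / 2) ^ k) + K * (C * (1 / 2) ^ k) * (2 * C))
      (μ := 2 * (4 * L + 1)) (by positivity) (fun z => ?_) (fun z => ?_) z).trans ?_
    · rw [mul_assoc]
      refine (hLL _ _).trans ?_
      gcongr
      exact (hd z).trans (mul_le_mul_of_nonneg_left (e1 z) (by positivity))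
    · have e : fderiv ℝ (fun y => h (picardIterate σ h Φ (k + 1) y) -
          h (picardIterate σ h Φ k y)) z =
          (fderiv ℝ h (picardIterate σ h Φ (k + 1) z)).comp (fderiv ℝ
            (fun z => picardIterate σ h Φ (k + 1) z - picardIterate σ h Φ k z) z) +
          (fderiv ℝ h (picardIterate σ h Φ (k + 1) z) -
            fderiv ℝ h (picardIterate σ h Φ k z)).comp (fderiv ℝ (picardIterate σ h Φ k) z) := by
        have hd' : ∀ k, DifferentiableAt ℝ (fun y => h (picardIterate σ h Φ k y)) z := fun k =>
          (hh.comp (hw k)).differentiable one_ne_zero z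
        rw [fderiv_fun_sub (hd' _) (hd' _), fderiv_comp_apply_eq hh (hw _),
          fderiv_comp_apply_eq hh (hw _), fderiv_fun_sub ((hw _).differentiable one_ne_zero _)
          ((hw _).differentiable one_ne_zero _), ContinuousLinearMap.comp_sub,
          ContinuousLinearMap.sub_comp]
        abel
      rw [e, add_mul]
      refine (norm_add_le _ _).trans (add_le_add ?_ ?_)
      · rw [mul_assoc]
        exact (ContinuousLinearMap.opNorm_comp_le _ _).trans
          (mul_le_mul (hL' _) (ih z) (norm_nonneg _) hL0)
      · refine (ContinuousLinearMap.opNorm_comp_le _ _).trans ?_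
        rw [← e2]
        calc _ ≤ (K * (C * (1 / 2) ^ k * Real.exp ((4 * L + 1) * |z.1|))) *
              (2 * C * Real.exp ((4 * L + 1) * |z.1|)) := by
              refine mul_le_mul ((hKK _ _).trans ?_)
                (norm_fderiv_picardIterate_le hσ hh hΦ hL hL' hB' k z) (norm_nonneg _)
                (by positivity)
              gcongr
              exact hd z
          _ = _ := by ring
    · gcongr
      have e5 : 2 * (L * (C' * (1 / 2) ^ k) + K * (C * (1 / 2) ^ k) * (2 * C)) /
          (2 * (4 * L + 1)) ≤ (C' / 4 + K * C * (2 * C)) * (1 / 2) ^ k := by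
        rw [div_le_iff₀ (by positivity)]
        have : 0 ≤ K * C * (2 * C) := by positivity
        have h3 : L * C' + K * C * (2 * C) ≤ (C' / 4 + K * C * (2 * C)) * (4 * L + 1) := by
          nlinarith
        nlinarith
      rw [pow_succ]
      have : L * C + C' / 4 + K * C * (2 * C) ≤ C' / 2 := by
        have : 0 ≤ C := hC0
        linarith
      nlinarith

/-- The telescoping series of the iterates and that of their derivatives converge geometrically,
uniformly on each strip `|t| ≤ T`. Hence the limit is `C¹` and the fixed point equation passes to
it. -/
theorem exists_contDiff_fixedPoint (hσ : ∀ i, |σ i| ≤ 1) (hh : ContDiff ℝ 1 h)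
    (hΦ : ContDiff ℝ 1 Φ) (hL : ∀ y, ‖h y‖ ≤ L) (hL' : ∀ y, ‖fderiv ℝ h y‖ ≤ L)
    (hLL : ∀ x y, ‖h x - h y‖ ≤ L * ‖x - y‖) (hK : 0 ≤ K)
    (hKK : ∀ x y, ‖fderiv ℝ h x - fderiv ℝ h y‖ ≤ K * ‖x - y‖)
    (hB : ∀ z, ‖Φ z‖ ≤ B) (hB' : ∀ z, ‖fderiv ℝ Φ z‖ ≤ B) :
    ∃ w : ℝ × ℝ → ι → ℂ, ContDiff ℝ 1 w ∧
      (∀ z, w z = Φ z + systemDuhamel σ (fun y => h (w y)) z) ∧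
      ∀ T, ∃ M, ∀ z : ℝ × ℝ, |z.1| ≤ T → ‖w z‖ ≤ M := by
  have hL0 : 0 ≤ L := (norm_nonneg _).trans (hL 0)
  have hB0 : 0 ≤ B := (norm_nonneg _).trans (hB 0)
  set C' := 4 * (L * (B + L) + K * (B + L) * (2 * (B + L))) + 2 * (B + L) with hC'
  have hC'0 : 0 ≤ C' := by positivity
  set W := picardIterate σ h Φ with hW
  have hw : ∀ k, ContDiff ℝ 1 (W k) := contDiff_picardIterate (σ := σ) hh hΦ
  set d : ℕ → ℝ × ℝ → ι → ℂ := fun k z => W (k + 1) z - W k z with hd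
  have hdc : ∀ k, ContDiff ℝ 1 (d k) := fun k => (hw _).sub (hw _)
  have d1 : ∀ k z, ‖d k z‖ ≤ (B + L) * (1 / 2) ^ k * Real.exp ((4 * L + 1) * |z.1|) :=
    norm_picardIterate_succ_sub_le (σ := σ) hh hΦ hL hLL hB
  have d2 : ∀ k z, ‖fderiv ℝ (d k) z‖ ≤ C' * (1 / 2) ^ k * Real.exp (2 * (4 * L + 1) * |z.1|) :=
    norm_fderiv_picardIterate_succ_sub_le hσ hh hΦ hL hL' hLL hK hKK hB hB'
  have hs : ∀ a b : ℝ, Summable fun k : ℕ => a * (1 / 2) ^ k * b := fun a b =>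
    (summable_geometric_two.mul_left a).mul_right b
  have hsum : ∀ z, Summable fun k => d k z := fun z =>
    Summable.of_norm_bounded (hs _ _) (fun k => d1 k z)
  have hpart : ∀ n z, ∑ k ∈ Finset.range n, d k z = W n z := by
    intro n z
    rw [hd, Finset.sum_range_sub (fun k => W k z)]
    simp [hW, picardIterate]
  set w : ℝ × ℝ → ι → ℂ := fun z => ∑' k, d k z with hwdef
  have htail : ∀ n z, ‖w z - W n z‖ ≤
      2 * (B + L) * (1 / 2) ^ n * Real.exp ((4 * L + 1) * |z.1|) := by
    intro n z
    rw [← hpart, hwdef]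
    simp only
    rw [← (hsum z).sum_add_tsum_nat_add n, add_sub_cancel_left]
    refine tsum_of_norm_bounded (g := fun k => (B + L) * (1 / 2) ^ (k + n) *
      Real.exp ((4 * L + 1) * |z.1|)) ?_ (fun k => d1 (k + n) z)
    have := (hasSum_geometric_two.mul_left ((B + L) * (1 / 2) ^ n)).mul_right
      (Real.exp ((4 * L + 1) * |z.1|))
    convert! this using 1
    · ext k
      rw [pow_add]
      ring
    · ring
  have hder : ∀ z, HasFDerivAt w (∑' k, fderiv ℝ (d k) z) z := by
    intro z
    have hS : IsPreconnected {y : ℝ × ℝ | |y.1| < |z.1| + 1} := by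
      have : {y : ℝ × ℝ | |y.1| < |z.1| + 1} =
          (ContinuousLinearMap.fst ℝ ℝ ℝ) ⁻¹' (Metric.ball 0 (|z.1| + 1)) := by
        ext; simp
      rw [this]
      exact ((convex_ball _ _).linear_preimage
        (ContinuousLinearMap.fst ℝ ℝ ℝ).toLinearMap).isPreconnected
    have hz : z ∈ {y : ℝ × ℝ | |y.1| < |z.1| + 1} := by simp
    refine hasFDerivAt_tsum_of_isPreconnected (hs C' (Real.exp (2 * (4 * L + 1) * (|z.1| + 1))))
      (isOpen_lt (by fun_prop) (by fun_prop)) hS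
      (fun n y _ => ((hdc n).differentiable one_ne_zero y).hasFDerivAt) ?_ hz (hsum z) hz
    intro n y hy
    refine (d2 n y).trans ?_
    gcongr
    exact le_of_lt hy
  have hderc : Continuous fun z => ∑' k, fderiv ℝ (d k) z := by
    refine continuous_iff_continuousAt.2 fun z => ?_
    have hopen : IsOpen {y : ℝ × ℝ | |y.1| < |z.1| + 1} :=
      isOpen_lt (by fun_prop) (by fun_prop)
    refine ContinuousOn.continuousAt (s := {y : ℝ × ℝ | |y.1| < |z.1| + 1}) ?_
      (hopen.mem_nhds (by simp))
    refine continuousOn_tsum (fun n => ((hdc n).continuous_fderiv one_ne_zero).continuousOn)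
      (hs C' (Real.exp (2 * (4 * L + 1) * (|z.1| + 1)))) ?_
    intro n y hy
    refine (d2 n y).trans ?_
    gcongr
    exact le_of_lt hy
  have hwc : ContDiff ℝ 1 w := contDiff_one_iff_hasFDerivAt.2 ⟨_, hderc, hder⟩
  have hp : ∀ a b : ℝ, Tendsto (fun n : ℕ => a * (1 / 2) ^ n * b) atTop (𝓝 0) := fun a b => by
    have := ((tendsto_pow_atTop_nhds_zero_of_lt_one (r := (1 / 2 : ℝ)) (by norm_num)
      (by norm_num)).const_mul a).mul_const b
    simpa using this
  have hlim : ∀ z, Tendsto (fun n => W n z) atTop (𝓝 (w z)) := fun z => by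
    rw [tendsto_iff_norm_sub_tendsto_zero]
    refine squeeze_zero (fun _ => norm_nonneg _) (fun n => ?_)
      (hp (2 * (B + L)) (Real.exp ((4 * L + 1) * |z.1|)))
    rw [norm_sub_rev]
    exact htail n z
  refine ⟨w, hwc, fun z => ?_, fun T => ⟨2 * (B + L) * Real.exp ((4 * L + 1) * T), fun z hz => ?_⟩⟩
  · refine tendsto_nhds_unique ((hlim z).comp (tendsto_add_atTop_nat 1)) ?_
    refine Tendsto.const_add _ ?_
    rw [tendsto_iff_norm_sub_tendsto_zero]
    refine squeeze_zero (fun _ => norm_nonneg _) (fun n => ?_)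
      (hp (L * (2 * (B + L)) / (4 * L + 1)) (Real.exp ((4 * L + 1) * |z.1|)))
    have hc₁ : Continuous fun y => h (w y) := hh.continuous.comp hwc.continuous
    have hc₂ : Continuous fun y => h (picardIterate σ h Φ n y) :=
      hh.continuous.comp (hw n).continuous
    rw [norm_sub_rev, systemDuhamel_sub hc₁ hc₂]
    refine (norm_systemDuhamel_le (C := L * (2 * (B + L) * (1 / 2) ^ n)) (μ := 4 * L + 1)
      (by positivity) (fun z => ?_) z).trans (le_of_eq (by ring))
    rw [mul_assoc]
    exact (hLL _ _).trans (by gcongr; exact htail n z)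
  · have := htail 0 z
    simp only [hW, picardIterate, sub_zero, pow_zero, mul_one] at this
    exact this.trans (by gcongr)

/-- Global classical solutions of the semilinear transport system
`∂ₜ wᵢ + σᵢ ∂ₓ wᵢ = hᵢ(w)` for smooth compactly supported `h` and initial values. -/
theorem exists_classical_solution (hσ : ∀ i, |σ i| ≤ 1) (hh : ContDiff ℝ 2 h)
    (hc : HasCompactSupport h) {w₀ : ℝ → ι → ℂ} (hw₀ : ContDiff ℝ 1 w₀)
    (hw₀c : HasCompactSupport w₀) :
    ∃ w : ℝ × ℝ → ι → ℂ, ContDiff ℝ 1 w ∧ (∀ x, w (0, x) = w₀ x) ∧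
      (∀ z i, fderiv ℝ (fun y => w y i) z (1, σ i) = h (w z) i) ∧
      ∀ T, ∃ M, ∀ z : ℝ × ℝ, |z.1| ≤ T → ‖w z‖ ≤ M := by
  have hh1 : ContDiff ℝ 1 h := hh.of_le one_le_two
  have hh2 : ContDiff ℝ 1 (fderiv ℝ h) := hh.fderiv_right (by norm_num)
  obtain ⟨L₁, hL₁⟩ := hc.exists_bound_of_continuous hh.continuous
  obtain ⟨L₂, hL₂⟩ := (hc.fderiv ℝ).exists_bound_of_continuous hh2.continuous
  obtain ⟨L₃, hL₃⟩ := ContDiff.lipschitzWith_of_hasCompactSupport hc hh1 one_ne_zero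
  obtain ⟨K, hK⟩ := ContDiff.lipschitzWith_of_hasCompactSupport (hc.fderiv ℝ) hh2 one_ne_zero
  obtain ⟨B₁, hB₁⟩ := hw₀c.exists_bound_of_continuous hw₀.continuous
  obtain ⟨B₂, hB₂⟩ := (hw₀c.fderiv ℝ).exists_bound_of_continuous
    (hw₀.continuous_fderiv one_ne_zero)
  set L := max L₁ (max L₂ L₃)
  have hB₂0 : 0 ≤ B₂ := (norm_nonneg _).trans (hB₂ 0)
  have hB₁0 : 0 ≤ B₁ := (norm_nonneg _).trans (hB₁ 0)
  set Φ : ℝ × ℝ → ι → ℂ := fun z i => w₀ (z.2 - σ i * z.1) i with hΦdef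
  have hline : ∀ i, ContDiff ℝ 1 fun z : ℝ × ℝ => z.2 - σ i * z.1 := fun i => by fun_prop
  have hcomp : ∀ i, ContDiff ℝ 1 fun z : ℝ × ℝ => w₀ (z.2 - σ i * z.1) := fun i =>
    hw₀.comp (hline i)
  have hΦ : ContDiff ℝ 1 Φ := contDiff_pi.2 fun i => contDiff_pi.1 (hcomp i) i
  have hΦB : ∀ z, ‖Φ z‖ ≤ max B₁ (2 * B₂) := fun z =>
    (pi_norm_le_iff_of_nonneg (le_max_of_le_left hB₁0)).2 fun i =>
      ((norm_le_pi_norm _ i).trans (hB₁ _)).trans (le_max_left _ _)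
  have hΦB' : ∀ z, ‖fderiv ℝ Φ z‖ ≤ max B₁ (2 * B₂) := fun z => by
    refine le_trans ?_ (le_max_right _ _)
    refine ContinuousLinearMap.opNorm_le_bound _ (by positivity) fun v =>
      (pi_norm_le_iff_of_nonneg (by positivity)).2 fun i => ?_
    have hl : HasFDerivAt (fun z : ℝ × ℝ => z.2 - σ i * z.1)
        (ContinuousLinearMap.snd ℝ ℝ ℝ - σ i • ContinuousLinearMap.fst ℝ ℝ ℝ) z :=
      hasFDerivAt_snd.sub (hasFDerivAt_fst.const_mul (σ i))
    have hf := ((hw₀.differentiable one_ne_zero (z.2 - σ i * z.1)).hasFDerivAt.comp z hl)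
    have e1 : fderiv ℝ Φ z v i = fderiv ℝ w₀ (z.2 - σ i * z.1) (v.2 - σ i * v.1) i := by
      rw [fderiv_pi_apply' hΦ]
      have := (hasFDerivAt_pi'.1 hf i).fderiv
      simp only [Function.comp_def] at this
      simp only [hΦdef]
      rw [this]
      simp only [ContinuousLinearMap.comp_apply, sub_apply,
        smul_apply, ContinuousLinearMap.coe_snd', ContinuousLinearMap.coe_fst',
        smul_eq_mul, ContinuousLinearMap.proj_apply]
    rw [e1]
    refine (norm_le_pi_norm _ i).trans ((ContinuousLinearMap.le_opNorm _ _).trans ?_)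
    have e2 : ‖v.2 - σ i * v.1‖ ≤ 2 * ‖v‖ := by
      have h1 := norm_fst_le v
      have h2 := norm_snd_le v
      have h3 : ‖σ i * v.1‖ ≤ 1 * ‖v‖ := by
        rw [norm_mul]
        exact mul_le_mul (hσ i) h1 (norm_nonneg _) zero_le_one
      linarith [norm_sub_le v.2 (σ i * v.1)]
    nlinarith [hB₂ (z.2 - σ i * z.1), norm_nonneg (v.2 - σ i * v.1), norm_nonneg v]
  obtain ⟨w, hw, hfix, hbd⟩ := exists_contDiff_fixedPoint hσ hh1 hΦ (L := L) (K := K)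
    (fun y => (hL₁ y).trans (le_max_left _ _))
    (fun y => (hL₂ y).trans ((le_max_left _ _).trans (le_max_right _ _)))
    (fun x y => (hL₃.norm_sub_le x y).trans (by
      gcongr; exact (le_max_right _ _).trans (le_max_right _ _)))
    K.2 (fun x y => hK.norm_sub_le x y) hΦB hΦB'
  refine ⟨w, hw, fun x => ?_, fun z i => ?_, hbd⟩
  · rw [hfix]
    ext i
    simp [hΦdef, systemDuhamel, duhamel]
  · set y := z.2 - σ i * z.1 with hy
    have hwi : ContDiff ℝ 1 fun y => w y i := contDiff_pi.1 hw i
    have hz : z = (z.1, y + σ i * z.1) := by ext <;> simp [hy]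
    have hline : ∀ t, HasDerivAt (fun t : ℝ => (t, y + σ i * t)) (1, σ i) t := fun t => by
      refine (hasDerivAt_id t).prodMk ?_
      simpa using ((hasDerivAt_id t).const_mul (σ i)).const_add y
    have h1 : HasDerivAt (fun t : ℝ => w (t, y + σ i * t) i)
        (fderiv ℝ (fun y => w y i) (z.1, y + σ i * z.1) (1, σ i)) z.1 :=
      (hwi.differentiable one_ne_zero _).hasFDerivAt.comp_hasDerivAt _ (hline z.1)
    -- On a fixed characteristic the fixed point equation is an ordinary integral equation, so the
    -- directional derivative is the integrand.
    have h2 : (fun t : ℝ => w (t, y + σ i * t) i) =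
        fun t => w₀ y i + ∫ τ in (0 : ℝ)..t, h (w (τ, y + σ i * τ)) i := by
      ext t
      rw [hfix (t, y + σ i * t), Pi.add_apply]
      congr 1
      · simp [hΦdef]
      · exact duhamel_along (σ i) (fun y => h (w y) i) t y
    have hcont : Continuous fun τ : ℝ => h (w (τ, y + σ i * τ)) i :=
      (continuous_apply i).comp (hh.continuous.comp (hw.continuous.comp (by fun_prop)))
    have h3 : HasDerivAt (fun t : ℝ => w (t, y + σ i * t) i) (h (w (z.1, y + σ i * z.1)) i) z.1 :=
        by
      rw [h2]
      exact (intervalIntegral.integral_hasDerivAt_right (hcont.intervalIntegrable _ _)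
        (hcont.stronglyMeasurableAtFilter _ _) hcont.continuousAt).const_add _
    rw [← hz] at h1 h3
    exact h1.unique h3

end Picard

/-! ### The a priori bound: interaction of two densities crossing transversally. -/

section Characteristics

/-- Grönwall's inequality in differential form: `f exp(-∫g)` is nonincreasing. No sign of `f` or `g`
is needed. -/
theorem le_mul_exp_integral {f f' g : ℝ → ℝ} (hg : Continuous g)
    (hf : ∀ t, HasDerivAt f (f' t) t) {t : ℝ} (ht : 0 ≤ t)
    (hf' : ∀ s ∈ Ioo 0 t, f' s ≤ g s * f s) :
    f t ≤ f 0 * Real.exp (∫ s in (0 : ℝ)..t, g s) := by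
  set E : ℝ → ℝ := fun t => ∫ s in (0 : ℝ)..t, g s with hE
  have hEd : ∀ t, HasDerivAt E (g t) t := fun t =>
    intervalIntegral.integral_hasDerivAt_right (hg.intervalIntegrable _ _)
      (hg.stronglyMeasurableAtFilter _ _) hg.continuousAt
  have hd : ∀ t, HasDerivAt (fun t => f t * Real.exp (-E t))
      (f' t * Real.exp (-E t) + f t * (Real.exp (-E t) * -g t)) t := fun t =>
    (hf t).mul (hEd t).neg.exp
  have hanti : AntitoneOn (fun t => f t * Real.exp (-E t)) (Icc 0 t) := by
    refine antitoneOn_of_deriv_nonpos (convex_Icc 0 t)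
      (fun s _ => (hd s).continuousAt.continuousWithinAt)
      (fun s _ => (hd s).differentiableAt.differentiableWithinAt) fun s hs => ?_
    rw [(hd s).deriv]
    rw [interior_Icc] at hs
    nlinarith [hf' s hs, Real.exp_pos (-E s)]
  have h0 : f t * Real.exp (-E t) ≤ f 0 := by
    simpa [hE] using hanti (left_mem_Icc.2 ht) (right_mem_Icc.2 ht) ht
  calc f t = f t * Real.exp (-E t) * Real.exp (E t) := by
        rw [mul_assoc, ← Real.exp_add]; simp
    _ ≤ f 0 * Real.exp (E t) := by gcongr

variable {k m : ℝ}

/-- If a density `b` moves along the characteristics of speed `-σ` and its growth factor there is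
at most `e`, then its integral along a characteristic of speed `σ` is at most `e m / 2`. -/
theorem integral_transversal_le {b b' g : ℝ × ℝ → ℝ} (hb : Continuous b) (hg : Continuous g)
    (hb0 : ∀ z, 0 ≤ b z) (hg0 : ∀ z, 0 ≤ g z) {σ : ℝ} (hσ : |σ| = 1)
    (hd : ∀ y t, HasDerivAt (fun s => b (s, y - σ * s)) (b' (t, y - σ * t)) t)
    (hb' : ∀ z, b' z ≤ g z * b z) (hi : Integrable fun x => b (0, x))
    (hm : ∫ x, b (0, x) ≤ m) {t₀ : ℝ} (ht₀ : 0 ≤ t₀)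
    (hclaim : ∀ y, ∫ s in (0 : ℝ)..t₀, g (s, y - σ * s) ≤ 1) (y : ℝ) :
    ∫ s in (0 : ℝ)..t₀, b (s, y + σ * s) ≤ Real.exp 1 * m / 2 := by
  -- The point `(s, y + σs)` lies on the characteristic of speed `-σ` that starts at `y + 2σs`.
  have hpt : ∀ s ∈ Icc 0 t₀, b (s, y + σ * s) ≤ Real.exp 1 * b (0, y + 2 * σ * s) := by
    intro s hs
    have hgc : ∀ y, Continuous fun τ => g (τ, y - σ * τ) := fun y => by fun_prop
    have h1 := le_mul_exp_integral (hgc (y + 2 * σ * s)) (hd (y + 2 * σ * s)) hs.1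
        (fun t _ => hb' _)
    have h2 : ∫ τ in (0 : ℝ)..s, g (τ, y + 2 * σ * s - σ * τ) ≤ 1 := by
      refine le_trans ?_ (hclaim (y + 2 * σ * s))
      exact intervalIntegral.integral_mono_interval le_rfl hs.1 hs.2
        (ae_of_all _ fun _ => hg0 _) ((hgc _).intervalIntegrable _ _)
    have h3 : y + 2 * σ * s - σ * s = y + σ * s := by ring
    rw [h3, mul_zero, sub_zero] at h1
    refine h1.trans ?_
    rw [mul_comm]
    gcongr
    exact hb0 _
  have hσ0 : (2 * σ) ≠ 0 := by
    have : σ ≠ 0 := by rintro rfl; simp at hσ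
    simpa using this
  have hi2 : Integrable fun s => b (0, y + 2 * σ * s) := (hi.comp_add_left y).comp_mul_left' hσ0
  -- As `s` varies, the starting points `y + 2σs` sweep the line at speed `2`; this is the source of
  -- the factor `1/2`.
  have hint : ∫ s, b (0, y + 2 * σ * s) = (∫ x, b (0, x)) / 2 := by
    rw [Measure.integral_comp_mul_left (fun s => b (0, y + s)) (2 * σ),
      integral_add_left_eq_self (fun x => b (0, x)) y, abs_inv, abs_mul, hσ]
    simp
    ring
  calc ∫ s in (0 : ℝ)..t₀, b (s, y + σ * s)
      ≤ ∫ s in (0 : ℝ)..t₀, Real.exp 1 * b (0, y + 2 * σ * s) :=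
        intervalIntegral.integral_mono_on ht₀ (Continuous.intervalIntegrable (by fun_prop) _ _)
          (Continuous.intervalIntegrable (by fun_prop) _ _) hpt
    _ = Real.exp 1 * ∫ s in Ioc 0 t₀, b (0, y + 2 * σ * s) := by
        rw [intervalIntegral.integral_const_mul, intervalIntegral.integral_of_le ht₀]
    _ ≤ Real.exp 1 * ∫ s, b (0, y + 2 * σ * s) := by
        exact mul_le_mul_of_nonneg_left
          (setIntegral_le_integral hi2 (ae_of_all _ fun _ => hb0 _)) (Real.exp_pos 1).le
    _ ≤ _ := by rw [hint]; nlinarith [Real.exp_pos 1]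

/-- Quantitative continuity in the upper endpoint: prolonging the time interval by at most `d` costs
at most `M d`. -/
theorem integral_le_integral_add {f : ℝ → ℝ} (hf : Continuous f) {M T t₀ t d : ℝ}
    (hM : ∀ s ∈ Icc 0 T, f s ≤ M) (hM0 : 0 ≤ M) (hf0 : ∀ s, 0 ≤ f s)
    (ht₀ : 0 ≤ t₀) (ht : t ∈ Icc 0 T) (htd : t ≤ t₀ + d) (hd : 0 ≤ d) :
    ∫ s in (0 : ℝ)..t, f s ≤ (∫ s in (0 : ℝ)..t₀, f s) + M * d := by
  rcases le_total t t₀ with h | h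
  · have := intervalIntegral.integral_mono_interval (μ := volume) le_rfl ht.1 h
      (ae_of_all _ hf0) (hf.intervalIntegrable _ _)
    have h2 : 0 ≤ M * d := by positivity
    linarith
  · rw [← intervalIntegral.integral_add_adjacent_intervals (hf.intervalIntegrable 0 t₀)
      (hf.intervalIntegrable t₀ t)]
    gcongr
    calc ∫ s in t₀..t, f s ≤ ∫ _ in t₀..t, M :=
          intervalIntegral.integral_mono_on h (hf.intervalIntegrable _ _) (by simp) fun s hs =>
            hM s ⟨ht₀.trans hs.1, hs.2.trans ht.2⟩
      _ = (t - t₀) * M := by simp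
      _ ≤ M * d := by nlinarith

/-- Two densities moving in opposite directions with small mass, whose growth rates are bounded by
`k` times the other density, grow at most by the factor `e`. -/
theorem density_le_exp_one_mul {a b a' b' : ℝ × ℝ → ℝ} (ha : Continuous a) (hb : Continuous b)
    (ha0 : ∀ z, 0 ≤ a z) (hb0 : ∀ z, 0 ≤ b z) (hk : 0 < k)
    (had : ∀ y t, HasDerivAt (fun s => a (s, y + s)) (a' (t, y + t)) t)
    (hbd : ∀ y t, HasDerivAt (fun s => b (s, y - s)) (b' (t, y - t)) t)
    (ha' : ∀ z, a' z ≤ k * (a z * b z)) (hb' : ∀ z, b' z ≤ k * (a z * b z))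
    (hai : Integrable fun x => a (0, x)) (hbi : Integrable fun x => b (0, x))
    (ham : ∫ x, a (0, x) ≤ m) (hbm : ∫ x, b (0, x) ≤ m) (hm : Real.exp 1 * m * k ≤ 1)
    {T M : ℝ} (haM : ∀ z : ℝ × ℝ, |z.1| ≤ T → a z ≤ M) (hbM : ∀ z : ℝ × ℝ, |z.1| ≤ T → b z ≤ M)
    {t : ℝ} (ht : t ∈ Icc 0 T) (y : ℝ) :
    a (t, y + t) ≤ Real.exp 1 * a (0, y) ∧ b (t, y - t) ≤ Real.exp 1 * b (0, y) := by
  have hT : 0 ≤ T := ht.1.trans ht.2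
  have hM0 : 0 ≤ M := (ha0 (0, 0)).trans (haM _ (by simpa using hT))
  have hac : ∀ y, Continuous fun s => k * a (s, y - s) := fun y => by fun_prop
  have hbc : ∀ y, Continuous fun s => k * b (s, y + s) := fun y => by fun_prop
  -- A time step so short that the exponents grow by at most `1/2` over it. It depends on the crude
  -- bound `M`, which does not enter the conclusion.
  set d := 1 / (2 * (k * (M + 1))) with hd
  have hd0 : 0 < d := by positivity
  have hkMd : k * M * d ≤ 1 / 2 := by
    rw [hd, mul_one_div, div_le_div_iff₀ (by positivity) (by positivity)]
    nlinarith
  have hM' : ∀ s ∈ Icc 0 T, ∀ x, k * a (s, x) ≤ k * M ∧ k * b (s, x) ≤ k * M := by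
    intro s hs x
    have : |s| ≤ T := by rw [abs_of_nonneg hs.1]; exact hs.2
    exact ⟨mul_le_mul_of_nonneg_left (haM (s, x) this) hk.le,
      mul_le_mul_of_nonneg_left (hbM (s, x) this) hk.le⟩
  -- Continuation in steps of length `d`: the bound `1` up to time `t₀` improves to `e m k / 2 ≤
  -- 1/2` by transversality, and one more step adds at most `1/2`.
  have claim : ∀ n : ℕ, ∀ t ∈ Icc 0 T, t ≤ n * d → ∀ y,
      ∫ s in (0 : ℝ)..t, k * b (s, y + s) ≤ 1 ∧ ∫ s in (0 : ℝ)..t, k * a (s, y - s) ≤ 1 := by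
    intro n
    induction n with
    | zero =>
      intro t ht htn y
      have : t = 0 := le_antisymm (by simpa using htn) ht.1
      simp [this]
    | succ n ih =>
      intro t ht htn y
      set t₀ := min T (n * d) with ht₀
      have ht₀0 : 0 ≤ t₀ := le_min hT (by positivity)
      have ht₁ : t ≤ t₀ + d := by
        rcases min_choice T (n * d) with h | h
        · rw [ht₀, h]; linarith [ht.2]
        · rw [ht₀, h]; push_cast at htn; linarith
      have h₀ := ih t₀ ⟨ht₀0, min_le_left _ _⟩ (min_le_right _ _)
      have hbh := integral_transversal_le (b := b) (b' := b') (g := fun z => k * a z) (σ := 1)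
        hb (by fun_prop) hb0 (fun z => mul_nonneg hk.le (ha0 z)) (by simp)
        (by simpa using hbd) (fun z => by linarith [hb' z]) hbi hbm ht₀0
        (fun y => by simpa using (h₀ y).2) y
      have hah := integral_transversal_le (b := a) (b' := a') (g := fun z => k * b z) (σ := -1)
        ha (by fun_prop) ha0 (fun z => mul_nonneg hk.le (hb0 z)) (by simp)
        (by simpa using had) (fun z => by linarith [ha' z]) hai ham ht₀0
        (fun y => by simpa using (h₀ y).1) y
      simp only [one_mul, neg_one_mul, ← sub_eq_add_neg] at hbh hah
      have e1 := integral_le_integral_add (hbc y) (fun s hs => (hM' s hs _).2) (by positivity)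
        (fun s => mul_nonneg hk.le (hb0 _)) ht₀0 ht ht₁ hd0.le
      have e2 := integral_le_integral_add (hac y) (fun s hs => (hM' s hs _).1) (by positivity)
        (fun s => mul_nonneg hk.le (ha0 _)) ht₀0 ht ht₁ hd0.le
      have e3 : ∫ s in (0 : ℝ)..t₀, k * b (s, y + s) ≤ 1 / 2 := by
        rw [intervalIntegral.integral_const_mul]
        nlinarith
      have e4 : ∫ s in (0 : ℝ)..t₀, k * a (s, y - s) ≤ 1 / 2 := by
        rw [intervalIntegral.integral_const_mul]
        nlinarith
      exact ⟨by linarith, by linarith⟩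
  obtain ⟨n, hn⟩ := exists_nat_ge (t / d)
  have hc := claim n t ht ((div_le_iff₀ hd0).1 hn) y
  have h1 := le_mul_exp_integral (hbc y) (had y) ht.1 (fun s _ => by linarith [ha' (s, y + s)])
  have h2 := le_mul_exp_integral (hac y) (hbd y) ht.1 (fun s _ => by linarith [hb' (s, y - s)])
  simp only [add_zero, sub_zero] at h1 h2
  refine ⟨h1.trans ?_, h2.trans ?_⟩
  · rw [mul_comm]
    gcongr
    exacts [ha0 _, hc.1]
  · rw [mul_comm]
    gcongr
    exacts [hb0 _, hc.2]

end Characteristics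

/-! ### Pairings and superposition operators in `L²`. -/

section SquareIntegrable

open Classical in
/-- The class in `L²` of a function, and zero if the function is not in `L²`. -/
def toL2 (f : ℝ → ℂ) : L2 := if h : MemLp f 2 volume then h.toLp f else 0

theorem coeFn_toL2 {f : ℝ → ℂ} (h : MemLp f 2 volume) : toL2 f =ᵐ[volume] f := by
  rw [toL2, dif_pos h]
  exact h.coeFn_toLp

theorem norm_sq_eq_integral (f : L2) : ‖f‖ ^ 2 = ∫ x, ‖f x‖ ^ 2 := by
  have h : ((‖f‖ ^ 2 : ℝ) : ℂ) = ((∫ x, ‖f x‖ ^ 2 : ℝ) : ℂ) := by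
    have h1 := inner_self_eq_norm_sq_to_K (𝕜 := ℂ) f
    rw [L2.inner_def] at h1
    push_cast
    rw [← integral_complex_ofReal]
    simp only [inner_self_eq_norm_sq_to_K] at h1
    simpa using h1.symm
  exact_mod_cast h

theorem integrable_norm_sq (f : L2) : Integrable fun x => ‖f x‖ ^ 2 :=
  (memLp_two_iff_integrable_sq_norm (Lp.aestronglyMeasurable f)).1 (Lp.memLp f)

theorem norm_toL2_sq {f : ℝ → ℂ} (h : MemLp f 2 volume) : ‖toL2 f‖ ^ 2 = ∫ x, ‖f x‖ ^ 2 := by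
  rw [norm_sq_eq_integral]
  refine integral_congr_ae ?_
  filter_upwards [coeFn_toL2 h] with x hx
  rw [hx]

theorem toL2_sub {f g : ℝ → ℂ} (hf : MemLp f 2 volume) (hg : MemLp g 2 volume) :
    toL2 f - toL2 g = toL2 (fun x => f x - g x) := by
  refine Lp.ext ?_
  filter_upwards [Lp.coeFn_sub (toL2 f) (toL2 g), coeFn_toL2 hf, coeFn_toL2 hg,
    coeFn_toL2 (hf.sub hg)] with x h1 h2 h3 h4
  rw [h1, Pi.sub_apply, h2, h3]
  exact h4.symm

theorem integral_mul_eq_inner (u : L2) {φ : ℝ → ℂ} (hφ : MemLp φ 2 volume) :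
    ∫ x, u x * φ x = inner ℂ (toL2 fun x => conj (φ x)) u := by
  rw [L2.inner_def]
  have hc : MemLp (fun x => conj (φ x)) 2 volume := hφ.star
  refine integral_congr_ae ?_
  filter_upwards [coeFn_toL2 hc] with x hx
  rw [hx, RCLike.inner_apply, Complex.conj_conj]

theorem norm_toL2_conj {φ : ℝ → ℂ} (hφ : MemLp φ 2 volume) :
    ‖toL2 fun x => conj (φ x)‖ = ‖toL2 φ‖ := by
  have hc : MemLp (fun x => conj (φ x)) 2 volume := hφ.star
  rw [← sq_eq_sq₀ (norm_nonneg _) (norm_nonneg _), norm_toL2_sq hc, norm_toL2_sq hφ]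
  simp

theorem norm_integral_mul_le (u : L2) {φ : ℝ → ℂ} (hφ : MemLp φ 2 volume) :
    ‖∫ x, u x * φ x‖ ≤ ‖u‖ * ‖toL2 φ‖ := by
  rw [integral_mul_eq_inner u hφ, ← norm_toL2_conj hφ, mul_comm]
  exact norm_inner_le_norm _ _

theorem integrable_mul_of_memLp (u : L2) {φ : ℝ → ℂ} (hφ : MemLp φ 2 volume) :
    Integrable fun x => u x * φ x :=
  (Lp.memLp u).integrable_mul hφ

theorem norm_toL2_comp_sub (ψ : ℝ → ℂ) (hψ : MemLp ψ 2 volume) (y : ℝ) :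
    ‖toL2 fun x => ψ (x - y)‖ = ‖toL2 ψ‖ := by
  have h : MemLp (fun x => ψ (x - y)) 2 volume :=
    hψ.comp_measurePreserving (measurePreserving_sub_right volume y)
  rw [← sq_eq_sq₀ (norm_nonneg _) (norm_nonneg _), norm_toL2_sq h, norm_toL2_sq hψ,
    integral_sub_right_eq_self (fun x => ‖ψ x‖ ^ 2)]

theorem memLp_of_continuous_of_eq_zero {f : ℝ → ℂ} (hf : Continuous f) {K : Set ℝ}
    (hK : IsCompact K) (h : ∀ x ∉ K, f x = 0) : MemLp f 2 volume :=
  hf.memLp_of_hasCompactSupport (HasCompactSupport.intro hK h)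

/-- A continuous family of continuous functions with supports in a fixed compact set is continuous
with values in `L²`. -/
theorem continuous_toL2 {X : Type*} [TopologicalSpace X] [FirstCountableTopology X]
    [LocallyCompactSpace X] {φ : X → ℝ → ℂ} (hφ : Continuous φ.uncurry) {K : Set ℝ}
    (hK : IsCompact K) (h : ∀ t, ∀ x ∉ K, φ t x = 0) : Continuous fun t => toL2 (φ t) := by
  have hs : ∀ t, Continuous (φ t) := fun t => hφ.comp (Continuous.prodMk_right t)
  have hm : ∀ t, MemLp (φ t) 2 volume := fun t => memLp_of_continuous_of_eq_zero (hs t) hK (h t)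
  refine continuous_iff_continuousAt.2 fun t₀ => ?_
  rw [ContinuousAt, tendsto_iff_norm_sub_tendsto_zero]
  have h1 : ∀ t, ‖toL2 (φ t) - toL2 (φ t₀)‖ ^ 2 = ∫ x in K, ‖φ t x - φ t₀ x‖ ^ 2 := by
    intro t
    have hd : MemLp (fun x => φ t x - φ t₀ x) 2 volume := (hm t).sub (hm t₀)
    rw [toL2_sub (hm t) (hm t₀), norm_toL2_sq hd]
    refine (setIntegral_eq_integral_of_forall_compl_eq_zero fun x hx => ?_).symm
    simp [h t x hx, h t₀ x hx]
  have h2 : Continuous fun t => ∫ x in K, ‖φ t x - φ t₀ x‖ ^ 2 := by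
    refine continuous_parametric_integral_of_continuous ?_ hK
    have : Continuous fun p : X × ℝ => φ t₀ p.2 := (hs t₀).comp continuous_snd
    exact (hφ.sub this).norm.pow 2
  have h3 := h2.tendsto t₀
  simp only [← h1, sub_self, norm_zero] at h3
  have h4 := h3.sqrt
  simpa [Real.sqrt_sq] using h4

/-- A pairing of curves in `L²` with continuous families of test functions is continuous. -/
theorem continuousOn_integral_mul {u : ℝ → L2} {s : Set ℝ} (hu : ContinuousOn u s)
    {φ : ℝ → ℝ → ℂ} (hφ : Continuous φ.uncurry) {K : Set ℝ} (hK : IsCompact K)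
    (h : ∀ t, ∀ x ∉ K, φ t x = 0) : ContinuousOn (fun t => ∫ x, u t x * φ t x) s := by
  have hs : ∀ t, MemLp (φ t) 2 volume := fun t =>
    memLp_of_continuous_of_eq_zero (hφ.comp (Continuous.prodMk_right t)) hK (h t)
  simp only [fun t => integral_mul_eq_inner (u t) (hs t)]
  refine ContinuousOn.inner (𝕜 := ℂ) (Continuous.continuousOn ?_) hu
  refine continuous_toL2 (φ := fun t x => conj (φ t x)) ?_ hK (fun t x hx => by simp [h t x hx])
  exact Complex.continuous_conj.comp hφ

/-- The superposition operator on `L²` of a function of two complex variables. -/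
def superposition (g : ℂ → ℂ → ℂ) (u v : L2) : L2 := toL2 fun x => g (u x) (v x)

theorem memLp_superposition {g : ℂ → ℂ → ℂ} {L : ℝ} (hg : Continuous g.uncurry)
    (hL : ∀ a b, ‖g a b‖ ≤ L * (‖a‖ + ‖b‖)) (u v : L2) :
    MemLp (fun x => g (u x) (v x)) 2 volume := by
  have h1 : MemLp (fun x => ‖u x‖ + ‖v x‖) 2 volume := (Lp.memLp u).norm.add (Lp.memLp v).norm
  refine h1.of_le_mul (c := L) ?_ (ae_of_all _ fun x => ?_)
  · exact hg.comp_aestronglyMeasurable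
      ((Lp.aestronglyMeasurable u).prodMk (Lp.aestronglyMeasurable v))
  · rw [Real.norm_of_nonneg (by positivity)]
    exact hL _ _

/-- Global Lipschitz continuity and vanishing at the origin make superposition Lipschitz on `L²`; an
untruncated polynomial need not even map `L²` to itself. -/
theorem norm_superposition_sub_le {g : ℂ → ℂ → ℂ} {L : ℝ} (hL0 : 0 ≤ L) (h0 : g 0 0 = 0)
    (hL : ∀ a b a' b', ‖g a b - g a' b'‖ ≤ L * (‖a - a'‖ + ‖b - b'‖))
    (hg : Continuous g.uncurry) (u v u' v' : L2) :
    ‖superposition g u v - superposition g u' v'‖ ≤ L * (‖u - u'‖ + ‖v - v'‖) := by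
  have hL' : ∀ a b, ‖g a b‖ ≤ L * (‖a‖ + ‖b‖) := fun a b => by simpa [h0] using hL a b 0 0
  -- The pointwise majorant taken as an element of real `L²`, so that its norm is estimated by the
  -- triangle inequality there.
  set N : Lp ℝ 2 (volume : Measure ℝ) :=
    L • ((Lp.memLp (u - u')).norm.toLp + (Lp.memLp (v - v')).norm.toLp) with hN
  have hnorm : ∀ w : L2, ‖(Lp.memLp w).norm.toLp‖ = ‖w‖ := fun w => by
    rw [Lp.norm_toLp, eLpNorm_norm, Lp.norm_def]
  calc ‖superposition g u v - superposition g u' v'‖ ≤ ‖N‖ := by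
        refine Lp.norm_le_norm_of_ae_le ?_
        filter_upwards [Lp.coeFn_sub (superposition g u v) (superposition g u' v'),
          coeFn_toL2 (memLp_superposition hg hL' u v), coeFn_toL2
              (memLp_superposition hg hL' u' v'),
          Lp.coeFn_smul L ((Lp.memLp (u - u')).norm.toLp + (Lp.memLp (v - v')).norm.toLp),
          Lp.coeFn_add ((Lp.memLp (u - u')).norm.toLp) ((Lp.memLp (v - v')).norm.toLp),
          (Lp.memLp (u - u')).norm.coeFn_toLp, (Lp.memLp (v - v')).norm.coeFn_toLp,
          Lp.coeFn_sub u u', Lp.coeFn_sub v v'] with x h1 h2 h3 h4 h5 h6 h7 h8 h9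
        rw [h1, Pi.sub_apply, superposition, h2, superposition, h3, hN, h4, Pi.smul_apply, h5,
          Pi.add_apply, h6, h7, h8, h9, smul_eq_mul, Real.norm_of_nonneg (by positivity)]
        exact hL _ _ _ _
    _ ≤ L * (‖u - u'‖ + ‖v - v'‖) := by
        rw [hN, norm_smul, Real.norm_of_nonneg hL0]
        gcongr
        refine (norm_add_le _ _).trans ?_
        rw [hnorm, hnorm]

end SquareIntegrable

/-! ### Weak derivatives in time. -/

section DuBoisReymond

/-- If `F' = G` on `(0, T)` in the sense of distributions, and `F` and `G` are continuous on
`[0, T]`, then `F` is a primitive of `G`. -/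
theorem sub_eq_integral_of_weak_deriv {F G : ℝ → ℂ} {T : ℝ} (hF : ContinuousOn F (Icc 0 T))
    (hG : ContinuousOn G (Icc 0 T))
    (h : ∀ χ : ℝ → ℝ, ContDiff ℝ ∞ χ → HasCompactSupport χ → tsupport χ ⊆ Ioo 0 T →
      ∫ t in 0..T, deriv χ t • F t = -∫ t in 0..T, χ t • G t)
    {t : ℝ} (ht : t ∈ Icc 0 T) : F t - F 0 = ∫ s in (0 : ℝ)..t, G s := by
  have hT : 0 ≤ T := ht.1.trans ht.2
  -- Clamping the time to `[0, T]` extends `F` and `G` to continuous functions on the line.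
  set cl : ℝ → ℝ := fun t => projIcc 0 T hT t with hcl
  have hclc : Continuous cl := continuous_subtype_val.comp continuous_projIcc
  have hclm : ∀ t, cl t ∈ Icc 0 T := fun t => (projIcc 0 T hT t).2
  have hcle : ∀ t ∈ Icc 0 T, cl t = t := fun t ht => by simp [hcl, projIcc_of_mem hT ht]
  set G' : ℝ → ℂ := fun t => G (cl t) with hG'
  have hGc : Continuous G' := hG.comp_continuous hclc hclm
  have hFc : Continuous fun t => F (cl t) := hF.comp_continuous hclc hclm
  set H : ℝ → ℂ := fun t => F (cl t) - ∫ s in (0 : ℝ)..t, G' s with hH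
  have hprim : ∀ t, HasDerivAt (fun t => ∫ s in (0 : ℝ)..t, G' s) (G' t) t := fun t =>
    intervalIntegral.integral_hasDerivAt_right (hGc.intervalIntegrable _ _)
      (hGc.stronglyMeasurableAtFilter _ _) hGc.continuousAt
  have hHc : Continuous H :=
    hFc.sub (continuous_iff_continuousAt.2 fun t => (hprim t).continuousAt)
  have hweak : ∀ χ : ℝ → ℝ, ContDiff ℝ ∞ χ → HasCompactSupport χ → tsupport χ ⊆ Ioo 0 T →
      ∫ t, deriv χ t • H t = 0 := by
    intro χ hχ hχc hχs
    have hχ1 : ContDiff ℝ 1 χ := hχ.of_le (by norm_num)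
    have hχd : Continuous (deriv χ) := hχ1.continuous_deriv_one
    have hz : ∀ t ∉ Ioc 0 T, deriv χ t = 0 := fun t ht => by
      by_contra h'
      have := hχs (support_deriv_subset h')
      exact ht ⟨this.1, this.2.le⟩
    have h0 : ∀ t ∉ Ioo 0 T, χ t = 0 := fun t ht => by
      by_contra h'
      exact ht (hχs (subset_tsupport _ h'))
    rw [← setIntegral_eq_integral_of_forall_compl_eq_zero (s := Ioc 0 T)
      (fun t ht => by rw [hz t ht, zero_smul]), ← intervalIntegral.integral_of_le hT]
    simp only [hH, smul_sub]
    have c1 : Continuous fun t => deriv χ t • F (cl t) := hχd.smul hFc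
    have c2 : Continuous fun t => deriv χ t • ∫ s in (0 : ℝ)..t, G' s :=
      hχd.smul (continuous_iff_continuousAt.2 fun t => (hprim t).continuousAt)
    rw [intervalIntegral.integral_sub (c1.intervalIntegrable _ _) (c2.intervalIntegrable _ _)]
    have e1 : ∫ t in (0 : ℝ)..T, deriv χ t • F (cl t) = -∫ t in (0 : ℝ)..T, χ t • G' t := by
      rw [← intervalIntegral.integral_congr (f := fun t => deriv χ t • F t)
        (fun t ht => by rw [uIcc_of_le hT] at ht; simp only [hcle t ht]), h χ hχ hχc hχs]
      congr 1
      exact intervalIntegral.integral_congr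
        (fun t ht => by rw [uIcc_of_le hT] at ht; simp only [hG', hcle t ht])
    have e2 : ∫ t in (0 : ℝ)..T, deriv χ t • ∫ s in (0 : ℝ)..t, G' s =
        -∫ t in (0 : ℝ)..T, χ t • G' t := by
      have := intervalIntegral.integral_smul_deriv_eq_deriv_smul (a := 0) (b := T) (u := χ)
          (u' := deriv χ)
        (v := fun t => ∫ s in (0 : ℝ)..t, G' s) (v' := G')
        (fun t _ => (hχ1.differentiable one_ne_zero t).hasDerivAt) (fun t _ => hprim t)
        (hχd.intervalIntegrable _ _) (hGc.intervalIntegrable _ _)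
      rw [this, h0 T (by simp), h0 0 (by simp)]
      simp
    rw [e1, e2, sub_self]
  -- `H` has weak derivative zero, so its mollifications are constant on `[t₁, t₂]`; shrinking the
  -- mollifier transfers this to `H`, which is continuous.
  have hconst : ∀ t₁ ∈ Ioo 0 T, ∀ t₂ ∈ Ioo 0 T, t₁ ≤ t₂ → H t₁ = H t₂ := by
    intro t₁ h₁ t₂ h₂ h₁₂
    -- Mollifiers of radius at most `r / 2`, centred at points of `[t₁, t₂]`, stay supported inside
    -- `(0, T)`, where the hypothesis applies.
    set r : ℝ := min t₁ (T - t₂) with hr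
    have hr0 : 0 < r := lt_min h₁.1 (by linarith [h₂.2])
    let ρ : ℕ → ContDiffBump (0 : ℝ) := fun n =>
      ⟨r / 4 / (n + 1), r / 2 / (n + 1), by positivity, by gcongr; norm_num⟩
    have hρ : Tendsto (fun n => (ρ n).rOut) atTop (𝓝 0) := by
      have := (tendsto_one_div_add_atTop_nhds_zero_nat (𝕜 := ℝ)).const_mul (r / 2)
      simpa [ρ, div_eq_mul_inv] using this
    have hlim := fun t => ContDiffBump.convolution_tendsto_right_of_continuous (μ := volume) hρ
        hHc t
    have heq : ∀ n, convolution ((ρ n).normed volume) H (ContinuousLinearMap.lsmul ℝ ℝ) volume t₁ =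
        convolution ((ρ n).normed volume) H (ContinuousLinearMap.lsmul ℝ ℝ) volume t₂ := by
      intro n
      have hsm : ContDiff ℝ ∞ ((ρ n).normed volume) := (ρ n).contDiff_normed
      have hcs : HasCompactSupport ((ρ n).normed volume) := (ρ n).hasCompactSupport_normed
      have hd := HasCompactSupport.hasDerivAt_convolution_left (ContinuousLinearMap.lsmul ℝ ℝ)
        (μ := volume) hcs (hsm.of_le (by norm_num)) hHc.locallyIntegrable
      have hz : ∀ t ∈ Icc t₁ t₂, convolution (deriv ((ρ n).normed volume)) H
          (ContinuousLinearMap.lsmul ℝ ℝ) volume t = 0 := by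
        intro t ht
        have hχ : ContDiff ℝ ∞ fun τ => (ρ n).normed volume (t - τ) :=
          hsm.comp (contDiff_const.sub contDiff_id)
        have hsub : ∀ τ, τ ∉ Metric.closedBall t (r / 2) → (ρ n).normed volume (t - τ) = 0 := by
          intro τ hτ
          by_contra h'
          have : t - τ ∈ Function.support ((ρ n).normed volume) := h'
          rw [(ρ n).support_normed_eq, mem_ball_zero_iff] at this
          refine hτ ?_
          rw [Metric.mem_closedBall, dist_comm, Real.dist_eq]
          refine this.le.trans (div_le_self (by positivity) ?_)
          have : (0 : ℝ) ≤ n := n.cast_nonneg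
          linarith
        have hts : tsupport (fun τ => (ρ n).normed volume (t - τ)) ⊆ Metric.closedBall t (r / 2) :=
          closure_minimal (fun τ hτ => by_contra fun h' => hτ (hsub τ h'))
            Metric.isClosed_closedBall
        have h3 := hweak _ hχ (HasCompactSupport.intro (isCompact_closedBall t (r / 2)) hsub)
          (hts.trans fun τ hτ => by
            rw [Metric.mem_closedBall, Real.dist_eq, abs_le] at hτ
            have := min_le_left t₁ (T - t₂)
            have := min_le_right t₁ (T - t₂)
            constructor <;> linarith [ht.1, ht.2, hτ.1, hτ.2])
        rw [convolution_eq_swap]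
        rw [← neg_eq_zero, ← integral_neg, ← h3]
        congr 1
        ext τ : 1
        have : deriv (fun τ => (ρ n).normed volume (t - τ)) τ =
            -deriv ((ρ n).normed volume) (t - τ) := deriv_comp_const_sub _ _ _
        rw [this]
        simp
      refine (constant_of_derivWithin_zero (f := convolution ((ρ n).normed volume) H
        (ContinuousLinearMap.lsmul ℝ ℝ) volume) (a := t₁) (b := t₂)
        (fun t _ => (hd t).differentiableAt.differentiableWithinAt) (fun t ht => ?_) t₂
        (right_mem_Icc.2 h₁₂)).symm
      rw [(hd t).hasDerivWithinAt.derivWithin, hz t ⟨ht.1, ht.2.le⟩]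
      exact (uniqueDiffOn_Icc (ht.1.trans_lt ht.2)) t ⟨ht.1, ht.2.le⟩
    exact tendsto_nhds_unique (hlim t₁) ((hlim t₂).congr fun n => (heq n).symm)
  have hall : ∀ t ∈ Icc 0 T, H t = H 0 := by
    rcases hT.eq_or_lt with rfl | hT0
    · intro t ht
      rw [le_antisymm ht.2 ht.1]
    have hmid : T / 2 ∈ Ioo 0 T := ⟨by linarith, by linarith⟩
    have hop : ∀ t ∈ Ioo 0 T, H t = H (T / 2) := fun t ht => by
      rcases le_total t (T / 2) with h' | h'
      · exact hconst t ht _ hmid h'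
      · exact (hconst _ hmid t ht h').symm
    have hcl : ∀ t ∈ Icc 0 T, H t = H (T / 2) := by
      rw [← closure_Ioo hT0.ne]
      exact fun t ht => closure_minimal (t := {t | H t = H (T / 2)}) hop
        (isClosed_eq hHc continuous_const) ht
    exact fun t ht => (hcl t ht).trans (hcl 0 ⟨le_rfl, hT⟩).symm
  have h1 := hall t ht
  simp only [hH, hcle t ht, hcle 0 ⟨le_rfl, hT⟩, intervalIntegral.integral_same, sub_zero] at h1
  have h2 : ∫ s in (0 : ℝ)..t, G' s = ∫ s in (0 : ℝ)..t, G s :=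
    intervalIntegral.integral_congr fun s hs => by
      rw [uIcc_of_le ht.1] at hs
      simp only [hG', hcle s ⟨hs.1, hs.2.trans ht.2⟩]
  rw [← h2, ← h1]
  ring

end DuBoisReymond

/-! ### Distributional transport equations in `L²`: energy estimate and stability. -/

section Transport

/-- `u_t + s u_x = f` in the sense of distributions on `(0, T) × ℝ`. -/
def IsTransportSolution (s T : ℝ) (u f : ℝ → L2) : Prop :=
  ∀ φ : ℝ × ℝ → ℂ, IsTestFunction T φ →
    ∫ t in 0..T, ∫ x, u t x * fderiv ℝ φ (t, x) (1, s) = -∫ t in 0..T, ∫ x, f t x * φ (t, x)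

variable {s T : ℝ} {φ : ℝ × ℝ → ℂ}

theorem IsTestFunction.eq_zero (_hφ : IsTestFunction T φ) (t : ℝ) :
    ∀ x ∉ Prod.snd '' tsupport φ, φ (t, x) = 0 := fun x hx =>
  image_eq_zero_of_notMem_tsupport fun h => hx ⟨(t, x), h, rfl⟩

theorem IsTestFunction.fderiv_eq_zero (_hφ : IsTestFunction T φ) (v : ℝ × ℝ) (t : ℝ) :
    ∀ x ∉ Prod.snd '' tsupport φ, fderiv ℝ φ (t, x) v = 0 := fun x hx => by
  have : fderiv ℝ φ (t, x) = 0 := by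
    by_contra h
    exact hx ⟨(t, x), support_fderiv_subset ℝ h, rfl⟩
  rw [this]
  rfl

theorem IsTestFunction.isCompact (hφ : IsTestFunction T φ) :
    IsCompact (Prod.snd '' tsupport φ) := hφ.hasCompactSupport.isCompact.image continuous_snd

theorem IsTestFunction.continuous_fderiv_apply (hφ : IsTestFunction T φ) (v : ℝ × ℝ) :
    Continuous fun z => fderiv ℝ φ z v :=
  (hφ.contDiff.continuous_fderiv (by norm_num)).clm_apply continuous_const

theorem IsTestFunction.continuousOn_pairing (hφ : IsTestFunction T φ) {u : ℝ → L2} {S : Set ℝ}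
    (hu : ContinuousOn u S) : ContinuousOn (fun t => ∫ x, u t x * φ (t, x)) S :=
  continuousOn_integral_mul hu (φ := fun t x => φ (t, x)) hφ.contDiff.continuous hφ.isCompact
    hφ.eq_zero

theorem IsTestFunction.continuousOn_fderiv_pairing (hφ : IsTestFunction T φ) (v : ℝ × ℝ)
    {u : ℝ → L2} {S : Set ℝ} (hu : ContinuousOn u S) :
    ContinuousOn (fun t => ∫ x, u t x * fderiv ℝ φ (t, x) v) S :=
  continuousOn_integral_mul hu (φ := fun t x => fderiv ℝ φ (t, x) v)
    (hφ.continuous_fderiv_apply v) hφ.isCompact (hφ.fderiv_eq_zero v)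

theorem IsTestFunction.memLp (hφ : IsTestFunction T φ) (t : ℝ) :
    MemLp (fun x => φ (t, x)) 2 volume :=
  memLp_of_continuous_of_eq_zero (hφ.contDiff.continuous.comp (Continuous.prodMk_right t))
    hφ.isCompact (hφ.eq_zero t)

theorem IsTestFunction.memLp_fderiv (hφ : IsTestFunction T φ) (v : ℝ × ℝ) (t : ℝ) :
    MemLp (fun x => fderiv ℝ φ (t, x) v) 2 volume :=
  memLp_of_continuous_of_eq_zero ((hφ.continuous_fderiv_apply v).comp (Continuous.prodMk_right t))
    hφ.isCompact (hφ.fderiv_eq_zero v t)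

theorem integral_sub_mul {u v : L2} {ψ : ℝ → ℂ} (hψ : MemLp ψ 2 volume) :
    ∫ x, (u - v : L2) x * ψ x = (∫ x, u x * ψ x) - ∫ x, v x * ψ x := by
  rw [← integral_sub (integrable_mul_of_memLp u hψ) (integrable_mul_of_memLp v hψ)]
  refine integral_congr_ae ?_
  filter_upwards [Lp.coeFn_sub u v] with x hx
  rw [hx, Pi.sub_apply, sub_mul]

theorem IsTransportSolution.sub {u f u' f' : ℝ → L2} (hT : 0 ≤ T)
    (h : IsTransportSolution s T u f) (h' : IsTransportSolution s T u' f')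
    (hu : ContinuousOn u (Icc 0 T)) (hf : ContinuousOn f (Icc 0 T))
    (hu' : ContinuousOn u' (Icc 0 T)) (hf' : ContinuousOn f' (Icc 0 T)) :
    IsTransportSolution s T (fun t => u t - u' t) (fun t => f t - f' t) := by
  intro φ hφ
  rw [← uIcc_of_le hT] at hu hf hu' hf'
  simp only [fun t => integral_sub_mul (u := u t) (v := u' t) (hφ.memLp_fderiv (1, s) t),
    fun t => integral_sub_mul (u := f t) (v := f' t) (hφ.memLp t)]
  rw [intervalIntegral.integral_sub
      (hφ.continuousOn_fderiv_pairing (1, s) hu).intervalIntegrable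
      (hφ.continuousOn_fderiv_pairing (1, s) hu').intervalIntegrable,
    intervalIntegral.integral_sub (hφ.continuousOn_pairing hf).intervalIntegrable
      (hφ.continuousOn_pairing hf').intervalIntegrable, h φ hφ, h' φ hφ]
  ring

/-- Test functions for the moving frame: a cutoff in time multiplied by a profile carried along the
characteristics. -/
theorem isTestFunction_mul_comp_sub {χ : ℝ → ℝ} {ψ : ℝ → ℂ} (hχ : ContDiff ℝ ∞ χ)
    (hχc : HasCompactSupport χ) (hχT : tsupport χ ⊆ Ioo 0 T) (hψ : ContDiff ℝ ∞ ψ)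
    (hψc : HasCompactSupport ψ) (s : ℝ) :
    IsTestFunction T fun p => χ p.1 • ψ (p.2 - s * p.1) where
  contDiff := (hχ.comp contDiff_fst).smul
    (hψ.comp (contDiff_snd.sub (contDiff_const.mul contDiff_fst)))
  hasCompactSupport := by
    refine HasCompactSupport.intro (K := (fun p : ℝ × ℝ => (p.1, p.2 + s * p.1)) ''
      (tsupport χ ×ˢ tsupport ψ)) ((hχc.isCompact.prod hψc.isCompact).image (by fun_prop)) ?_
    intro p hp
    by_contra h
    refine hp ⟨(p.1, p.2 - s * p.1), ⟨subset_tsupport _ fun h' => h ?_,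
      subset_tsupport _ fun h' => h ?_⟩, by simp⟩
    · simp only at h'
      simp [h']
    · simp only at h'
      simp [h']
  tsupport_subset := by
    have : tsupport (fun p : ℝ × ℝ => χ p.1 • ψ (p.2 - s * p.1)) ⊆ Prod.fst ⁻¹' tsupport χ := by
      refine closure_minimal (fun p hp => subset_tsupport _ fun h' => hp ?_)
        ((isClosed_tsupport χ).preimage continuous_fst)
      simp [h']
    exact fun p hp => ⟨hχT (this hp), mem_univ _⟩

/-- The direction `(1, s)` is tangent to the characteristics, on which the profile is constant, so
only the time cutoff is differentiated. -/
theorem fderiv_mul_comp_sub {χ : ℝ → ℝ} {ψ : ℝ → ℂ} (hχ : ContDiff ℝ ∞ χ) (hψ : ContDiff ℝ ∞ ψ)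
    (s t x : ℝ) :
    fderiv ℝ (fun p : ℝ × ℝ => χ p.1 • ψ (p.2 - s * p.1)) (t, x) (1, s) =
      deriv χ t • ψ (x - s * t) := by
  have h1 : ContDiff ℝ ∞ fun p : ℝ × ℝ => χ p.1 • ψ (p.2 - s * p.1) :=
    (hχ.comp contDiff_fst).smul (hψ.comp (contDiff_snd.sub (contDiff_const.mul contDiff_fst)))
  have hline : HasDerivAt (fun τ : ℝ => (τ, x - s * t + s * τ)) (1, s) t := by
    refine (hasDerivAt_id t).prodMk ?_
    simpa using ((hasDerivAt_id t).const_mul s).const_add (x - s * t)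
  have hx : (t, x) = (t, x - s * t + s * t) := by simp
  have h2 := (h1.differentiable (by norm_num)
    (t, x - s * t + s * t)).hasFDerivAt.comp_hasDerivAt t hline
  have h3 : HasDerivAt (fun τ => χ τ • ψ (x - s * t)) (deriv χ t • ψ (x - s * t)) t :=
    ((hχ.differentiable (by norm_num) t).hasDerivAt).smul_const _
  rw [hx]
  refine h2.unique ?_
  convert! h3 using 1
  ext τ
  simp

/-- The energy estimate in `L²` for the transport equation. -/
theorem IsTransportSolution.norm_le {u f : ℝ → L2} (h : IsTransportSolution s T u f)
    (hu : ContinuousOn u (Icc 0 T)) (hf : ContinuousOn f (Icc 0 T)) {t : ℝ} (ht : t ∈ Icc 0 T) :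
    ‖u t‖ ≤ ‖u 0‖ + ∫ τ in (0 : ℝ)..t, ‖f τ‖ := by
  have hT : 0 ≤ T := ht.1.trans ht.2
  have hsub : uIcc 0 t ⊆ Icc 0 T := by
    rw [uIcc_of_le ht.1]
    exact Icc_subset_Icc_right ht.2
  have hfi : IntervalIntegrable (fun τ => ‖f τ‖) volume 0 t :=
    (hf.norm.mono hsub).intervalIntegrable
  set C := ‖u 0‖ + ∫ τ in (0 : ℝ)..t, ‖f τ‖ with hC
  have hC0 : 0 ≤ C := add_nonneg (norm_nonneg _)
    (intervalIntegral.integral_nonneg ht.1 fun _ _ => norm_nonneg _)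
  -- Paired with a profile moving at speed `s`, the equation becomes a weak ordinary differential
  -- equation in time; its integrated form is bounded by Cauchy–Schwarz, since translation preserves
  -- the norm of `ψ`.
  have key : ∀ ψ : ℝ → ℂ, ContDiff ℝ ∞ ψ → HasCompactSupport ψ →
      ‖∫ x, u t x * ψ (x - s * t)‖ ≤ C * ‖toL2 ψ‖ := by
    intro ψ hψ hψc
    have hψm : MemLp ψ 2 volume := hψ.continuous.memLp_of_hasCompactSupport hψc
    have hψy : ∀ y, MemLp (fun x => ψ (x - y)) 2 volume := fun y =>
      hψm.comp_measurePreserving (measurePreserving_sub_right volume y)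
    have hpair : ∀ v : ℝ → L2, ContinuousOn v (Icc 0 T) →
        ContinuousOn (fun t => ∫ x, v t x * ψ (x - s * t)) (Icc 0 T) := by
      intro v hv
      set cl : ℝ → ℝ := fun t => projIcc 0 T hT t with hcl
      have hclc : Continuous cl := continuous_subtype_val.comp continuous_projIcc
      have hcle : ∀ t ∈ Icc 0 T, cl t = t := fun t ht => by simp [hcl, projIcc_of_mem hT ht]
      refine (continuousOn_integral_mul hv (φ := fun t x => ψ (x - s * cl t)) ?_
        (K := (fun p : ℝ × ℝ => p.1 + s * p.2) '' (tsupport ψ ×ˢ Icc 0 T))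
        ((hψc.isCompact.prod isCompact_Icc).image (by fun_prop)) ?_).congr fun t ht => by
          simp only [hcle t ht]
      · have := hψ.continuous
        change Continuous fun p : ℝ × ℝ => ψ (p.2 - s * cl p.1)
        fun_prop
      · intro t x hx
        by_contra h'
        exact hx ⟨(x - s * cl t, cl t), ⟨subset_tsupport _ h', (projIcc 0 T hT t).2⟩, by simp⟩
    have hweak := sub_eq_integral_of_weak_deriv (hpair u hu) (hpair f hf) (fun χ hχ hχc hχT => by
      have := h _ (isTestFunction_mul_comp_sub hχ hχc hχT hψ hψc s)
      simp only [fderiv_mul_comp_sub hχ hψ, mul_smul_comm, integral_smul] at this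
      exact this) ht
    have e0 : ‖∫ x, u 0 x * ψ (x - s * 0)‖ ≤ ‖u 0‖ * ‖toL2 ψ‖ := by
      simpa using norm_integral_mul_le (u 0) hψm
    have e1 : ‖∫ τ in (0 : ℝ)..t, ∫ x, f τ x * ψ (x - s * τ)‖ ≤
        (∫ τ in (0 : ℝ)..t, ‖f τ‖) * ‖toL2 ψ‖ := by
      rw [← intervalIntegral.integral_mul_const]
      refine intervalIntegral.norm_integral_le_of_norm_le ht.1 (ae_of_all _ fun τ _ => ?_)
        (hfi.mul_const _)
      rw [← norm_toL2_comp_sub ψ hψm (s * τ)]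
      exact norm_integral_mul_le (f τ) (hψy _)
    rw [sub_eq_iff_eq_add] at hweak
    rw [hweak]
    refine (norm_add_le _ _).trans ?_
    rw [hC, add_mul]
    linarith
  -- Smooth compactly supported functions are dense, so the bound holds against every `g`; choosing
  -- `g = u t` at the end gives the norm.
  have key2 : ∀ g : L2, ‖inner ℂ g (u t)‖ ≤ C * ‖g‖ := by
    have hd := Lp.dense_hasCompactSupport_contDiff (E := ℝ) (F := ℂ) (μ := volume) (p := 2)
      (by norm_num)
    intro g
    refine hd.induction (P := fun g : L2 => ‖inner ℂ g (u t)‖ ≤ C * ‖g‖) ?_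
      (isClosed_le (by fun_prop) (by fun_prop)) g
    rintro g ⟨η, hgη, hηc, hη⟩
    have hηm : MemLp η 2 volume := hη.continuous.memLp_of_hasCompactSupport hηc
    have hg : g = toL2 η := Lp.ext (hgη.trans (coeFn_toL2 hηm).symm)
    have hconj : ContDiff ℝ ∞ fun x => conj (η x) := Complex.conjCLE.contDiff.comp hη
    have hconjc : HasCompactSupport fun x => conj (η x) := hηc.comp_left (map_zero _)
    have hk := key (fun x => conj (η (x + s * t)))
      (hconj.comp (contDiff_id.add contDiff_const))
      (hconjc.comp_homeomorph (Homeomorph.addRight (s * t)))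
    have hcm : MemLp (fun x => conj (η x)) 2 volume := hηm.star
    have e1 := integral_mul_eq_inner (u t) hcm
    simp only [Complex.conj_conj] at e1
    have e2 : ‖toL2 fun x => conj (η (x + s * t))‖ = ‖toL2 η‖ := by
      have := norm_toL2_comp_sub _ hcm (-(s * t))
      simp only [sub_neg_eq_add] at this
      rw [this, norm_toL2_conj hηm]
    rw [e2] at hk
    simp only [sub_add_cancel] at hk
    rw [hg, ← e1]
    exact hk
  by_contra hlt
  push Not at hlt
  have h1 := key2 (u t)
  rw [inner_self_eq_norm_sq_to_K, norm_pow, RCLike.norm_ofReal, abs_norm] at h1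
  nlinarith [norm_nonneg (u t)]

/-- A continuously differentiable solution of the transport equation is a solution in the sense of
distributions. -/
theorem isTransportSolution_of_contDiff {w : ℝ × ℝ → ℂ} (hT : 0 ≤ T) (hw : ContDiff ℝ 1 w)
    {u f : ℝ → L2} (hu : ∀ t ∈ Icc 0 T, u t =ᵐ[volume] fun x => w (t, x))
    (hf : ∀ t ∈ Icc 0 T, f t =ᵐ[volume] fun x => fderiv ℝ w (t, x) (1, s)) :
    IsTransportSolution s T u f := by
  intro φ hφ
  set g : ℝ × ℝ → ℂ := fun z => fderiv ℝ w z (1, s)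
  have hg : Continuous g := (hw.continuous_fderiv one_ne_zero).clm_apply continuous_const
  have hφd : Continuous fun z => fderiv ℝ φ z (1, s) := hφ.continuous_fderiv_apply (1, s)
  have hsupp : ∀ z ∉ tsupport φ, fderiv ℝ φ z (1, s) = 0 := fun z hz => by
    have : fderiv ℝ φ z = 0 := by
      by_contra h
      exact hz (support_fderiv_subset ℝ h)
    rw [this]
    rfl
  have hint : ∀ k : ℝ × ℝ → ℂ, Continuous k → (∀ z ∉ tsupport φ, k z = 0) →
      Integrable k := fun k hk hk0 =>
    hk.integrable_of_hasCompactSupport (HasCompactSupport.intro hφ.hasCompactSupport.isCompact hk0)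
  have hfub : ∀ k : ℝ × ℝ → ℂ, Continuous k → (∀ z ∉ tsupport φ, k z = 0) →
      ∫ z, k z = ∫ t in 0..T, ∫ x, k (t, x) := by
    intro k hk hk0
    rw [Measure.volume_eq_prod, integral_prod _ (hint k hk hk0), intervalIntegral.integral_of_le hT]
    refine (setIntegral_eq_integral_of_forall_compl_eq_zero fun t ht => ?_).symm
    have : ∀ x, k (t, x) = 0 := fun x => hk0 _ fun h' =>
      ht ⟨(hφ.tsupport_subset h').1.1, (hφ.tsupport_subset h').1.2.le⟩
    simp [this]
  have hi1 : ∀ z ∉ tsupport φ, w z * fderiv ℝ φ z (1, s) = 0 := fun z hz => by simp [hsupp z hz]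
  have hi2 : ∀ z ∉ tsupport φ, g z * φ z = 0 := fun z hz => by
    simp [image_eq_zero_of_notMem_tsupport hz]
  have hi3 : ∀ z ∉ tsupport φ, w z * φ z = 0 := fun z hz => by
    simp [image_eq_zero_of_notMem_tsupport hz]
  have hc1 : Continuous fun z => w z * fderiv ℝ φ z (1, s) := hw.continuous.mul hφd
  have hc2 : Continuous fun z => g z * φ z := hg.mul hφ.contDiff.continuous
  have hc3 : Continuous fun z => w z * φ z := hw.continuous.mul hφ.contDiff.continuous
  -- Integration by parts over the whole plane in the direction `(1, s)`; the support of `φ` lies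
  -- inside the open strip, so there are no terms at `t = 0` or `t = T`.
  have hibp := integral_bilinear_hasLineDerivAt_right_eq_neg_left_of_integrable
    (μ := (volume : Measure (ℝ × ℝ))) (B := ContinuousLinearMap.mul ℝ ℂ) (f := w) (f' := g)
    (g := φ) (g' := fun z => fderiv ℝ φ z (1, s)) (v := (1, s))
    (hint _ hc2 hi2) (hint _ hc1 hi1) (hint _ hc3 hi3)
    (fun z _ => (hw.differentiable one_ne_zero z).hasFDerivAt.hasLineDerivAt (1, s))
    (fun z _ => (hφ.contDiff.differentiable (by norm_num) z).hasFDerivAt.hasLineDerivAt (1, s))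
  simp only [ContinuousLinearMap.mul_apply'] at hibp
  rw [hfub _ hc1 hi1, hfub _ hc2 hi2] at hibp
  calc _ = ∫ t in 0..T, ∫ x, w (t, x) * fderiv ℝ φ (t, x) (1, s) := by
        refine intervalIntegral.integral_congr fun t ht => integral_congr_ae ?_
        rw [uIcc_of_le hT] at ht
        filter_upwards [hu t ht] with x hx
        rw [hx]
    _ = _ := hibp
    _ = _ := by
        congr 1
        refine intervalIntegral.integral_congr fun t ht => integral_congr_ae ?_
        rw [uIcc_of_le hT] at ht
        filter_upwards [hf t ht] with x hx
        rw [hx]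

theorem tendsto_integral_pairing {u : ℝ → L2} {un : ℕ → ℝ → L2} (hT : 0 ≤ T)
    (hu : ContinuousOn u (Icc 0 T)) (hun : ∀ n, ContinuousOn (un n) (Icc 0 T))
    (hlim : TendstoUniformlyOn un u atTop (Icc 0 T)) {φ : ℝ → ℝ → ℂ} (hφ : Continuous φ.uncurry)
    {K : Set ℝ} (hK : IsCompact K) (h : ∀ t, ∀ x ∉ K, φ t x = 0) :
    Tendsto (fun n => ∫ t in 0..T, ∫ x, un n t x * φ t x) atTop
      (𝓝 (∫ t in 0..T, ∫ x, u t x * φ t x)) := by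
  have hm : ∀ t, MemLp (φ t) 2 volume := fun t =>
    memLp_of_continuous_of_eq_zero (hφ.comp (Continuous.prodMk_right t)) hK (h t)
  have hcont : Continuous fun t => toL2 (φ t) := continuous_toL2 hφ hK h
  obtain ⟨C, hC⟩ := (isCompact_Icc (a := 0) (b := T)).exists_bound_of_continuousOn
      hcont.continuousOn
  have hC0 : 0 ≤ C := (norm_nonneg _).trans (hC 0 ⟨le_rfl, hT⟩)
  have hint : ∀ v : ℝ → L2, ContinuousOn v (Icc 0 T) →
      IntervalIntegrable (fun t => ∫ x, v t x * φ t x) volume 0 T := fun v hv => by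
    rw [← uIcc_of_le hT] at hv
    exact (continuousOn_integral_mul hv hφ hK h).intervalIntegrable
  rw [Metric.tendsto_atTop]
  intro ε hε
  have hε' : 0 < ε / (C * T + 1) := by positivity
  obtain ⟨N, hN⟩ := eventually_atTop.1 (Metric.tendstoUniformlyOn_iff.1 hlim _ hε')
  refine ⟨N, fun n hn => ?_⟩
  rw [dist_eq_norm, ← intervalIntegral.integral_sub (hint _ (hun n)) (hint _ hu)]
  have := intervalIntegral.norm_integral_le_of_norm_le_const (a := 0) (b := T)
    (f := fun t => (∫ x, un n t x * φ t x) - ∫ x, u t x * φ t x)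
    (C := ε / (C * T + 1) * C) fun t ht => by
      rw [uIoc_of_le hT] at ht
      have ht' : t ∈ Icc 0 T := ⟨ht.1.le, ht.2⟩
      rw [← integral_sub_mul (hm t)]
      refine (norm_integral_mul_le _ (hm t)).trans ?_
      have h1 := hN n hn t ht'
      rw [dist_comm, dist_eq_norm] at h1
      exact mul_le_mul h1.le (hC t ht') (norm_nonneg _) hε'.le
  refine this.trans_lt ?_
  rw [sub_zero, abs_of_nonneg hT, div_mul_eq_mul_div, div_mul_eq_mul_div, div_lt_iff₀
      (by positivity)]
  nlinarith

/-- Both sides of the weak equation are pairings with fixed test functions, hence continuous under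
uniform convergence in `L²`. -/
theorem IsTransportSolution.of_tendsto {u f : ℝ → L2} {un fn : ℕ → ℝ → L2} (hT : 0 ≤ T)
    (h : ∀ n, IsTransportSolution s T (un n) (fn n))
    (hun : ∀ n, ContinuousOn (un n) (Icc 0 T)) (hfn : ∀ n, ContinuousOn (fn n) (Icc 0 T))
    (hu : TendstoUniformlyOn un u atTop (Icc 0 T)) (hf : TendstoUniformlyOn fn f atTop (Icc 0 T)) :
    IsTransportSolution s T u f := by
  intro φ hφ
  have huc : ContinuousOn u (Icc 0 T) := hu.continuousOn (Frequently.of_forall hun)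
  have hfc : ContinuousOn f (Icc 0 T) := hf.continuousOn (Frequently.of_forall hfn)
  have h1 := tendsto_integral_pairing hT huc hun hu (φ := fun t x => fderiv ℝ φ (t, x) (1, s))
    (hφ.continuous_fderiv_apply (1, s)) hφ.isCompact (hφ.fderiv_eq_zero (1, s))
  have h2 := tendsto_integral_pairing hT hfc hfn hf (φ := fun t x => φ (t, x))
    hφ.contDiff.continuous hφ.isCompact hφ.eq_zero
  simp only [fun n => h n φ hφ] at h1
  exact tendsto_nhds_unique h1 h2.neg

/-- Grönwall's inequality in integral form: the differential form is applied to the right-hand side,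
which is differentiable even when `e` is only continuous. -/
theorem le_mul_exp_of_le_add_integral {e : ℝ → ℝ} {A K : ℝ} (hK : 0 ≤ K)
    (he : ContinuousOn e (Icc 0 T))
    (h : ∀ t ∈ Icc 0 T, e t ≤ A + ∫ τ in (0 : ℝ)..t, K * e τ) {t : ℝ} (ht : t ∈ Icc 0 T) :
    e t ≤ A * Real.exp (K * t) := by
  have hT : 0 ≤ T := ht.1.trans ht.2
  set cl : ℝ → ℝ := fun t => projIcc 0 T hT t with hcl
  have hclc : Continuous cl := continuous_subtype_val.comp continuous_projIcc
  have hclm : ∀ t, cl t ∈ Icc 0 T := fun t => (projIcc 0 T hT t).2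
  have hcle : ∀ t ∈ Icc 0 T, cl t = t := fun t ht => by simp [hcl, projIcc_of_mem hT ht]
  have hec : Continuous fun t => K * e (cl t) := continuous_const.mul (he.comp_continuous hclc hclm)
  have hcongr : ∀ t ∈ Icc 0 T, ∫ τ in (0 : ℝ)..t, K * e (cl τ) = ∫ τ in (0 : ℝ)..t, K * e τ :=
    fun t ht => intervalIntegral.integral_congr fun τ hτ => by
      rw [uIcc_of_le ht.1] at hτ
      simp only [hcle τ ⟨hτ.1, hτ.2.trans ht.2⟩]
  have hd : ∀ t, HasDerivAt (fun t => A + ∫ τ in (0 : ℝ)..t, K * e (cl τ)) (K * e (cl t)) t :=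
    fun t => (intervalIntegral.integral_hasDerivAt_right (hec.intervalIntegrable _ _)
      (hec.stronglyMeasurableAtFilter _ _) hec.continuousAt).const_add A
  have hg := le_mul_exp_integral (g := fun _ => K) continuous_const hd ht.1 fun τ hτ => by
    have hτ' : τ ∈ Icc 0 T := ⟨hτ.1.le, hτ.2.le.trans ht.2⟩
    rw [hcle τ hτ', hcongr τ hτ']
    exact mul_le_mul_of_nonneg_left (h τ hτ') hK
  rw [hcongr t ht] at hg
  refine (h t ht).trans (hg.trans (le_of_eq ?_))
  simp [mul_comm]

end Transport

/-! ### Structure of the nonlinearity and its truncation. -/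

section Nonlinearity

/-- The chain rule with `∂(z z̄)/∂z̄ = z`. It shows that a potential depending on moduli only
contributes a real multiple of the unknown. -/
theorem dbar_ofReal_comp_norm_sq {f : ℝ → ℝ} {d : ℝ} {u : ℂ} (hf : HasDerivAt f d (‖u‖ ^ 2)) :
    dbar (fun z => (f (‖z‖ ^ 2) : ℂ)) u = d * u := by
  have h1 : HasFDerivAt (fun z : ℂ => f (‖z‖ ^ 2)) (d • (2 • innerSL ℝ u)) u :=
    hf.comp_hasFDerivAt u (hasStrictFDerivAt_norm_sq u).hasFDerivAt
  have h2 : HasFDerivAt (fun z : ℂ => (f (‖z‖ ^ 2) : ℂ))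
      (Complex.ofRealCLM.comp (d • (2 • innerSL ℝ u))) u :=
    Complex.ofRealCLM.hasFDerivAt.comp u h1
  rw [dbar, h2.fderiv]
  apply Complex.ext <;> simp [Complex.inner] <;> ring

theorem contDiff_eval_mvPolynomial {E A ι : Type*} [NormedAddCommGroup E] [NormedSpace ℝ E]
    [NormedCommRing A] [NormedAlgebra ℝ A] (P : MvPolynomial ι A) {x : E → ι → A}
    (hx : ∀ i, ContDiff ℝ ∞ fun y => x y i) :
    ContDiff ℝ ∞ fun y => MvPolynomial.eval (x y) P := by
  induction P using MvPolynomial.induction_on with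
  | C a => simpa using contDiff_const
  | add p q hp hq => simpa using hp.add hq
  | mul_X p i hp => simpa using hp.mul (hx i)

theorem IsCubic.contDiff {F : ℂ → ℂ → ℂ} (h : IsCubic F) :
    ContDiff ℝ ∞ fun p : ℂ × ℂ => F p.1 p.2 := by
  obtain ⟨P, -, hP⟩ := h
  simp only [hP]
  refine contDiff_eval_mvPolynomial P fun i => ?_
  have hc : ContDiff ℝ ∞ (fun z : ℂ => conj z) := Complex.conjCLE.contDiff
  fin_cases i
  · exact contDiff_fst
  · exact contDiff_snd
  · exact hc.comp contDiff_fst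
  · exact hc.comp contDiff_snd

theorem A1.exists_deriv {W : ℂ → ℂ → ℝ} (h : A1 W) : ∃ q₁ q₂ : ℝ × ℝ → ℝ, ContDiff ℝ ∞ q₁ ∧
    ContDiff ℝ ∞ q₂ ∧ ∀ u v, dbar (fun z => (W z v : ℂ)) u = q₁ (‖u‖ ^ 2, ‖v‖ ^ 2) * u ∧
      dbar (fun z => (W u z : ℂ)) v = q₂ (‖u‖ ^ 2, ‖v‖ ^ 2) * v := by
  obtain ⟨P, hP⟩ := h
  set p : ℝ × ℝ → ℝ := fun y => MvPolynomial.eval ![y.1, y.2] P with hp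
  have hpc : ContDiff ℝ ∞ p := contDiff_eval_mvPolynomial P fun i => by
    fin_cases i
    · exact contDiff_fst
    · exact contDiff_snd
  have hd : ∀ v : ℝ × ℝ, ContDiff ℝ ∞ fun y => fderiv ℝ p y v := fun v =>
    (hpc.fderiv_right (m := ∞) (by simp)).clm_apply contDiff_const
  have hp' : ∀ y, HasFDerivAt p (fderiv ℝ p y) y := fun y =>
    (hpc.differentiable (by simp) y).hasFDerivAt
  have e₁ : ∀ r q : ℝ, HasDerivAt (fun r => p (r, q)) (fderiv ℝ p (r, q) (1, 0)) r := fun r q =>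
    HasFDerivAt.comp_hasDerivAt (l := p) (f := fun r : ℝ => (r, q)) r (hp' (r, q))
      ((hasDerivAt_id r).prodMk (hasDerivAt_const r q))
  have e₂ : ∀ r q : ℝ, HasDerivAt (fun q => p (r, q)) (fderiv ℝ p (r, q) (0, 1)) q := fun r q =>
    HasFDerivAt.comp_hasDerivAt (l := p) (f := fun q : ℝ => (r, q)) q (hp' (r, q))
      ((hasDerivAt_const q r).prodMk (hasDerivAt_id q))
  refine ⟨fun y => fderiv ℝ p y (1, 0), fun y => fderiv ℝ p y (0, 1), hd _, hd _,
    fun u v => ⟨?_, ?_⟩⟩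
  · simp only [hP]
    exact dbar_ofReal_comp_norm_sq (e₁ (‖u‖ ^ 2) (‖v‖ ^ 2))
  · simp only [hP]
    exact dbar_ofReal_comp_norm_sq (e₂ (‖u‖ ^ 2) (‖v‖ ^ 2))

/-- The properties of the right-hand sides of the system `u_t + u_x = g₁(u, v)`,
`v_t - v_x = g₂(u, v)` on which the proof depends. -/
structure IsAdmissible (c : ℝ) (g₁ g₂ : ℂ → ℂ → ℂ) : Prop where
  contDiff_fst : ContDiff ℝ ∞ fun p : ℂ × ℂ => g₁ p.1 p.2
  contDiff_snd : ContDiff ℝ ∞ fun p : ℂ × ℂ => g₂ p.1 p.2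
  zero_fst : g₁ 0 0 = 0
  zero_snd : g₂ 0 0 = 0
  re_fst_le : ∀ u v, (conj u * g₁ u v).re ≤ c * (‖u‖ ^ 2 * ‖v‖ ^ 2)
  re_snd_le : ∀ u v, (conj v * g₂ u v).re ≤ c * (‖u‖ ^ 2 * ‖v‖ ^ 2)

theorem eq_zero_of_conj_mul_eq_zero {f : ℂ → ℂ} (hf : Continuous f)
    (h : ∀ z, conj z * f z = 0) : f 0 = 0 := by
  have hd : Dense ({0}ᶜ : Set ℂ) := dense_compl_singleton 0
  have hcl : IsClosed {z | f z = 0} := isClosed_eq hf continuous_const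
  have hsub : ({0}ᶜ : Set ℂ) ⊆ {z | f z = 0} := fun z hz => by
    have hz' : conj z ≠ 0 := by simpa using hz
    exact (mul_eq_zero.1 (h z)).resolve_left hz'
  exact closure_minimal hsub hcl (hd 0)

/-- The term `-i q |u|²` is purely imaginary; this is why `W`, of whatever degree, does not enter
the growth of the densities. -/
theorem re_conj_mul_neg_I_mul_add_le (q : ℝ) (u f : ℂ) :
    (conj u * (-Complex.I * (q * u + f))).re ≤ ‖conj u * f‖ := by
  have : (conj u * (-Complex.I * (q * u + f))).re = (-Complex.I * (conj u * f)).re := by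
    simp
    ring
  rw [this]
  refine (Complex.re_le_norm _).trans ?_
  simp

/-- Vanishing at the origin comes from (A2) on the axes: `ū F₁(u, 0) = 0` for all `u`, and
continuity removes the factor `ū` at `u = 0`. -/
theorem isAdmissible {W : ℂ → ℂ → ℝ} {F₁ F₂ : ℂ → ℂ → ℂ} {c : ℝ} (hW : A1 W) (hF : A2 c F₁ F₂) :
    IsAdmissible c (fun u v => -Complex.I * G₁ W F₁ u v) (fun u v => -Complex.I * G₂ W F₂ u v) := by
  obtain ⟨q₁, q₂, hq₁, hq₂, hq⟩ := hW.exists_deriv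
  obtain ⟨h₁, h₂, hb⟩ := hF
  have hG₁ : ∀ u v, G₁ W F₁ u v = q₁ (‖u‖ ^ 2, ‖v‖ ^ 2) * u + F₁ u v := fun u v => by
    rw [G₁, (hq u v).1]
  have hG₂ : ∀ u v, G₂ W F₂ u v = q₂ (‖u‖ ^ 2, ‖v‖ ^ 2) * v + F₂ u v := fun u v => by
    rw [G₂, (hq u v).2]
  have hN : ContDiff ℝ ∞ fun p : ℂ × ℂ => (‖p.1‖ ^ 2, ‖p.2‖ ^ 2) :=
    (contDiff_fst.norm_sq ℝ).prodMk (contDiff_snd.norm_sq ℝ)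
  have hof : ∀ {q : ℝ × ℝ → ℝ}, ContDiff ℝ ∞ q →
      ContDiff ℝ ∞ fun p : ℂ × ℂ => (q (‖p.1‖ ^ 2, ‖p.2‖ ^ 2) : ℂ) := fun hq =>
    Complex.ofRealCLM.contDiff.comp (hq.comp hN)
  have hF₁ : ∀ u, conj u * F₁ u 0 = 0 := fun u => by
    have := hb u 0
    rw [norm_zero] at this
    refine norm_eq_zero.1 (le_antisymm ?_ (norm_nonneg _))
    nlinarith [norm_nonneg (conj (0 : ℂ) * F₂ u 0)]
  have hF₂ : ∀ v, conj v * F₂ 0 v = 0 := fun v => by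
    have := hb 0 v
    rw [norm_zero] at this
    refine norm_eq_zero.1 (le_antisymm ?_ (norm_nonneg _))
    nlinarith [norm_nonneg (conj (0 : ℂ) * F₁ 0 v)]
  refine ⟨?_, ?_, ?_, ?_, fun u v => ?_, fun u v => ?_⟩
  · simp only [hG₁]
    exact contDiff_const.mul (((hof hq₁).mul contDiff_fst).add h₁.contDiff)
  · simp only [hG₂]
    exact contDiff_const.mul (((hof hq₂).mul contDiff_snd).add h₂.contDiff)
  · have : F₁ 0 0 = 0 := eq_zero_of_conj_mul_eq_zero (f := fun u => F₁ u 0)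
      (h₁.contDiff.continuous.comp (Continuous.prodMk_left 0)) hF₁
    simp [hG₁, this]
  · have : F₂ 0 0 = 0 := eq_zero_of_conj_mul_eq_zero (f := fun v => F₂ 0 v)
      (h₂.contDiff.continuous.comp (Continuous.prodMk_right 0)) hF₂
    simp [hG₂, this]
  · rw [hG₁]
    refine (re_conj_mul_neg_I_mul_add_le _ _ _).trans ?_
    linarith [hb u v, norm_nonneg (conj v * F₂ u v)]
  · rw [hG₂]
    refine (re_conj_mul_neg_I_mul_add_le _ _ _).trans ?_
    linarith [hb u v, norm_nonneg (conj u * F₁ u v)]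

/-- An admissible nonlinearity agrees on any ball with a smooth compactly supported admissible
one. -/
theorem IsAdmissible.exists_truncation {c : ℝ} {g₁ g₂ : ℂ → ℂ → ℂ} (hc : 0 ≤ c)
    (h : IsAdmissible c g₁ g₂) (R : ℝ) :
    ∃ k : (Fin 2 → ℂ) → Fin 2 → ℂ, ContDiff ℝ ∞ k ∧ HasCompactSupport k ∧
      IsAdmissible c (fun u v => k ![u, v] 0) (fun u v => k ![u, v] 1) ∧
      ∀ u v, ‖u‖ ≤ R → ‖v‖ ≤ R → k ![u, v] 0 = g₁ u v ∧ k ![u, v] 1 = g₂ u v := by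
  let χ : ContDiffBump (0 : Fin 2 → ℂ) := ⟨max R 1, max R 1 + 1, by positivity, by linarith⟩
  set k : (Fin 2 → ℂ) → Fin 2 → ℂ := fun y => χ y • ![g₁ (y 0) (y 1), g₂ (y 0) (y 1)] with hk
  have hpr : ContDiff ℝ ∞ fun y : Fin 2 → ℂ => (y 0, y 1) :=
    (contDiff_apply ℝ ℂ 0).prodMk (contDiff_apply ℝ ℂ 1)
  have hkc : ContDiff ℝ ∞ k := by
    refine χ.contDiff.smul (contDiff_pi.2 fun i => ?_)
    fin_cases i
    · exact h.contDiff_fst.comp hpr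
    · exact h.contDiff_snd.comp hpr
  have hpair : ContDiff ℝ ∞ fun p : ℂ × ℂ => ![p.1, p.2] := contDiff_pi.2 fun i => by
    fin_cases i
    · exact _root_.contDiff_fst
    · exact _root_.contDiff_snd
  have hkp := hkc.comp hpair
  -- A factor in `[0, 1]` preserves an upper bound that is nonnegative. So the constant `c` is the
  -- same for every truncation radius, and the smallness condition is independent of the radius.
  have hre : ∀ (y : Fin 2 → ℂ) (a b : ℂ) (B : ℝ), 0 ≤ B → (a * b).re ≤ B →
      (a * (χ y • b)).re ≤ B := by
    intro y a b B hB hab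
    rw [mul_smul_comm, Complex.smul_re, smul_eq_mul]
    nlinarith [χ.nonneg (x := y), χ.le_one (x := y)]
  refine ⟨k, hkc, χ.hasCompactSupport.smul_right, ⟨contDiff_pi.1 hkp 0, contDiff_pi.1 hkp 1,
    ?_, ?_, fun u v => ?_, fun u v => ?_⟩, fun u v hu hv => ?_⟩
  · simp [hk, h.zero_fst]
  · simp [hk, h.zero_snd]
  · exact hre _ _ _ _ (by positivity) (h.re_fst_le u v)
  · exact hre _ _ _ _ (by positivity) (h.re_snd_le u v)
  · have h1 : χ ![u, v] = 1 := by
      refine χ.one_of_mem_closedBall ?_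
      rw [mem_closedBall_zero_iff, pi_norm_le_iff_of_nonneg (by positivity)]
      intro i
      fin_cases i
      · exact hu.trans (le_max_left _ _)
      · exact hv.trans (le_max_left _ _)
    simp [hk, h1]

end Nonlinearity

/-! ### The Thirring, Federbusch and Gross–Neveu models. -/

section Models

theorem a1_thirringW (α : ℝ) : A1 (thirringW α) :=
  ⟨MvPolynomial.C α * (MvPolynomial.X 0 * MvPolynomial.X 1), fun u v => by simp [thirringW]⟩

theorem a1_federbuschW (α : ℝ) : A1 (federbuschW α) :=
  ⟨MvPolynomial.C α * ((MvPolynomial.X 0 + MvPolynomial.X 1) *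
    (MvPolynomial.X 0 * MvPolynomial.X 1)), fun u v => by simp [federbuschW]⟩

theorem a1_zero : A1 fun _ _ => 0 := ⟨0, fun u v => by simp⟩

theorem a2_zero : A2 1 (fun _ _ => 0) fun _ _ => 0 :=
  ⟨⟨0, by simp, by simp⟩, ⟨0, by simp, by simp⟩, fun u v => by simp; positivity⟩

theorem dbar_sq_conj_mul_add (α : ℝ) (a b u : ℂ) :
    dbar (fun z => α * (conj z * a + z * b) ^ 2) u = 2 * α * (conj u * a + u * b) * a := by
  have h0 : HasFDerivAt (fun z : ℂ => conj z) (Complex.conjCLE : ℂ →L[ℝ] ℂ) u :=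
    Complex.conjCLE.hasFDerivAt
  have h1 : HasFDerivAt (fun z : ℂ => α * (conj z * a + z * b) ^ 2) _ u :=
    (((h0.mul_const a).add ((hasFDerivAt_id (𝕜 := ℝ) u).mul_const b)).pow 2).const_mul (α : ℂ)
  rw [dbar, h1.fderiv]
  simp
  ring_nf
  simp
  ring

theorem grossNeveuF₁_eq (α : ℝ) (u v : ℂ) :
    grossNeveuF₁ α u v = 2 * α * (conj u * v + u * conj v) * v :=
  dbar_sq_conj_mul_add α v (conj v) u

theorem grossNeveuF₂_eq (α : ℝ) (u v : ℂ) :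
    grossNeveuF₂ α u v = 2 * α * (conj u * v + u * conj v) * u := by
  have := dbar_sq_conj_mul_add α u (conj u) v
  rw [grossNeveuF₂]
  convert! this using 1
  · congr 1
    ext z
    rw [grossNeveu]
    ring
  · ring

/-- From `|ūv + uv̄| ≤ 2|u||v|` each of the two terms is at most `4|α||u|²|v|²`. The summand `1`
only keeps the constant positive when `α = 0`. -/
theorem a2_grossNeveu (α : ℝ) : A2 (8 * |α| + 1) (grossNeveuF₁ α) (grossNeveuF₂ α) := by
  have hX : ∀ i j k : Fin 4, ((MvPolynomial.C (2 * α : ℂ) : MvPolynomial (Fin 4) ℂ) *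
      (MvPolynomial.X i * MvPolynomial.X j * MvPolynomial.X k)).totalDegree ≤ 3 := by
    intro i j k
    refine (MvPolynomial.totalDegree_mul _ _).trans ?_
    have h1 := MvPolynomial.totalDegree_mul
        (MvPolynomial.X i * MvPolynomial.X j : MvPolynomial (Fin 4) ℂ) (MvPolynomial.X k)
    have h2 := MvPolynomial.totalDegree_mul (MvPolynomial.X i : MvPolynomial (Fin 4) ℂ)
        (MvPolynomial.X j)
    simp only [MvPolynomial.totalDegree_X, MvPolynomial.totalDegree_C] at h1 h2 ⊢
    omega
  have hdeg : ∀ l : Fin 4, (MvPolynomial.C (2 * α : ℂ) * (MvPolynomial.X 2 * MvPolynomial.X 1 *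
      MvPolynomial.X l) + MvPolynomial.C (2 * α : ℂ) * (MvPolynomial.X 0 * MvPolynomial.X 3 *
      MvPolynomial.X l) : MvPolynomial (Fin 4) ℂ).totalDegree ≤ 3 := fun l =>
    (MvPolynomial.totalDegree_add _ _).trans (max_le (hX _ _ _) (hX _ _ _))
  refine ⟨⟨_, hdeg 1, fun u v => ?_⟩, ⟨_, hdeg 0, fun u v => ?_⟩, fun u v => ?_⟩
  · rw [grossNeveuF₁_eq]
    simp
    ring
  · rw [grossNeveuF₂_eq]
    simp
    ring
  · have hq : ‖conj u * v + u * conj v‖ ≤ 2 * (‖u‖ * ‖v‖) := by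
      refine (norm_add_le _ _).trans (le_of_eq ?_)
      simp
      ring
    rw [grossNeveuF₁_eq, grossNeveuF₂_eq]
    simp only [norm_mul, RCLike.norm_conj, Complex.norm_real, Complex.norm_ofNat, Real.norm_eq_abs]
    have hu := norm_nonneg u
    have hv := norm_nonneg v
    have : ‖u‖ * (2 * |α| * ‖conj u * v + u * conj v‖ * ‖v‖) +
        ‖v‖ * (2 * |α| * ‖conj u * v + u * conj v‖ * ‖u‖) =
        4 * |α| * (‖u‖ * ‖v‖) * ‖conj u * v + u * conj v‖ := by ring
    rw [this]
    calc _ ≤ 4 * |α| * (‖u‖ * ‖v‖) * (2 * (‖u‖ * ‖v‖)) := by gcongr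
      _ ≤ _ := by nlinarith [sq_nonneg (‖u‖ * ‖v‖)]

end Models

/-! ### Global classical solutions for smooth small data. -/

section Classical

theorem hasDerivAt_norm_sq_along {a : ℝ × ℝ → ℂ} (ha : ContDiff ℝ 1 a) (σ y t : ℝ) :
    HasDerivAt (fun s => ‖a (s, y + σ * s)‖ ^ 2)
      (2 * (conj (a (t, y + σ * t)) * fderiv ℝ a (t, y + σ * t) (1, σ)).re) t := by
  have hline : HasDerivAt (fun s : ℝ => (s, y + σ * s)) (1, σ) t := by
    refine (hasDerivAt_id t).prodMk ?_
    simpa using ((hasDerivAt_id t).const_mul σ).const_add y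
  have h1 : HasDerivAt (fun s => a (s, y + σ * s)) (fderiv ℝ a (t, y + σ * t) (1, σ)) t :=
    (ha.differentiable one_ne_zero _).hasFDerivAt.comp_hasDerivAt t hline
  have h2 := h1.norm_sq
  rw [Complex.inner, mul_comm (fderiv _ _ _ _)] at h2
  exact h2

/-- It suffices that `e < 4`. -/
theorem le_two_mul_of_sq_le_exp_one_mul {r q M : ℝ} (hq : 0 ≤ q) (hqM : q ≤ M)
    (h : r ^ 2 ≤ Real.exp 1 * q ^ 2) : r ≤ 2 * M := by
  have h1 : q ^ 2 ≤ M ^ 2 := by gcongr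
  have h2 := Real.exp_one_lt_d9
  exact (abs_le_of_sq_le_sq' (by nlinarith) (by linarith)).2

/-- Global classical solutions of the system with small smooth compactly supported initial
values. -/
theorem IsAdmissible.exists_classical {c m M : ℝ} {g₁ g₂ : ℂ → ℂ → ℂ} (hc : 0 < c)
    (h : IsAdmissible c g₁ g₂) (hm : Real.exp 1 * m * (2 * c) ≤ 1) {u₀ v₀ : ℝ → ℂ}
    (hu : ContDiff ℝ ∞ u₀) (hv : ContDiff ℝ ∞ v₀) (huc : HasCompactSupport u₀)
    (hvc : HasCompactSupport v₀) (hum : ∫ x, ‖u₀ x‖ ^ 2 ≤ m) (hvm : ∫ x, ‖v₀ x‖ ^ 2 ≤ m)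
    (huM : ∀ x, ‖u₀ x‖ ≤ M) (hvM : ∀ x, ‖v₀ x‖ ≤ M) :
    ∃ a b : ℝ × ℝ → ℂ, ContDiff ℝ 1 a ∧ ContDiff ℝ 1 b ∧ (∀ x, a (0, x) = u₀ x) ∧
      (∀ x, b (0, x) = v₀ x) ∧
      (∀ t x, 0 ≤ t → ‖a (t, x)‖ ^ 2 ≤ Real.exp 1 * ‖u₀ (x - t)‖ ^ 2) ∧
      (∀ t x, 0 ≤ t → ‖b (t, x)‖ ^ 2 ≤ Real.exp 1 * ‖v₀ (x + t)‖ ^ 2) ∧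
      (∀ t x, 0 ≤ t → ‖a (t, x)‖ ≤ 2 * M) ∧ (∀ t x, 0 ≤ t → ‖b (t, x)‖ ≤ 2 * M) ∧
      (∀ t x, 0 ≤ t → fderiv ℝ a (t, x) (1, 1) = g₁ (a (t, x)) (b (t, x))) ∧
      (∀ t x, 0 ≤ t → fderiv ℝ b (t, x) (1, -1) = g₂ (a (t, x)) (b (t, x))) := by
  have hM0 : 0 ≤ M := (norm_nonneg _).trans (huM 0)
  -- The truncated system is the one that is solved. Its solution satisfies the a priori bound with
  -- the same `c`, so for `t ≥ 0` it stays in the ball of radius `2M`, where the truncation changes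
  -- nothing.
  obtain ⟨k, hk, hkc, hka, hkg⟩ := h.exists_truncation hc.le (2 * M)
  have hw₀ : ContDiff ℝ 1 fun x => ![u₀ x, v₀ x] := contDiff_pi.2 fun i => by
    fin_cases i
    · exact hu.of_le (by simp)
    · exact hv.of_le (by simp)
  have hw₀c : HasCompactSupport fun x => ![u₀ x, v₀ x] := by
    refine HasCompactSupport.intro (huc.isCompact.union hvc.isCompact) fun x hx => ?_
    rw [mem_union, not_or] at hx
    simp [image_eq_zero_of_notMem_tsupport hx.1, image_eq_zero_of_notMem_tsupport hx.2]
  have hσ : ∀ i : Fin 2, |(![1, -1] : Fin 2 → ℝ) i| ≤ 1 := fun i => by fin_cases i <;> simp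
  obtain ⟨w, hw, hw0, hweq, hwb⟩ := exists_classical_solution hσ (hk.of_le (by norm_cast))
    hkc hw₀ hw₀c
  have hwv : ∀ z, w z = ![w z 0, w z 1] := fun z => by
    ext i
    fin_cases i <;> rfl
  have ha : ContDiff ℝ 1 fun z => w z 0 := contDiff_pi.1 hw 0
  have hb : ContDiff ℝ 1 fun z => w z 1 := contDiff_pi.1 hw 1
  have ha0 : ∀ x, w (0, x) 0 = u₀ x := fun x => by rw [hw0]; rfl
  have hb0 : ∀ x, w (0, x) 1 = v₀ x := fun x => by rw [hw0]; rfl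
  have ea : ∀ z, fderiv ℝ (fun y => w y 0) z (1, 1) = k ![w z 0, w z 1] 0 := fun z => by
    rw [← hwv]; exact hweq z 0
  have eb : ∀ z, fderiv ℝ (fun y => w y 1) z (1, -1) = k ![w z 0, w z 1] 1 := fun z => by
    rw [← hwv]; exact hweq z 1
  have hdens : ∀ t y, 0 ≤ t → ‖w (t, y + t) 0‖ ^ 2 ≤ Real.exp 1 * ‖w (0, y) 0‖ ^ 2 ∧
      ‖w (t, y - t) 1‖ ^ 2 ≤ Real.exp 1 * ‖w (0, y) 1‖ ^ 2 := by
    intro t y ht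
    -- This bound on the strip only determines the length of the continuation steps.
    obtain ⟨N, hN⟩ := hwb t
    have hN' : ∀ i, ∀ z : ℝ × ℝ, |z.1| ≤ t → ‖w z i‖ ^ 2 ≤ N ^ 2 := fun i z hz => by
      gcongr
      exact (norm_le_pi_norm _ i).trans (hN z hz)
    refine density_le_exp_one_mul (a := fun z => ‖w z 0‖ ^ 2) (b := fun z => ‖w z 1‖ ^ 2)
      (a' := fun z => 2 * (conj (w z 0) * k ![w z 0, w z 1] 0).re)
      (b' := fun z => 2 * (conj (w z 1) * k ![w z 0, w z 1] 1).re) (k := 2 * c) (m := m)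
      (ha.continuous.norm.pow 2) (hb.continuous.norm.pow 2) (fun z => by positivity)
      (fun z => by positivity) (by positivity) (fun y t => ?_) (fun y t => ?_) (fun z => ?_)
      (fun z => ?_) ?_ ?_ ?_ ?_ hm (hN' 0) (hN' 1) (right_mem_Icc.2 ht) y
    · have := hasDerivAt_norm_sq_along ha 1 y t
      simp only [one_mul] at this
      rwa [ea] at this
    · have := hasDerivAt_norm_sq_along hb (-1) y t
      simp only [neg_one_mul, ← sub_eq_add_neg] at this
      rwa [eb] at this
    · have := hka.re_fst_le (w z 0) (w z 1)
      linarith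
    · have := hka.re_snd_le (w z 0) (w z 1)
      linarith
    · simp only [ha0]
      exact (memLp_two_iff_integrable_sq_norm hu.continuous.aestronglyMeasurable).1
        (hu.continuous.memLp_of_hasCompactSupport huc)
    · simp only [hb0]
      exact (memLp_two_iff_integrable_sq_norm hv.continuous.aestronglyMeasurable).1
        (hv.continuous.memLp_of_hasCompactSupport hvc)
    · simpa only [ha0] using hum
    · simpa only [hb0] using hvm
  have hda : ∀ t x, 0 ≤ t → ‖w (t, x) 0‖ ^ 2 ≤ Real.exp 1 * ‖u₀ (x - t)‖ ^ 2 := fun t x ht => by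
    have := (hdens t (x - t) ht).1
    rwa [sub_add_cancel, ha0] at this
  have hdb : ∀ t x, 0 ≤ t → ‖w (t, x) 1‖ ^ 2 ≤ Real.exp 1 * ‖v₀ (x + t)‖ ^ 2 := fun t x ht => by
    have := (hdens t (x + t) ht).2
    rwa [add_sub_cancel_right, hb0] at this
  have hMa : ∀ t x, 0 ≤ t → ‖w (t, x) 0‖ ≤ 2 * M := fun t x ht =>
    le_two_mul_of_sq_le_exp_one_mul (norm_nonneg _) (huM _) (hda t x ht)
  have hMb : ∀ t x, 0 ≤ t → ‖w (t, x) 1‖ ≤ 2 * M := fun t x ht =>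
    le_two_mul_of_sq_le_exp_one_mul (norm_nonneg _) (hvM _) (hdb t x ht)
  refine ⟨fun z => w z 0, fun z => w z 1, ha, hb, ha0, hb0, hda, hdb, hMa, hMb,
    fun t x ht => ?_, fun t x ht => ?_⟩
  · rw [ea]
    exact (hkg _ _ (hMa t x ht) (hMb t x ht)).1
  · rw [eb]
    exact (hkg _ _ (hMa t x ht) (hMb t x ht)).2

theorem isClassicalSolution_of_fderiv {W : ℂ → ℂ → ℝ} {F₁ F₂ : ℂ → ℂ → ℂ} {T : ℝ} (hT : 0 < T)
    {a b : ℝ × ℝ → ℂ} (ha : ContDiff ℝ 1 a) (hb : ContDiff ℝ 1 b)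
    (h₁ : ∀ t x, 0 ≤ t →
      fderiv ℝ a (t, x) (1, 1) = -Complex.I * G₁ W F₁ (a (t, x)) (b (t, x)))
    (h₂ : ∀ t x, 0 ≤ t →
      fderiv ℝ b (t, x) (1, -1) = -Complex.I * G₂ W F₂ (a (t, x)) (b (t, x))) :
    IsClassicalSolution W F₁ F₂ T (fun t x => a (t, x)) (fun t x => b (t, x)) := by
  have hI : ∀ z : ℂ, Complex.I * (-Complex.I * z) = z := fun z => by
    rw [← mul_assoc, mul_neg, Complex.I_mul_I]
    simp
  have ht : ∀ {f : ℝ × ℝ → ℂ}, ContDiff ℝ 1 f → ∀ t ∈ Icc 0 T, ∀ x,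
      derivWithin (fun s => f (s, x)) (Icc 0 T) t = fderiv ℝ f (t, x) (1, 0) := by
    intro f hf t ht x
    have : HasDerivAt (fun s => f (s, x)) (fderiv ℝ f (t, x) (1, 0)) t :=
      HasFDerivAt.comp_hasDerivAt (l := f) (f := fun s : ℝ => (s, x)) t
        (hf.differentiable one_ne_zero (t, x)).hasFDerivAt
        ((hasDerivAt_id t).prodMk (hasDerivAt_const t x))
    exact this.hasDerivWithinAt.derivWithin (uniqueDiffOn_Icc hT t ht)
  have hx : ∀ {f : ℝ × ℝ → ℂ}, ContDiff ℝ 1 f → ∀ t x,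
      deriv (fun y => f (t, y)) x = fderiv ℝ f (t, x) (0, 1) := by
    intro f hf t x
    have : HasDerivAt (fun y => f (t, y)) (fderiv ℝ f (t, x) (0, 1)) x :=
      HasFDerivAt.comp_hasDerivAt (l := f) (f := fun y : ℝ => (t, y)) x
        (hf.differentiable one_ne_zero (t, x)).hasFDerivAt
        ((hasDerivAt_const x t).prodMk (hasDerivAt_id x))
    exact this.deriv
  refine ⟨ha.contDiffOn, hb.contDiffOn, fun t htT x => ?_, fun t htT x => ?_⟩
  · rw [ht ha t htT x, hx ha t x, ← map_add]
    simp only [Prod.mk_add_mk, add_zero, zero_add]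
    rw [h₁ t x htT.1, hI]
  · rw [ht hb t htT x, hx hb t x, ← map_sub]
    simp only [Prod.mk_sub_mk, sub_zero, zero_sub]
    rw [h₂ t x htT.1, hI]

end Classical

/-! ### Smooth approximation, almost everywhere limits, and escaping windows. -/

section Approximation

/-- A bounded function in `L²` is approximated in `L²` by uniformly bounded smooth compactly
supported functions. -/
theorem exists_smooth_approx {u₀ : L2} {M : ℝ} (hM : ∀ᵐ x, ‖u₀ x‖ ≤ M) {ε : ℝ} (hε : 0 < ε) :
    ∃ g : ℝ → ℂ, ContDiff ℝ ∞ g ∧ HasCompactSupport g ∧ (∀ x, ‖g x‖ ≤ max M 1 + 1) ∧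
      ‖toL2 g - u₀‖ < ε := by
  let χ : ContDiffBump (0 : ℂ) := ⟨max M 1, max M 1 + 1, by positivity, by linarith⟩
  -- `Φ` is bounded, Lipschitz and the identity on the values of `u₀`. Composing an
  -- `L²`-approximation with it makes the approximation bounded and costs only the Lipschitz
  -- constant.
  set Φ : ℂ → ℂ := fun z => χ z • z with hΦ
  have hΦc : ContDiff ℝ ∞ Φ := χ.contDiff.smul contDiff_id
  have hΦ0 : Φ 0 = 0 := by simp [hΦ]
  have hΦb : ∀ z, ‖Φ z‖ ≤ max M 1 + 1 := by
    intro z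
    by_cases hz : z ∈ Metric.ball (0 : ℂ) (max M 1 + 1)
    · rw [mem_ball_zero_iff] at hz
      rw [hΦ, norm_smul, Real.norm_of_nonneg χ.nonneg]
      exact (mul_le_of_le_one_left (norm_nonneg _) χ.le_one).trans hz.le
    · have : χ z = 0 := by
        by_contra h'
        exact hz (χ.support_eq ▸ (Function.mem_support.2 h'))
      rw [hΦ]
      simp only [this, zero_smul, norm_zero]
      positivity
  obtain ⟨L, hL⟩ := ContDiff.lipschitzWith_of_hasCompactSupport
    (f := Φ) (χ.hasCompactSupport.smul_right) hΦc (by simp)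
  have hL1 : (0 : ℝ) < L + 1 := by positivity
  obtain ⟨f, ⟨η, hfη, hηc, hη⟩, hf⟩ := (Lp.dense_hasCompactSupport_contDiff (E := ℝ) (F := ℂ)
    (μ := volume) (p := 2) (by norm_num)).exists_dist_lt u₀ (div_pos hε hL1)
  have hgc : ContDiff ℝ ∞ fun x => Φ (η x) := hΦc.comp hη
  have hgs : HasCompactSupport fun x => Φ (η x) := hηc.comp_left hΦ0
  refine ⟨fun x => Φ (η x), hgc, hgs, fun x => hΦb _, ?_⟩
  have hle : ‖toL2 (fun x => Φ (η x)) - u₀‖ ≤ L * ‖f - u₀‖ := by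
    refine Lp.norm_le_mul_norm_of_ae_le_mul ?_
    filter_upwards [Lp.coeFn_sub (toL2 fun x => Φ (η x)) u₀, Lp.coeFn_sub f u₀, hfη, hM,
      coeFn_toL2 (hgc.continuous.memLp_of_hasCompactSupport hgs)] with x h1 h2 h3 h4 h5
    have h6 : Φ (u₀ x) = u₀ x := by
      have : χ (u₀ x) = 1 := χ.one_of_mem_closedBall (by
        rw [mem_closedBall_zero_iff]
        exact h4.trans (le_max_left _ _))
      simp [hΦ, this]
    rw [h1, h2, Pi.sub_apply, Pi.sub_apply, h3, h5]
    nth_rewrite 1 [← h6]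
    exact hL.norm_sub_le _ _
  rw [dist_comm, dist_eq_norm, lt_div_iff₀ hL1] at hf
  nlinarith [norm_nonneg (f - u₀)]

theorem exists_subseq_tendsto_ae {fn : ℕ → L2} {f : L2} (h : Tendsto fn atTop (𝓝 f)) :
    ∃ ns : ℕ → ℕ, StrictMono ns ∧
      ∀ᵐ x, Tendsto (fun i => fn (ns i) x) atTop (𝓝 (f x)) :=
  (tendstoInMeasure_of_tendsto_Lp h).exists_seq_tendsto_ae

/-- Two successive subsequences make both sequences converge almost everywhere, where the inequality
passes to the limit. -/
theorem ae_norm_sq_le_of_tendsto {fn gn : ℕ → L2} {f g : L2} (hf : Tendsto fn atTop (𝓝 f))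
    (hg : Tendsto gn atTop (𝓝 g)) {C : ℝ} (h : ∀ n, ∀ᵐ x, ‖fn n x‖ ^ 2 ≤ C * ‖gn n x‖ ^ 2) :
    ∀ᵐ x, ‖f x‖ ^ 2 ≤ C * ‖g x‖ ^ 2 := by
  obtain ⟨ns, hns, h1⟩ := exists_subseq_tendsto_ae hf
  obtain ⟨ms, hms, h2⟩ := exists_subseq_tendsto_ae (hg.comp hns.tendsto_atTop)
  filter_upwards [h1, h2, ae_all_iff.2 h] with x h3 h4 h5
  exact le_of_tendsto_of_tendsto' ((h3.comp hms.tendsto_atTop).norm.pow 2)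
    ((h4.norm.pow 2).const_mul C) fun i => h5 _

/-- The integral over the moving window is a difference of two integrals with the same limit over a
half-line. -/
theorem tendsto_integral_sub_atTop {f : ℝ → ℝ} (hf : Integrable f) (a b : ℝ) :
    Tendsto (fun t => ∫ x in (a - t)..(b - t), f x) atTop (𝓝 0) := by
  have hlim : ∀ a : ℝ, Tendsto (fun t => ∫ x in (a - t)..0, f x) atTop (𝓝 (∫ x in Iic 0, f x)) :=
    fun a => intervalIntegral_tendsto_integral_Iic 0 hf.integrableOn
      (tendsto_const_nhds.add_atBot tendsto_neg_atTop_atBot)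
  have := (hlim a).sub (hlim b)
  rw [sub_self] at this
  refine this.congr fun t => ?_
  rw [sub_eq_iff_eq_add]
  exact (intervalIntegral.integral_add_adjacent_intervals hf.intervalIntegrable
    hf.intervalIntegrable).symm

theorem tendsto_integral_add_atTop {f : ℝ → ℝ} (hf : Integrable f) (a b : ℝ) :
    Tendsto (fun t => ∫ x in (a + t)..(b + t), f x) atTop (𝓝 0) := by
  have hlim : ∀ a : ℝ, Tendsto (fun t => ∫ x in 0..(a + t), f x) atTop (𝓝 (∫ x in Ioi 0, f x)) :=
    fun a => intervalIntegral_tendsto_integral_Ioi 0 hf.integrableOn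
      (tendsto_const_nhds.add_atTop tendsto_id)
  have := (hlim b).sub (hlim a)
  rw [sub_self] at this
  refine this.congr fun t => ?_
  rw [sub_eq_iff_eq_add']
  exact (intervalIntegral.integral_add_adjacent_intervals hf.intervalIntegrable
    hf.intervalIntegrable).symm

end Approximation

/-! ### Continuous dependence in `L²` for Lipschitz nonlinearities. -/

section Stability

/-- `g` is Lipschitz continuous with constant `L` (for the sum of the norms of the components) and
vanishes at the origin. -/
structure IsLipschitzAtZero (L : ℝ) (g : ℂ → ℂ → ℂ) : Prop where
  nonneg : 0 ≤ L
  continuous : Continuous g.uncurry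
  zero : g 0 0 = 0
  norm_sub_le : ∀ a b a' b', ‖g a b - g a' b'‖ ≤ L * (‖a - a'‖ + ‖b - b'‖)

theorem exists_isLipschitzAtZero {k : (Fin 2 → ℂ) → Fin 2 → ℂ} (hk : ContDiff ℝ ∞ k)
    (hkc : HasCompactSupport k) {c : ℝ} (h : IsAdmissible c (fun u v => k ![u, v] 0)
      (fun u v => k ![u, v] 1)) :
    ∃ L, IsLipschitzAtZero L (fun u v => k ![u, v] 0) ∧
      IsLipschitzAtZero L (fun u v => k ![u, v] 1) := by
  obtain ⟨L, hL⟩ := ContDiff.lipschitzWith_of_hasCompactSupport hkc hk (by simp)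
  have hle : ∀ a b a' b' : ℂ, ∀ i, ‖k ![a, b] i - k ![a', b'] i‖ ≤ L * (‖a - a'‖ + ‖b - b'‖) := by
    intro a b a' b' i
    refine (norm_le_pi_norm (k ![a, b] - k ![a', b']) i).trans ((hL.norm_sub_le _ _).trans ?_)
    gcongr
    refine (pi_norm_le_iff_of_nonneg (by positivity)).2 fun j => ?_
    fin_cases j <;> simp
  exact ⟨L, ⟨L.2, h.contDiff_fst.continuous, h.zero_fst, fun a b a' b' => hle a b a' b' 0⟩,
    ⟨L.2, h.contDiff_snd.continuous, h.zero_snd, fun a b a' b' => hle a b a' b' 1⟩⟩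

theorem IsLipschitzAtZero.memLp {L : ℝ} {g : ℂ → ℂ → ℂ} (h : IsLipschitzAtZero L g) (u v : L2) :
    MemLp (fun x => g (u x) (v x)) 2 volume :=
  memLp_superposition h.continuous
    (fun a b => by simpa [h.zero] using h.norm_sub_le a b 0 0) u v

theorem IsLipschitzAtZero.norm_superposition_sub_le {L : ℝ} {g : ℂ → ℂ → ℂ}
    (h : IsLipschitzAtZero L g) (u v u' v' : L2) :
    ‖superposition g u v - superposition g u' v'‖ ≤ L * (‖u - u'‖ + ‖v - v'‖) :=
  NonlinearDirac.norm_superposition_sub_le h.nonneg h.zero h.norm_sub_le h.continuous u v u' v'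

theorem IsLipschitzAtZero.continuousOn_superposition {L : ℝ} {g : ℂ → ℂ → ℂ}
    (h : IsLipschitzAtZero L g) {u v : ℝ → L2} {S : Set ℝ} (hu : ContinuousOn u S)
    (hv : ContinuousOn v S) : ContinuousOn (fun t => superposition g (u t) (v t)) S := by
  intro t ht
  rw [ContinuousWithinAt, tendsto_iff_norm_sub_tendsto_zero]
  refine squeeze_zero (fun _ => norm_nonneg _)
    (fun τ => h.norm_superposition_sub_le (u τ) (v τ) (u t) (v t)) ?_
  have := ((tendsto_iff_norm_sub_tendsto_zero.1 (hu t ht)).add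
    (tendsto_iff_norm_sub_tendsto_zero.1 (hv t ht))).const_mul L
  simpa using this

/-- `(u, v) ∈ C([0, T]; L²)` solves `u_t + u_x = g₁(u, v)`, `v_t - v_x = g₂(u, v)` in the sense of
distributions. -/
structure IsL2Solution (g₁ g₂ : ℂ → ℂ → ℂ) (T : ℝ) (u v : ℝ → L2) : Prop where
  continuousOn_fst : ContinuousOn u (Icc 0 T)
  continuousOn_snd : ContinuousOn v (Icc 0 T)
  transport_fst : IsTransportSolution 1 T u fun t => superposition g₁ (u t) (v t)
  transport_snd : IsTransportSolution (-1) T v fun t => superposition g₂ (u t) (v t)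

variable {L T : ℝ} {g₁ g₂ : ℂ → ℂ → ℂ}

/-- Continuous dependence on the initial values. -/
theorem IsL2Solution.norm_sub_add_norm_sub_le (h₁ : IsLipschitzAtZero L g₁)
    (h₂ : IsLipschitzAtZero L g₂) {u v u' v' : ℝ → L2} (h : IsL2Solution g₁ g₂ T u v)
    (h' : IsL2Solution g₁ g₂ T u' v') {t : ℝ} (ht : t ∈ Icc 0 T) :
    ‖u t - u' t‖ + ‖v t - v' t‖ ≤
      (‖u 0 - u' 0‖ + ‖v 0 - v' 0‖) * Real.exp (2 * L * t) := by
  have hT : 0 ≤ T := ht.1.trans ht.2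
  have hL := h₁.nonneg
  have c₁ := h₁.continuousOn_superposition h.continuousOn_fst h.continuousOn_snd
  have c₂ := h₂.continuousOn_superposition h.continuousOn_fst h.continuousOn_snd
  have c₁' := h₁.continuousOn_superposition h'.continuousOn_fst h'.continuousOn_snd
  have c₂' := h₂.continuousOn_superposition h'.continuousOn_fst h'.continuousOn_snd
  have d₁ := h.transport_fst.sub hT h'.transport_fst h.continuousOn_fst c₁ h'.continuousOn_fst c₁'
  have d₂ := h.transport_snd.sub hT h'.transport_snd h.continuousOn_snd c₂ h'.continuousOn_snd c₂'
  have hu := h.continuousOn_fst.sub h'.continuousOn_fst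
  have hv := h.continuousOn_snd.sub h'.continuousOn_snd
  have he : ContinuousOn (fun t => ‖u t - u' t‖ + ‖v t - v' t‖) (Icc 0 T) := hu.norm.add hv.norm
  -- The differences solve transport equations whose right-hand sides are Lipschitz in the
  -- differences. Adding the two energy estimates gives the rate `2L`.
  refine le_mul_exp_of_le_add_integral (e := fun t => ‖u t - u' t‖ + ‖v t - v' t‖)
    (by positivity) he (fun t ht => ?_) ht
  have hsub : uIcc 0 t ⊆ Icc 0 T := by
    rw [uIcc_of_le ht.1]
    exact Icc_subset_Icc_right ht.2
  have n₁ := d₁.norm_le hu (c₁.sub c₁') ht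
  have n₂ := d₂.norm_le hv (c₂.sub c₂') ht
  have hei : IntervalIntegrable (fun τ => L * (‖u τ - u' τ‖ + ‖v τ - v' τ‖)) volume 0 t :=
    ((he.mono hsub).const_smul L).intervalIntegrable
  have i₁ := intervalIntegral.integral_mono_on ht.1
      (((c₁.sub c₁').norm.mono hsub).intervalIntegrable)
    hei fun τ _ => h₁.norm_superposition_sub_le (u τ) (v τ) (u' τ) (v' τ)
  have i₂ := intervalIntegral.integral_mono_on ht.1
      (((c₂.sub c₂').norm.mono hsub).intervalIntegrable)
    hei fun τ _ => h₂.norm_superposition_sub_le (u τ) (v τ) (u' τ) (v' τ)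
  have e : ∫ τ in (0 : ℝ)..t, 2 * L * (‖u τ - u' τ‖ + ‖v τ - v' τ‖) =
      2 * ∫ τ in (0 : ℝ)..t, L * (‖u τ - u' τ‖ + ‖v τ - v' τ‖) := by
    rw [← intervalIntegral.integral_const_mul]
    simp only [mul_assoc]
  simp only [Pi.sub_apply] at i₁ i₂
  rw [e]
  linarith

theorem transport_iff_of_ae_eq {u G f : ℝ → ℝ → ℂ} {s T : ℝ} (hT : 0 ≤ T) {φ : ℝ × ℝ → ℂ}
    (hf : ∀ t ∈ Icc 0 T, ∀ᵐ x, f t x = -Complex.I * G t x) :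
    -Complex.I * (∫ t in 0..T, ∫ x, u t x * fderiv ℝ φ (t, x) (1, s)) =
        ∫ t in 0..T, ∫ x, G t x * φ (t, x) ↔
      ∫ t in 0..T, ∫ x, u t x * fderiv ℝ φ (t, x) (1, s) =
        -∫ t in 0..T, ∫ x, f t x * φ (t, x) := by
  have h1 : ∫ t in 0..T, ∫ x, f t x * φ (t, x) =
      -Complex.I * ∫ t in 0..T, ∫ x, G t x * φ (t, x) := by
    rw [← intervalIntegral.integral_const_mul]
    refine intervalIntegral.integral_congr fun t ht => ?_
    rw [uIcc_of_le hT] at ht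
    rw [← integral_const_mul]
    refine integral_congr_ae ?_
    filter_upwards [hf t ht] with x hx
    rw [hx, mul_assoc]
  rw [h1]
  constructor
  · intro h
    rw [← h]
    linear_combination (∫ t in 0..T, ∫ x, u t x * fderiv ℝ φ (t, x) (1, s)) * Complex.I_sq
  · intro h
    rw [h]
    linear_combination -(∫ t in 0..T, ∫ x, G t x * φ (t, x)) * Complex.I_sq

/-- For bounded `u` and `v` the nonlinearity may be replaced by a truncation of it. -/
theorem solvesInDistributions_iff {W : ℂ → ℂ → ℝ} {F₁ F₂ : ℂ → ℂ → ℂ} (hT : 0 ≤ T) {R : ℝ}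
    (h₁ : IsLipschitzAtZero L g₁) (h₂ : IsLipschitzAtZero L g₂)
    (hg : ∀ a b, ‖a‖ ≤ R → ‖b‖ ≤ R →
      g₁ a b = -Complex.I * G₁ W F₁ a b ∧ g₂ a b = -Complex.I * G₂ W F₂ a b)
    {u v : ℝ → L2} (hu : ∀ t ∈ Icc 0 T, ∀ᵐ x, ‖u t x‖ ≤ R)
    (hv : ∀ t ∈ Icc 0 T, ∀ᵐ x, ‖v t x‖ ≤ R) :
    SolvesInDistributions W F₁ F₂ T u v ↔
      IsTransportSolution 1 T u (fun t => superposition g₁ (u t) (v t)) ∧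
        IsTransportSolution (-1) T v fun t => superposition g₂ (u t) (v t) := by
  have a₁ : ∀ t ∈ Icc 0 T, ∀ᵐ x, superposition g₁ (u t) (v t) x =
      -Complex.I * G₁ W F₁ (u t x) (v t x) := fun t ht => by
    filter_upwards [hu t ht, hv t ht, coeFn_toL2 (h₁.memLp (u t) (v t))] with x e1 e2 e3
    rw [superposition, e3, (hg _ _ e1 e2).1]
  have a₂ : ∀ t ∈ Icc 0 T, ∀ᵐ x, superposition g₂ (u t) (v t) x =
      -Complex.I * G₂ W F₂ (u t x) (v t x) := fun t ht => by
    filter_upwards [hu t ht, hv t ht, coeFn_toL2 (h₂.memLp (u t) (v t))] with x e1 e2 e3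
    rw [superposition, e3, (hg _ _ e1 e2).2]
  have hadd : ∀ (φ : ℝ × ℝ → ℂ) z,
      fderiv ℝ φ z (1, 0) + fderiv ℝ φ z (0, 1) = fderiv ℝ φ z (1, 1) := fun φ z => by
    rw [← map_add]; simp
  have hsub : ∀ (φ : ℝ × ℝ → ℂ) z,
      fderiv ℝ φ z (1, 0) - fderiv ℝ φ z (0, 1) = fderiv ℝ φ z (1, -1) := fun φ z => by
    rw [← map_sub]; simp
  simp only [SolvesInDistributions, IsTransportSolution, hadd, hsub, ← forall_and]
  refine forall₂_congr fun φ _ => and_congr ?_ ?_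
  · exact transport_iff_of_ae_eq (u := fun t => u t) hT a₁
  · exact transport_iff_of_ae_eq (u := fun t => v t) hT a₂

end Stability

/-! ### Existence, uniqueness and decay for bounded data of small charge. -/

section GlobalSolution

theorem toL2_coe (u : L2) : toL2 u = u := Lp.ext (coeFn_toL2 (Lp.memLp u))

/-- The strict inequality `‖u₀‖ < δ` leaves room for the approximations to satisfy the same
smallness condition. -/
theorem exists_smooth_sequence {u₀ : L2} {M : ℝ} (hM : ∀ᵐ x, ‖u₀ x‖ ≤ M) {δ : ℝ} (hδ : ‖u₀‖ < δ) :
    ∃ g : ℕ → ℝ → ℂ, (∀ n, ContDiff ℝ ∞ (g n)) ∧ (∀ n, HasCompactSupport (g n)) ∧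
      (∀ n x, ‖g n x‖ ≤ max M 1 + 1) ∧ (∀ n, ∫ x, ‖g n x‖ ^ 2 ≤ δ ^ 2) ∧
      Tendsto (fun n => toL2 (g n)) atTop (𝓝 u₀) := by
  have hε : ∀ n : ℕ, 0 < min (1 / ((n : ℝ) + 1)) (δ - ‖u₀‖) := fun n =>
    lt_min (by positivity) (sub_pos.2 hδ)
  choose g hg hgc hgM hgε using fun n => exists_smooth_approx hM (hε n)
  refine ⟨g, hg, hgc, hgM, fun n => ?_, ?_⟩
  · rw [← norm_toL2_sq ((hg n).continuous.memLp_of_hasCompactSupport (hgc n))]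
    gcongr
    have h1 := (hgε n).trans_le (min_le_right _ _)
    have h2 := norm_sub_norm_le (toL2 (g n)) u₀
    linarith
  · rw [tendsto_iff_norm_sub_tendsto_zero]
    exact squeeze_zero (fun _ => norm_nonneg _) (fun n => (hgε n).le.trans (min_le_left _ _))
      tendsto_one_div_add_atTop_nhds_zero_nat

theorem exists_ae_norm_le {f : ℝ → ℂ} (hf : MemLp f ∞ volume) : ∃ M : ℝ, ∀ᵐ x, ‖f x‖ ≤ M := by
  refine ⟨(eLpNorm f ∞ volume).toReal, ?_⟩
  have h := hf.eLpNorm_ne_top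
  rw [eLpNorm_exponent_top] at h ⊢
  filter_upwards [ae_le_eLpNormEssSup (f := f) (μ := volume)] with x hx
  rw [← toReal_enorm]
  exact ENNReal.toReal_mono h hx

section Slices

variable {a : ℝ × ℝ → ℂ} {g : ℝ → ℂ} {C σ : ℝ}

theorem memLp_slice (ha : Continuous a) (hg : HasCompactSupport g)
    (h : ∀ t x, 0 ≤ t → ‖a (t, x)‖ ^ 2 ≤ C * ‖g (x - σ * t)‖ ^ 2) {t : ℝ} (ht : 0 ≤ t) :
    MemLp (fun x => a (t, x)) 2 volume := by
  refine memLp_of_continuous_of_eq_zero (ha.comp (Continuous.prodMk_right t))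
    (hg.isCompact.image (f := fun y => y + σ * t) (by fun_prop)) fun x hx => ?_
  have h0 : g (x - σ * t) = 0 :=
    image_eq_zero_of_notMem_tsupport fun h' => hx ⟨x - σ * t, h', by simp⟩
  have := h t x ht
  rw [h0] at this
  simpa using this

/-- The bound by translates is finite speed of propagation: for `t ∈ [0, T]` the supports lie in one
compact set, so joint continuity gives continuity in `L²`. -/
theorem continuousOn_toL2_slice (ha : Continuous a) (hg : HasCompactSupport g)
    (h : ∀ t x, 0 ≤ t → ‖a (t, x)‖ ^ 2 ≤ C * ‖g (x - σ * t)‖ ^ 2) (T : ℝ) :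
    ContinuousOn (fun t => toL2 fun x => a (t, x)) (Icc 0 T) := by
  rcases lt_or_ge T 0 with hT | hT
  · simp [Icc_eq_empty_of_lt hT]
  set cl : ℝ → ℝ := fun t => projIcc 0 T hT t with hcl
  have hclc : Continuous cl := continuous_subtype_val.comp continuous_projIcc
  have hclm : ∀ t, cl t ∈ Icc 0 T := fun t => (projIcc 0 T hT t).2
  have hcle : ∀ t ∈ Icc 0 T, cl t = t := fun t ht => by simp [hcl, projIcc_of_mem hT ht]
  refine (Continuous.continuousOn (continuous_toL2 (φ := fun t x => a (cl t, x)) ?_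
    (K := (fun p : ℝ × ℝ => p.1 + σ * p.2) '' (tsupport g ×ˢ Icc 0 T))
    ((hg.isCompact.prod isCompact_Icc).image (by fun_prop)) fun t x hx => ?_)).congr
      fun t ht => by simp only [hcle t ht]
  · change Continuous fun p : ℝ × ℝ => a (cl p.1, p.2)
    fun_prop
  · have h0 : g (x - σ * cl t) = 0 := image_eq_zero_of_notMem_tsupport fun h' =>
      hx ⟨(x - σ * cl t, cl t), ⟨h', hclm t⟩, by simp⟩
    have := h (cl t) x (hclm t).1
    rw [h0] at this
    simpa using this

end Slices

theorem tendstoUniformlyOn_of_norm_sub_le {un : ℕ → ℝ → L2} {u : ℝ → L2} {S : Set ℝ} {r : ℕ → ℝ}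
    (hr : Tendsto r atTop (𝓝 0)) (h : ∀ n, ∀ t ∈ S, ‖un n t - u t‖ ≤ r n) :
    TendstoUniformlyOn un u atTop S := by
  rw [Metric.tendstoUniformlyOn_iff]
  intro ε hε
  filter_upwards [hr.eventually_lt_const hε] with n hn t ht
  rw [dist_comm, dist_eq_norm]
  exact (h n t ht).trans_lt hn

theorem tendsto_toL2_comp_sub {g : ℕ → ℝ → ℂ} {u₀ : L2} (hg : ∀ n, MemLp (g n) 2 volume)
    (h : Tendsto (fun n => toL2 (g n)) atTop (𝓝 u₀)) (y : ℝ) :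
    Tendsto (fun n => toL2 fun x => g n (x - y)) atTop (𝓝 (toL2 fun x => u₀ (x - y))) := by
  have hu := Lp.memLp u₀
  have hs : ∀ {f : ℝ → ℂ}, MemLp f 2 volume → MemLp (fun x => f (x - y)) 2 volume := fun hf =>
    hf.comp_measurePreserving (measurePreserving_sub_right volume y)
  rw [tendsto_iff_norm_sub_tendsto_zero] at h ⊢
  refine h.congr fun n => ?_
  rw [toL2_sub (hs (hg n)) (hs hu), norm_toL2_comp_sub (fun x => g n x - u₀ x) ((hg n).sub hu) y,
    ← toL2_sub (hg n) hu, toL2_coe]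

/-- Passage to the limit in the pointwise bounds for the classical solutions. -/
theorem ae_norm_sq_le_comp_sub {g : ℕ → ℝ → ℂ} {u₀ w : L2} (hg : ∀ n, MemLp (g n) 2 volume)
    (h : Tendsto (fun n => toL2 (g n)) atTop (𝓝 u₀)) {f : ℕ → ℝ → ℂ}
    (hf : ∀ n, MemLp (f n) 2 volume) (hfw : Tendsto (fun n => toL2 (f n)) atTop (𝓝 w)) {C y : ℝ}
    (hle : ∀ n x, ‖f n x‖ ^ 2 ≤ C * ‖g n (x - y)‖ ^ 2) :
    ∀ᵐ x, ‖w x‖ ^ 2 ≤ C * ‖u₀ (x - y)‖ ^ 2 := by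
  have hs : ∀ {f : ℝ → ℂ}, MemLp f 2 volume → MemLp (fun x => f (x - y)) 2 volume := fun hf =>
    hf.comp_measurePreserving (measurePreserving_sub_right volume y)
  have h1 := ae_norm_sq_le_of_tendsto hfw (tendsto_toL2_comp_sub hg h y) (C := C) fun n => by
    filter_upwards [coeFn_toL2 (hf n), coeFn_toL2 (hs (hg n))] with x e1 e2
    rw [e1, e2]
    exact hle n x
  filter_upwards [h1, coeFn_toL2 (hs (Lp.memLp u₀))] with x e1 e2
  rwa [e2] at e1

theorem ae_norm_le_of_sq_le_comp_sub {u₀ w : L2} {M y : ℝ} (hM : ∀ᵐ x, ‖u₀ x‖ ≤ M)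
    (h : ∀ᵐ x, ‖w x‖ ^ 2 ≤ Real.exp 1 * ‖u₀ (x - y)‖ ^ 2) : ∀ᵐ x, ‖w x‖ ≤ 2 * M := by
  filter_upwards [h, (measurePreserving_sub_right volume y).quasiMeasurePreserving.ae hM]
    with x h1 h2
  exact le_two_mul_of_sq_le_exp_one_mul (norm_nonneg _) h2 h1

/-- Existence of a global strong solution, which is bounded by the translated initial values. -/
theorem exists_isGlobalStrongSolution {c δ : ℝ} (hc : 0 < c)
    (hδ : Real.exp 1 * δ ^ 2 * (2 * c) ≤ 1) {W : ℂ → ℂ → ℝ} {F₁ F₂ : ℂ → ℂ → ℂ}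
    (hg : IsAdmissible c (fun u v => -Complex.I * G₁ W F₁ u v)
      (fun u v => -Complex.I * G₂ W F₂ u v)) {u₀ v₀ : L2} {M : ℝ}
    (huM : ∀ᵐ x, ‖u₀ x‖ ≤ M) (hvM : ∀ᵐ x, ‖v₀ x‖ ≤ M) (hu₀ : ‖u₀‖ < δ) (hv₀ : ‖v₀‖ < δ) :
    ∃ u v : ℝ → L2, IsGlobalStrongSolution W F₁ F₂ u₀ v₀ u v ∧
      (∀ t, 0 ≤ t → ∀ᵐ x, ‖u t x‖ ^ 2 ≤ Real.exp 1 * ‖u₀ (x - t)‖ ^ 2) ∧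
      ∀ t, 0 ≤ t → ∀ᵐ x, ‖v t x‖ ^ 2 ≤ Real.exp 1 * ‖v₀ (x + t)‖ ^ 2 := by
  set M' := max M 1 + 1 with hM'
  have hMM' : M ≤ M' := (le_max_left M 1).trans (by linarith)
  obtain ⟨p, hp, hpc, hpM, hpm, hpu⟩ := exists_smooth_sequence huM hu₀
  obtain ⟨q, hq, hqc, hqM, hqm, hqv⟩ := exists_smooth_sequence hvM hv₀
  choose a b ha hb ha0 hb0 hda hdb hMa hMb hea heb using fun n =>
    hg.exists_classical hc hδ (hp n) (hq n) (hpc n) (hqc n) (hpm n) (hqm n) (hpM n) (hqM n)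
  have hpL : ∀ n, MemLp (p n) 2 volume := fun n =>
    (hp n).continuous.memLp_of_hasCompactSupport (hpc n)
  have hqL : ∀ n, MemLp (q n) 2 volume := fun n =>
    (hq n).continuous.memLp_of_hasCompactSupport (hqc n)
  have hda' : ∀ n t x, 0 ≤ t → ‖a n (t, x)‖ ^ 2 ≤ Real.exp 1 * ‖p n (x - 1 * t)‖ ^ 2 :=
    fun n t x ht => by simpa using hda n t x ht
  have hdb' : ∀ n t x, 0 ≤ t → ‖b n (t, x)‖ ^ 2 ≤ Real.exp 1 * ‖q n (x - -1 * t)‖ ^ 2 :=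
    fun n t x ht => by simpa using hdb n t x ht
  have haL : ∀ n t, 0 ≤ t → MemLp (fun x => a n (t, x)) 2 volume := fun n t ht =>
    memLp_slice (ha n).continuous (hpc n) (hda' n) ht
  have hbL : ∀ n t, 0 ≤ t → MemLp (fun x => b n (t, x)) 2 volume := fun n t ht =>
    memLp_slice (hb n).continuous (hqc n) (hdb' n) ht
  -- All approximations obey the same sup bound, so one truncation with one Lipschitz constant
  -- serves every `n` and every `T`.
  obtain ⟨k, hk, hkc, hka, hkg⟩ := hg.exists_truncation hc.le (2 * M')
  obtain ⟨L, hL₁, hL₂⟩ := exists_isLipschitzAtZero hk hkc hka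
  set un : ℕ → ℝ → L2 := fun n t => toL2 fun x => a n (t, x) with hun
  set vn : ℕ → ℝ → L2 := fun n t => toL2 fun x => b n (t, x) with hvn
  have hsol : ∀ n T, 0 ≤ T → IsL2Solution (fun u v => k ![u, v] 0) (fun u v => k ![u, v] 1) T
      (un n) (vn n) := by
    intro n T hT
    refine ⟨continuousOn_toL2_slice (ha n).continuous (hpc n) (hda' n) T,
      continuousOn_toL2_slice (hb n).continuous (hqc n) (hdb' n) T,
      isTransportSolution_of_contDiff hT (ha n) (fun t ht => coeFn_toL2 (haL n t ht.1))
        fun t ht => ?_,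
      isTransportSolution_of_contDiff hT (hb n) (fun t ht => coeFn_toL2 (hbL n t ht.1))
        fun t ht => ?_⟩
    · filter_upwards [coeFn_toL2 (hL₁.memLp (un n t) (vn n t)), coeFn_toL2 (haL n t ht.1),
        coeFn_toL2 (hbL n t ht.1)] with x e1 e2 e3
      rw [superposition, e1, hun, hvn, e2, e3, hea n t x ht.1]
      exact (hkg _ _ (hMa n t x ht.1) (hMb n t x ht.1)).1
    · filter_upwards [coeFn_toL2 (hL₂.memLp (un n t) (vn n t)), coeFn_toL2 (haL n t ht.1),
        coeFn_toL2 (hbL n t ht.1)] with x e1 e2 e3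
      rw [superposition, e1, hun, hvn, e2, e3, heb n t x ht.1]
      exact (hkg _ _ (hMa n t x ht.1) (hMb n t x ht.1)).2
  have hstab : ∀ n m t, 0 ≤ t → ‖un n t - un m t‖ + ‖vn n t - vn m t‖ ≤
      (‖un n 0 - un m 0‖ + ‖vn n 0 - vn m 0‖) * Real.exp (2 * L * t) := fun n m t ht =>
    (hsol n t ht).norm_sub_add_norm_sub_le hL₁ hL₂ (hsol m t ht) (right_mem_Icc.2 ht)
  have hun0 : Tendsto (fun n => un n 0) atTop (𝓝 u₀) := by simpa only [hun, ha0] using hpu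
  have hvn0 : Tendsto (fun n => vn n 0) atTop (𝓝 v₀) := by simpa only [hvn, hb0] using hqv
  have hcauchy : ∀ t, 0 ≤ t → Tendsto (fun n : ℕ × ℕ =>
      (‖un n.1 0 - un n.2 0‖ + ‖vn n.1 0 - vn n.2 0‖) * Real.exp (2 * L * t)) atTop (𝓝 0) := by
    intro t _
    have h1 := cauchySeq_iff_tendsto_dist_atTop_0.1 hun0.cauchySeq
    have h2 := cauchySeq_iff_tendsto_dist_atTop_0.1 hvn0.cauchySeq
    simp only [dist_eq_norm] at h1 h2
    simpa using (h1.add h2).mul_const (Real.exp (2 * L * t))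
  have hexu : ∀ t, ∃ w : L2, 0 ≤ t → Tendsto (fun n => un n t) atTop (𝓝 w) := fun t => by
    by_cases ht : 0 ≤ t
    · obtain ⟨w, hw⟩ := cauchySeq_tendsto_of_complete (u := fun n => un n t)
        (cauchySeq_iff_tendsto_dist_atTop_0.2 (squeeze_zero (fun _ => dist_nonneg)
          (fun n => by
            rw [dist_eq_norm]
            exact (le_add_of_nonneg_right (norm_nonneg _)).trans (hstab n.1 n.2 t ht))
          (hcauchy t ht)))
      exact ⟨w, fun _ => hw⟩
    · exact ⟨0, fun h => absurd h ht⟩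
  have hexv : ∀ t, ∃ w : L2, 0 ≤ t → Tendsto (fun n => vn n t) atTop (𝓝 w) := fun t => by
    by_cases ht : 0 ≤ t
    · obtain ⟨w, hw⟩ := cauchySeq_tendsto_of_complete (u := fun n => vn n t)
        (cauchySeq_iff_tendsto_dist_atTop_0.2 (squeeze_zero (fun _ => dist_nonneg)
          (fun n => by
            rw [dist_eq_norm]
            exact (le_add_of_nonneg_left (norm_nonneg _)).trans (hstab n.1 n.2 t ht))
          (hcauchy t ht)))
      exact ⟨w, fun _ => hw⟩
    · exact ⟨0, fun h => absurd h ht⟩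
  choose u hu using hexu
  choose v hv using hexv
  -- Let `m → ∞` in `hstab`; the rate is locally uniform in time.
  have htail : ∀ n t, 0 ≤ t → ‖un n t - u t‖ + ‖vn n t - v t‖ ≤
      (‖un n 0 - u₀‖ + ‖vn n 0 - v₀‖) * Real.exp (2 * L * t) := fun n t ht =>
    le_of_tendsto_of_tendsto'
      (((tendsto_const_nhds.sub (hu t ht)).norm).add ((tendsto_const_nhds.sub (hv t ht)).norm))
      ((((tendsto_const_nhds.sub hun0).norm).add
        ((tendsto_const_nhds.sub hvn0).norm)).mul_const _) fun m => hstab n m t ht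
  have hrate : ∀ T, Tendsto (fun n => (‖un n 0 - u₀‖ + ‖vn n 0 - v₀‖) * Real.exp (2 * L * T))
      atTop (𝓝 0) := fun T => by
    simpa using ((tendsto_iff_norm_sub_tendsto_zero.1 hun0).add
      (tendsto_iff_norm_sub_tendsto_zero.1 hvn0)).mul_const (Real.exp (2 * L * T))
  have hrateT : ∀ T n, ∀ t ∈ Icc 0 T, ‖un n t - u t‖ + ‖vn n t - v t‖ ≤
      (‖un n 0 - u₀‖ + ‖vn n 0 - v₀‖) * Real.exp (2 * L * T) := fun T n t ht => by
    have := hL₁.nonneg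
    refine (htail n t ht.1).trans ?_
    gcongr
    exact ht.2
  have huu : ∀ T, TendstoUniformlyOn un u atTop (Icc 0 T) := fun T =>
    tendstoUniformlyOn_of_norm_sub_le (hrate T) fun n t ht =>
      (le_add_of_nonneg_right (norm_nonneg _)).trans (hrateT T n t ht)
  have hvv : ∀ T, TendstoUniformlyOn vn v atTop (Icc 0 T) := fun T =>
    tendstoUniformlyOn_of_norm_sub_le (hrate T) fun n t ht =>
      (le_add_of_nonneg_left (norm_nonneg _)).trans (hrateT T n t ht)
  have hsup : ∀ T {g : ℂ → ℂ → ℂ}, IsLipschitzAtZero L g →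
      TendstoUniformlyOn (fun n t => superposition g (un n t) (vn n t))
        (fun t => superposition g (u t) (v t)) atTop (Icc 0 T) := fun T g hgL =>
    tendstoUniformlyOn_of_norm_sub_le (by simpa using (hrate T).const_mul L) fun n t ht =>
      (hgL.norm_superposition_sub_le _ _ _ _).trans
        (mul_le_mul_of_nonneg_left (hrateT T n t ht) hgL.nonneg)
  have huc : ∀ T, 0 ≤ T → ContinuousOn u (Icc 0 T) := fun T hT =>
    (huu T).continuousOn (Frequently.of_forall fun n => (hsol n T hT).continuousOn_fst)
  have hvc : ∀ T, 0 ≤ T → ContinuousOn v (Icc 0 T) := fun T hT =>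
    (hvv T).continuousOn (Frequently.of_forall fun n => (hsol n T hT).continuousOn_snd)
  have hIci : ∀ {w : ℝ → L2}, (∀ T, 0 ≤ T → ContinuousOn w (Icc 0 T)) →
      ContinuousOn w (Ici 0) := by
    intro w hw t ht
    have ht' : 0 ≤ t := ht
    refine ((hw (t + 1) (by linarith)) t ⟨ht', by linarith⟩).mono_of_mem_nhdsWithin ?_
    refine mem_nhdsWithin.2 ⟨Iio (t + 1), isOpen_Iio, by simp, fun s hs => ⟨hs.2, ?_⟩⟩
    exact le_of_lt hs.1
  have hub : ∀ t, 0 ≤ t → ∀ᵐ x, ‖u t x‖ ^ 2 ≤ Real.exp 1 * ‖u₀ (x - t)‖ ^ 2 := fun t ht =>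
    ae_norm_sq_le_comp_sub hpL hpu (fun n => haL n t ht) (hu t ht) fun n x => hda n t x ht
  have hvb' : ∀ t, 0 ≤ t → ∀ᵐ x, ‖v t x‖ ^ 2 ≤ Real.exp 1 * ‖v₀ (x - -t)‖ ^ 2 := fun t ht =>
    ae_norm_sq_le_comp_sub hqL hqv (fun n => hbL n t ht) (hv t ht) fun n x => by
      simpa using hdb n t x ht
  have hvb : ∀ t, 0 ≤ t → ∀ᵐ x, ‖v t x‖ ^ 2 ≤ Real.exp 1 * ‖v₀ (x + t)‖ ^ 2 := fun t ht => by
    simpa using hvb' t ht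
  have huR : ∀ t, 0 ≤ t → ∀ᵐ x, ‖u t x‖ ≤ 2 * M' := fun t ht =>
    ae_norm_le_of_sq_le_comp_sub (huM.mono fun x hx => hx.trans hMM') (hub t ht)
  have hvR : ∀ t, 0 ≤ t → ∀ᵐ x, ‖v t x‖ ≤ 2 * M' := fun t ht =>
    ae_norm_le_of_sq_le_comp_sub (hvM.mono fun x hx => hx.trans hMM') (hvb' t ht)
  refine ⟨u, v, ⟨⟨hIci huc, _, huR⟩, ⟨hIci hvc, _, hvR⟩, fun T hT => ?_, fun T hT => ?_⟩, hub, hvb⟩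
  · exact ⟨un, vn, fun n => ⟨(hsol n T hT.le).continuousOn_fst, (hsol n T hT.le).continuousOn_snd,
      fun t x => a n (t, x), fun t x => b n (t, x),
      isClassicalSolution_of_fderiv hT (ha n) (hb n) (hea n) (heb n),
      fun t ht => ⟨coeFn_toL2 (haL n t ht.1), coeFn_toL2 (hbL n t ht.1)⟩⟩,
      huu T, hvv T, hun0, hvn0⟩
  · refine (solvesInDistributions_iff hT.le hL₁ hL₂ hkg (fun t ht => huR t ht.1)
      fun t ht => hvR t ht.1).2 ⟨?_, ?_⟩
    · exact IsTransportSolution.of_tendsto hT.le (fun n => (hsol n T hT.le).transport_fst)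
        (fun n => (hsol n T hT.le).continuousOn_fst)
        (fun n => hL₁.continuousOn_superposition (hsol n T hT.le).continuousOn_fst
          (hsol n T hT.le).continuousOn_snd) (huu T) (hsup T hL₁)
    · exact IsTransportSolution.of_tendsto hT.le (fun n => (hsol n T hT.le).transport_snd)
        (fun n => (hsol n T hT.le).continuousOn_snd)
        (fun n => hL₂.continuousOn_superposition (hsol n T hT.le).continuousOn_fst
          (hsol n T hT.le).continuousOn_snd) (hvv T) (hsup T hL₂)

/-- The initial condition is encoded in the approximating sequence: its values at time zero converge
both to `(u 0, v 0)` and to `(u₀, v₀)`. -/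
theorem IsGlobalStrongSolution.initial {W : ℂ → ℂ → ℝ} {F₁ F₂ : ℂ → ℂ → ℂ} {u₀ v₀ : L2}
    {u v : ℝ → L2} (h : IsGlobalStrongSolution W F₁ F₂ u₀ v₀ u v) : u 0 = u₀ ∧ v 0 = v₀ := by
  obtain ⟨un, vn, -, hu, hv, hu₀, hv₀⟩ := h.limit 1 one_pos
  have h0 : (0 : ℝ) ∈ Icc (0 : ℝ) 1 := by simp
  exact ⟨tendsto_nhds_unique (hu.tendsto_at h0) hu₀, tendsto_nhds_unique (hv.tendsto_at h0) hv₀⟩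

/-- Uniqueness of global strong solutions. -/
theorem IsGlobalStrongSolution.eq {c : ℝ} (hc : 0 ≤ c) {W : ℂ → ℂ → ℝ} {F₁ F₂ : ℂ → ℂ → ℂ}
    (hg : IsAdmissible c (fun u v => -Complex.I * G₁ W F₁ u v)
      (fun u v => -Complex.I * G₂ W F₂ u v)) {u₀ v₀ : L2} {u v u' v' : ℝ → L2}
    (h : IsGlobalStrongSolution W F₁ F₂ u₀ v₀ u v)
    (h' : IsGlobalStrongSolution W F₁ F₂ u₀ v₀ u' v') {t : ℝ} (ht : 0 ≤ t) :
    u' t = u t ∧ v' t = v t := by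
  obtain ⟨hu, R₁, hR₁⟩ := h.space_fst
  obtain ⟨hv, R₂, hR₂⟩ := h.space_snd
  obtain ⟨hu', R₃, hR₃⟩ := h'.space_fst
  obtain ⟨hv', R₄, hR₄⟩ := h'.space_snd
  -- Beyond this radius the nonlinearity is irrelevant to both solutions, so they solve the same
  -- Lipschitz system and continuous dependence applies.
  set R := max (max R₁ R₂) (max R₃ R₄)
  obtain ⟨k, hk, hkc, hka, hkg⟩ := hg.exists_truncation hc R
  obtain ⟨L, hL₁, hL₂⟩ := exists_isLipschitzAtZero hk hkc hka
  have hsub : Icc 0 (t + 1) ⊆ Ici 0 := Icc_subset_Ici_self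
  -- An interval of positive length is needed even when `t = 0`.
  have hT : 0 < t + 1 := by linarith
  have h1 := (solvesInDistributions_iff hT.le hL₁ hL₂ hkg
    (fun t ht => (hR₁ t ht.1).mono fun x hx =>
      hx.trans ((le_max_left _ _).trans (le_max_left _ _)))
    (fun t ht => (hR₂ t ht.1).mono fun x hx =>
      hx.trans ((le_max_right _ _).trans (le_max_left _ _)))).1 (h.solves _ hT)
  have h2 := (solvesInDistributions_iff hT.le hL₁ hL₂ hkg
    (fun t ht => (hR₃ t ht.1).mono fun x hx =>
      hx.trans ((le_max_left _ _).trans (le_max_right _ _)))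
    (fun t ht => (hR₄ t ht.1).mono fun x hx =>
      hx.trans ((le_max_right _ _).trans (le_max_right _ _)))).1 (h'.solves _ hT)
  have s1 : IsL2Solution _ _ (t + 1) u v := ⟨hu.mono hsub, hv.mono hsub, h1.1, h1.2⟩
  have s2 : IsL2Solution _ _ (t + 1) u' v' := ⟨hu'.mono hsub, hv'.mono hsub, h2.1, h2.2⟩
  have hle := s2.norm_sub_add_norm_sub_le hL₁ hL₂ s1 (t := t) ⟨ht, by linarith⟩
  rw [h.initial.1, h.initial.2, h'.initial.1, h'.initial.2] at hle
  simp only [sub_self, norm_zero, add_zero, zero_mul] at hle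
  have n1 := norm_nonneg (u' t - u t)
  have n2 := norm_nonneg (v' t - v t)
  exact ⟨sub_eq_zero.1 (norm_eq_zero.1 (by linarith)),
    sub_eq_zero.1 (norm_eq_zero.1 (by linarith))⟩

/-- Decay of the local charge of functions bounded by translates of the initial values. -/
theorem tendsto_local_charge {u₀ v₀ : L2} {u v : ℝ → L2} {C : ℝ}
    (hu : ∀ t, 0 ≤ t → ∀ᵐ x, ‖u t x‖ ^ 2 ≤ C * ‖u₀ (x - t)‖ ^ 2)
    (hv : ∀ t, 0 ≤ t → ∀ᵐ x, ‖v t x‖ ^ 2 ≤ C * ‖v₀ (x + t)‖ ^ 2) {a b : ℝ} (hab : a ≤ b) :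
    Tendsto (fun t : ℝ => ∫ x in a..b, (‖u t x‖ ^ 2 + ‖v t x‖ ^ 2)) atTop (𝓝 0) := by
  have h1 := (tendsto_integral_sub_atTop (integrable_norm_sq u₀) a b).const_mul C
  have h2 := (tendsto_integral_add_atTop (integrable_norm_sq v₀) a b).const_mul C
  have h3 := h1.add h2
  rw [mul_zero, add_zero] at h3
  refine squeeze_zero' (Eventually.of_forall fun t =>
    intervalIntegral.integral_nonneg hab fun x _ => by positivity) ?_ h3
  filter_upwards [eventually_ge_atTop 0] with t ht
  have i₁ : Integrable fun x => C * ‖u₀ (x - t)‖ ^ 2 :=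
    ((integrable_norm_sq u₀).comp_sub_right t).const_mul C
  have i₂ : Integrable fun x => C * ‖v₀ (x + t)‖ ^ 2 :=
    ((integrable_norm_sq v₀).comp_add_right t).const_mul C
  calc ∫ x in a..b, (‖u t x‖ ^ 2 + ‖v t x‖ ^ 2)
      ≤ ∫ x in a..b, (C * ‖u₀ (x - t)‖ ^ 2 + C * ‖v₀ (x + t)‖ ^ 2) := by
        refine intervalIntegral.integral_mono_ae hab
          ((integrable_norm_sq _).add (integrable_norm_sq _)).intervalIntegrable
          (i₁.add i₂).intervalIntegrable ?_
        filter_upwards [hu t ht, hv t ht] with x e1 e2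
        exact add_le_add e1 e2
    _ = _ := by
        rw [intervalIntegral.integral_add i₁.intervalIntegrable i₂.intervalIntegrable,
          intervalIntegral.integral_const_mul, intervalIntegral.integral_const_mul,
          intervalIntegral.integral_comp_sub_right (fun x => ‖u₀ x‖ ^ 2),
          intervalIntegral.integral_comp_add_right (fun x => ‖v₀ x‖ ^ 2)]

end GlobalSolution

end NonlinearDirac

end

theorem theorem1p1 :
    -- the Thirring, Federbusch and Gross-Neveu models belong to the class
    (∀ α : ℝ,
      (NonlinearDirac.A1 (NonlinearDirac.thirringW α) ∧
        ∃ c : ℝ, 0 < c ∧ NonlinearDirac.A2 c (fun _ _ => 0) (fun _ _ => 0)) ∧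
      (NonlinearDirac.A1 (NonlinearDirac.federbuschW α) ∧
        ∃ c : ℝ, 0 < c ∧ NonlinearDirac.A2 c (fun _ _ => 0) (fun _ _ => 0)) ∧
      (NonlinearDirac.A1 (fun _ _ => 0) ∧
        ∃ c : ℝ, 0 < c ∧
          NonlinearDirac.A2 c (NonlinearDirac.grossNeveuF₁ α) (NonlinearDirac.grossNeveuF₂ α))) ∧
    -- existence, uniqueness and decay of the local charge
    (∀ c : ℝ, 0 < c → ∃ δ : ℝ, 0 < δ ∧
      ∀ (W : ℂ → ℂ → ℝ) (F₁ F₂ : ℂ → ℂ → ℂ),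
        NonlinearDirac.A1 W → NonlinearDirac.A2 c F₁ F₂ →
      ∀ u₀ v₀ : NonlinearDirac.L2,
        MemLp (u₀ : ℝ → ℂ) ∞ volume → MemLp (v₀ : ℝ → ℂ) ∞ volume → ‖u₀‖ + ‖v₀‖ < δ →
      ∃ u v : ℝ → NonlinearDirac.L2,
        NonlinearDirac.IsGlobalStrongSolution W F₁ F₂ u₀ v₀ u v ∧
        (∀ u' v' : ℝ → NonlinearDirac.L2,
          NonlinearDirac.IsGlobalStrongSolution W F₁ F₂ u₀ v₀ u' v' →
          ∀ t : ℝ, 0 ≤ t → u' t = u t ∧ v' t = v t) ∧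
        (∀ a b : ℝ, a < b →
          Tendsto (fun t : ℝ => ∫ x in a..b, (‖u t x‖ ^ 2 + ‖v t x‖ ^ 2)) atTop (𝓝 0))) := by
  refine ⟨fun α => ⟨⟨NonlinearDirac.a1_thirringW α, 1, one_pos, NonlinearDirac.a2_zero⟩,
    ⟨NonlinearDirac.a1_federbuschW α, 1, one_pos, NonlinearDirac.a2_zero⟩,
    NonlinearDirac.a1_zero, 8 * |α| + 1, by positivity, NonlinearDirac.a2_grossNeveu α⟩, ?_⟩
  intro c hc
  have he := Real.exp_pos 1
  -- This is the value with `2c e δ² = 1`, the threshold of the a priori bound when the mass bound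
  -- is `m = δ²`.
  refine ⟨Real.sqrt (1 / (Real.exp 1 * (2 * c))), by positivity, ?_⟩
  intro W F₁ F₂ hW hF u₀ v₀ hu₀ hv₀ hsmall
  have hg := NonlinearDirac.isAdmissible hW hF
  have hδ : Real.exp 1 * Real.sqrt (1 / (Real.exp 1 * (2 * c))) ^ 2 * (2 * c) ≤ 1 := by
    rw [Real.sq_sqrt (by positivity)]
    apply le_of_eq
    field_simp
  obtain ⟨M₁, hM₁⟩ := NonlinearDirac.exists_ae_norm_le hu₀
  obtain ⟨M₂, hM₂⟩ := NonlinearDirac.exists_ae_norm_le hv₀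
  obtain ⟨u, v, huv, hu, hv⟩ := NonlinearDirac.exists_isGlobalStrongSolution hc hδ hg
    (hM₁.mono fun x hx => hx.trans (le_max_left M₁ M₂))
    (hM₂.mono fun x hx => hx.trans (le_max_right M₁ M₂))
    ((le_add_of_nonneg_right (norm_nonneg _)).trans_lt hsmall)
    ((le_add_of_nonneg_left (norm_nonneg _)).trans_lt hsmall)
  exact ⟨u, v, huv, fun u' v' h' t ht => huv.eq hc.le hg h' ht,
    fun a b hab => NonlinearDirac.tendsto_local_charge hu hv hab.le⟩
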